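/- Let $n$ items be partitioned into nonempty parts, $[n]=T_1\cup\dots\cup T_m$, and let first-stage costs $C\in\mathbb R_{\ge0}^n$, lower bounds $\underline c\in\mathbb R_{\ge0}^n$, deviations $d\in\mathbb R_{\ge0}^n$ and a budget $\Gamma\in\mathbb R_{\ge0}$ be given. Put $$U=\Big\{c\in\mathbb R_{\ge0}^n:\ \exists\,\delta\in[0,1]^n,\ c_i=\underline c_i+d_i\delta_i\ \forall i,\ \sum_i\delta_i\le\Gamma\Big\},\qquad X'=\Big\{x\in\{0,1\}^n:\ \sum_{i\in T_j}x_i\le1\ \forall j\Big\},$$ $$Y(x)=\Big\{y\in\{0,1\}^n:\ \sum_{i\in T_j}(x_i+y_i)=1\ \forall j,\ x_i+y_i\le1\ \forall i\Big\}.$$ The two-stage robust representative selection problem with continuous budgeted uncertainty (2RS-C) is $$\min_{x\in X'}\Big(\sum_i C_ix_i+\max_{c\in U}\min_{y\in Y(x)}\sum_i c_iy_i\Big),$$ or, as a mixed-integer program, $$\min\ \sum_i C_ix_i+\sum_i\underline c_iy_i+\Gamma\pi+\sum_i\rho_i\quad\text{s.t.}\quad \sum_{i\in T_j}(x_i+y_i)=1\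 \forall j,\quad x_i+y_i\le1,\ \ \pi+\rho_i\ge d_iy_i\ \forall i,$$ with $x\in\{0,1\}^n$, $y\in[0,1]^n$, $\pi\ge0$, $\rho\in\mathbb R^n_{\ge0}$. For $\pi\ge0$ let $$f_j(\pi)=\min\Big\{\sum_{i\in T_j}(\underline c_iy_i+\rho_i):\ \sum_{i\in T_j}y_i=1,\ \pi+\rho_i\ge d_iy_i,\ y_i\in[0,1],\ \rho_i\ge0\Big\},\qquad f(\pi)=\Gamma\pi+\sum_{j=1}^m\min\Big\{\min_{k\in T_j}C_k,\ f_j(\pi)\Big\}.$$ **Theorem.** (2RS-C) can be solved in $O(n\log n)$ time: there is one program for the real RAM (unit-cost arithmetic and comparisons of reals, unit-cost addition, subtraction and comparison of integers, indirect addressing) which on every instance with $n$ items halts after at most $t(n)=O(n\log n)$ steps and outputs the optimal value, an optimal first-stage selection $x$ of the two-stage problem, and a number $\pi$ such that $x$ and $\pi$ belong to an optimal solution of the mixed-integer program, which has the same optimal value. Moreover, this optimal value is $\min_{\pi\ge0}f(\pi)$; the value $f_j(\pi)$ is the optimal value of the continuous minimum knapsack problem $$\min\ \sum_{i\in T_j}\underline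 c_i\pi_i\underline z_i+\sum_{i\in T_j}(\underline c_i+d_i)(1-\pi_i)\overline z_i\quad\text{s.t.}\quad\sum_{i\in T_j}\big(\pi_i\underline z_i+(1-\pi_i)\overline z_i\big)=1,\quad \underline z_i,\overline z_i\in[0,1],$$ where $\pi_i=\min\{1,\pi/d_i\}$, and $\pi_i=1$ if $d_i=0$; the function $f$ is continuous and piecewise linear on $[0,\infty)$, all its breakpoints lie in a set of $O(n)$ numbers (with an absolute constant), and the program outputs such a set as well. -/

import Mathlib

/-! ### A real RAM

Memory consists of integer cells and real cells, organised in arrays `0, 1, 2, …` whose cells are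
addressed by natural numbers (indirect addressing); a program mentions finitely many arrays.
There is no conversion between real and integer cells, no rounding, and no real literal other than
natural numbers.  Every operation (literal, memory read or write, arithmetic, comparison,
Boolean connective, branch) costs one time unit. -/

namespace RealRAM

/-- The memory of the machine. `int a i` is cell `i` of integer array `a`, and `real a i` is
cell `i` of real array `a`. -/
@[ext]
structure State where
  int : ℕ → ℕ → ℕ
  real : ℕ → ℕ → ℝ

/-- Write `v` into cell `i` of integer array `a`. -/
def State.setInt (s : State) (a i v : ℕ) : State :=
  { s with int := Function.update s.int a (Function.update (s.int a) i v) }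

/-- Write `v` into cell `i` of real array `a`. -/
noncomputable def State.setReal (s : State) (a i : ℕ) (v : ℝ) : State :=
  { s with real := Function.update s.real a (Function.update (s.real a) i v) }

/-- Integer expressions (subtraction is truncated at `0`). -/
inductive IExp where
  | lit (k : ℕ)
  | get (a : ℕ) (i : IExp)
  | add (e₁ e₂ : IExp)
  | sub (e₁ e₂ : IExp)

def IExp.eval (s : State) : IExp → ℕ
  | lit k => k
  | get a i => s.int a (i.eval s)
  | add e₁ e₂ => e₁.eval s + e₂.eval s
  | sub e₁ e₂ => e₁.eval s - e₂.eval s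

/-- Number of operations performed when evaluating an integer expression. -/
def IExp.cost : IExp → ℕ
  | lit _ => 1
  | get _ i => i.cost + 1
  | add e₁ e₂ => e₁.cost + e₂.cost + 1
  | sub e₁ e₂ => e₁.cost + e₂.cost + 1

/-- Real expressions (a division by `0` returns `0`). -/
inductive RExp where
  | lit (k : ℕ)
  | get (a : ℕ) (i : IExp)
  | add (e₁ e₂ : RExp)
  | sub (e₁ e₂ : RExp)
  | mul (e₁ e₂ : RExp)
  | div (e₁ e₂ : RExp)

noncomputable def RExp.eval (s : State) : RExp → ℝ
  | lit k => k
  | get a i => s.real a (i.eval s)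
  | add e₁ e₂ => e₁.eval s + e₂.eval s
  | sub e₁ e₂ => e₁.eval s - e₂.eval s
  | mul e₁ e₂ => e₁.eval s * e₂.eval s
  | div e₁ e₂ => e₁.eval s / e₂.eval s

/-- Number of operations performed when evaluating a real expression. -/
def RExp.cost : RExp → ℕ
  | lit _ => 1
  | get _ i => i.cost + 1
  | add e₁ e₂ => e₁.cost + e₂.cost + 1
  | sub e₁ e₂ => e₁.cost + e₂.cost + 1
  | mul e₁ e₂ => e₁.cost + e₂.cost + 1
  | div e₁ e₂ => e₁.cost + e₂.cost + 1

/-- Tests. -/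
inductive Test where
  | intLE (e₁ e₂ : IExp)
  | realLE (e₁ e₂ : RExp)
  | not (b : Test)
  | and (b₁ b₂ : Test)

def Test.Holds (s : State) : Test → Prop
  | intLE e₁ e₂ => e₁.eval s ≤ e₂.eval s
  | realLE e₁ e₂ => e₁.eval s ≤ e₂.eval s
  | not b => ¬ b.Holds s
  | and b₁ b₂ => b₁.Holds s ∧ b₂.Holds s

/-- Number of operations performed when evaluating a test. -/
def Test.cost : Test → ℕ
  | intLE e₁ e₂ => e₁.cost + e₂.cost + 1
  | realLE e₁ e₂ => e₁.cost + e₂.cost + 1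
  | not b => b.cost + 1
  | and b₁ b₂ => b₁.cost + b₂.cost + 1

/-- Programs. -/
inductive Prog where
  | skip
  | setInt (a : ℕ) (i v : IExp)
  | setReal (a : ℕ) (i : IExp) (v : RExp)
  | seq (p q : Prog)
  | ite (b : Test) (p q : Prog)
  | while (b : Test) (p : Prog)

/-- `Exec p s s' t`: started in memory `s`, the program `p` halts in memory `s'` after exactly
`t` time units. -/
inductive Exec : Prog → State → State → ℕ → Prop where
  | skip (s : State) : Exec Prog.skip s s 1
  | setInt (a : ℕ) (i v : IExp) (s : State) :
      Exec (Prog.setInt a i v) s (s.setInt a (i.eval s) (v.eval s)) (i.cost + v.cost + 1)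
  | setReal (a : ℕ) (i : IExp) (v : RExp) (s : State) :
      Exec (Prog.setReal a i v) s (s.setReal a (i.eval s) (v.eval s)) (i.cost + v.cost + 1)
  | seq {p q : Prog} {s s' s'' : State} {t t' : ℕ} :
      Exec p s s' t → Exec q s' s'' t' → Exec (Prog.seq p q) s s'' (t + t')
  | ite_true {b : Test} {p q : Prog} {s s' : State} {t : ℕ} :
      b.Holds s → Exec p s s' t → Exec (Prog.ite b p q) s s' (b.cost + 1 + t)
  | ite_false {b : Test} {p q : Prog} {s s' : State} {t : ℕ} :
      ¬ b.Holds s → Exec q s s' t → Exec (Prog.ite b p q) s s' (b.cost + 1 + t)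
  | while_false {b : Test} {p : Prog} {s : State} :
      ¬ b.Holds s → Exec (Prog.while b p) s s (b.cost + 1)
  | while_true {b : Test} {p : Prog} {s s' s'' : State} {t t' : ℕ} :
      b.Holds s → Exec p s s' t → Exec (Prog.while b p) s' s'' t' →
      Exec (Prog.while b p) s s'' (b.cost + 1 + t + t')

end RealRAM

/-! ### Two-stage robust representative selection, continuous budgeted uncertainty -/

namespace RepSel

/-- An instance with `n` items, partitioned into the `m` nonempty parts
`T j = {i | part i = j}`. -/
structure Instance (n m : ℕ) where
  /-- the index of the part that contains an item -/
  part : Fin n → Fin m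
  part_surjective : Function.Surjective part
  /-- first-stage costs -/
  C : Fin n → ℝ
  /-- lower bounds of the second-stage costs -/
  cLow : Fin n → ℝ
  /-- maximal deviations of the second-stage costs -/
  d : Fin n → ℝ
  /-- budget of the adversary -/
  Γ : ℝ
  C_nonneg : ∀ i, 0 ≤ C i
  cLow_nonneg : ∀ i, 0 ≤ cLow i
  d_nonneg : ∀ i, 0 ≤ d i
  Γ_nonneg : 0 ≤ Γ

namespace Instance

variable {n m : ℕ} (I : Instance n m)

/-- The part `T j`. -/
def T (j : Fin m) : Finset (Fin n) := Finset.univ.filter fun i => I.part i = j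

theorem T_nonempty (j : Fin m) : (I.T j).Nonempty := by
  obtain ⟨i, hi⟩ := I.part_surjective j
  exact ⟨i, by simp [T, hi]⟩

/-- The continuous budgeted uncertainty set. -/
def U : Set (Fin n → ℝ) :=
  {c | (∀ i, 0 ≤ c i) ∧ ∃ δ : Fin n → ℝ, (∀ i, 0 ≤ δ i ∧ δ i ≤ 1) ∧
    (∀ i, c i = I.cLow i + I.d i * δ i) ∧ ∑ i, δ i ≤ I.Γ}

/-- The feasible first-stage selections, as vectors in `{0,1}ⁿ`. -/
def X : Set (Fin n → ℝ) :=
  {x | (∀ i, x i = 0 ∨ x i = 1) ∧ ∀ j, ∑ i ∈ I.T j, x i ≤ 1}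

/-- The feasible second-stage selections for a first-stage selection `x`. -/
def Y (x : Fin n → ℝ) : Set (Fin n → ℝ) :=
  {y | (∀ i, y i = 0 ∨ y i = 1) ∧ (∀ j, ∑ i ∈ I.T j, (x i + y i) = 1) ∧ ∀ i, x i + y i ≤ 1}

/-- `w = min_{y ∈ Y(x)} ∑ c_i y_i`. -/
def IsSecondStageCost (x c : Fin n → ℝ) (w : ℝ) : Prop :=
  IsLeast ((fun y : Fin n → ℝ => ∑ i, c i * y i) '' I.Y x) w

/-- `v = ∑ C_i x_i + max_{c ∈ U} min_{y ∈ Y(x)} ∑ c_i y_i`. -/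
def IsRobustCost (x : Fin n → ℝ) (v : ℝ) : Prop :=
  ∃ w, IsGreatest {w | ∃ c ∈ I.U, I.IsSecondStageCost x c w} w ∧ v = ∑ i, I.C i * x i + w

/-- `x` is an optimal first-stage selection of the two-stage robust problem and `v` is the optimal
value. (The last part also says that every feasible first-stage selection has a robust cost.) -/
def IsOptimal (x : Fin n → ℝ) (v : ℝ) : Prop :=
  x ∈ I.X ∧ I.IsRobustCost x v ∧ ∀ x' ∈ I.X, ∃ v', I.IsRobustCost x' v' ∧ v ≤ v'

/-! The mixed-integer linear programming formulation. -/

/-- Feasibility in the mixed-integer program. -/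
def MIPFeasible (x y : Fin n → ℝ) (π : ℝ) (ρ : Fin n → ℝ) : Prop :=
  (∀ j, ∑ i ∈ I.T j, (x i + y i) = 1) ∧ (∀ i, x i + y i ≤ 1) ∧
  (∀ i, I.d i * y i ≤ π + ρ i) ∧
  (∀ i, x i = 0 ∨ x i = 1) ∧ (∀ i, 0 ≤ y i ∧ y i ≤ 1) ∧ 0 ≤ π ∧ ∀ i, 0 ≤ ρ i

/-- The objective of the mixed-integer program. -/
def mipCost (x y : Fin n → ℝ) (π : ℝ) (ρ : Fin n → ℝ) : ℝ :=
  ∑ i, I.C i * x i + ∑ i, I.cLow i * y i + I.Γ * π + ∑ i, ρ i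

/-- `x` and `π` belong to an optimal solution of the mixed-integer program, whose optimal value
is `v`. -/
def IsMIPOptimal (x : Fin n → ℝ) (π v : ℝ) : Prop :=
  (∃ y ρ, I.MIPFeasible x y π ρ ∧ I.mipCost x y π ρ = v) ∧
  ∀ x' y' π' ρ', I.MIPFeasible x' y' π' ρ' → v ≤ I.mipCost x' y' π' ρ'

/-! The optimal value for a fixed `π`. -/

/-- The objective values of the feasible points of the problem for part `j` in which no item is
selected in the first stage. -/
def partValues (j : Fin m) (π : ℝ) : Set ℝ :=
  {v | ∃ y ρ : Fin n → ℝ, ∑ i ∈ I.T j, y i = 1 ∧ (∀ i ∈ I.T j, I.d i * y i ≤ π + ρ i) ∧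
    (∀ i ∈ I.T j, 0 ≤ y i ∧ y i ≤ 1) ∧ (∀ i ∈ I.T j, 0 ≤ ρ i) ∧
    v = ∑ i ∈ I.T j, I.cLow i * y i + ∑ i ∈ I.T j, ρ i}

/-- The function `f_j`. -/
noncomputable def fPart (j : Fin m) (π : ℝ) : ℝ := sInf (I.partValues j π)

/-- `π_i = min {1, π / d_i}`, read as `1` if `d_i = 0`. -/
noncomputable def share (π : ℝ) (i : Fin n) : ℝ :=
  if I.d i = 0 then 1 else min 1 (π / I.d i)

/-- The objective values of the feasible points of the continuous minimum knapsack problem of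
part `j` with parameter `π`: each item of the part is split into a piece of size `π_i` and unit
cost `c_i`, and a piece of size `1 - π_i` and unit cost `c_i + d_i`. -/
def knapsackValues (j : Fin m) (π : ℝ) : Set ℝ :=
  {v | ∃ z w : Fin n → ℝ,
    ∑ i ∈ I.T j, (I.share π i * z i + (1 - I.share π i) * w i) = 1 ∧
    (∀ i ∈ I.T j, 0 ≤ z i ∧ z i ≤ 1) ∧ (∀ i ∈ I.T j, 0 ≤ w i ∧ w i ≤ 1) ∧
    v = ∑ i ∈ I.T j, I.cLow i * I.share π i * z i +
      ∑ i ∈ I.T j, (I.cLow i + I.d i) * (1 - I.share π i) * w i}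

/-- The function `f`. -/
noncomputable def f (π : ℝ) : ℝ :=
  I.Γ * π + ∑ j, min ((I.T j).inf' (I.T_nonempty j) I.C) (I.fPart j π)

/-! Input and output on the machine. -/

/-- The initial memory: integer array `0` holds `n, m`; integer array `1` holds for every item the
index of its part; real array `0` holds `Γ`; real arrays `1`, `2`, `3` hold the first-stage costs,
the lower bounds and the deviations. All other cells are `0`. -/
noncomputable def input : RealRAM.State where
  int a i :=
    if a = 0 then (if i = 0 then n else if i = 1 then m else 0)
    else if a = 1 then (if h : i < n then (I.part ⟨i, h⟩ : ℕ) else 0)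
    else 0
  real a i :=
    if a = 0 then (if i = 0 then I.Γ else 0)
    else if h : i < n then
      (if a = 1 then I.C ⟨i, h⟩ else if a = 2 then I.cLow ⟨i, h⟩
        else if a = 3 then I.d ⟨i, h⟩ else 0)
    else 0

end Instance

/-- The first-stage selection in the final memory: the first `n` cells of integer array `2`. -/
def outX (n : ℕ) (s : RealRAM.State) : Fin n → ℝ := fun i => (s.int 2 i : ℝ)

/-- The optimal value in the final memory. -/
def outValue (s : RealRAM.State) : ℝ := s.real 4 0

/-- The value of `π` in the final memory. -/
def outPi (s : RealRAM.State) : ℝ := s.real 4 1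

/-- The breakpoints in the final memory: cell `0` of integer array `3` holds their number `k`
(repetitions allowed), and the first `k` cells of real array `5` hold the breakpoints. -/
noncomputable def outBreakpoints (s : RealRAM.State) : Finset ℝ :=
  (Finset.range (s.int 3 0)).image fun i => s.real 5 i

/-- `g` is continuous on `[0, ∞)` and affine on every interval without an inner point in `B`. -/
def PiecewiseLinearWith (g : ℝ → ℝ) (B : Finset ℝ) : Prop :=
  ContinuousOn g (Set.Ici 0) ∧
  ∀ a b : ℝ, 0 ≤ a → a ≤ b → (∀ p ∈ B, p ∉ Set.Ioo a b) →
    ∃ α β : ℝ, ∀ π ∈ Set.Icc a b, g π = α + β * π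

end RepSel

/-! Everything rests on a dual description of one part. If all costs of a part are to reach a common
level `lam`, with `lam` at most the smallest upper bound `top`, the adversary spends `need lam`, a
convex piecewise linear function with kinks at the lower bounds. Pricing the budget at `π` gives
`f_j(π) = max (lam - π * need lam)`, and the maximum is attained at one of the finitely many
`levels`. The inequality `≥` is an itemwise estimate (`le_partValues`); equality comes from the
greedy solution of the knapsack (`exists_level_partValues`). The same bound holds for the knapsack
values, whence `isLeast_knapsackValues`.

For a fixed first-stage selection the second stage decomposes into the open parts, and `dualCost` is
a maximum of finitely many affine functions of `π`, one for each choice of levels. At a minimiser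
two active functions with slopes of opposite sign can be mixed to slope zero; by convexity of `need`
the mixed levels are affordable, so the adversary attains the dual value
(`exists_dualCost_le_sum_inf`). Both the two-stage problem and the mixed-integer program thus become
a joint minimisation over `x` and `π`. For fixed `π` the choice of `x` separates over the parts and
leaves `f`; `isOptimal_of_min` turns a minimiser of `f` into optimal solutions.

For the algorithm, the levels of a part are scanned in increasing order. Between two consecutive
levels `need` has the constant slope `D = accInv`, so the new level adds `gap * max 0 (1 - π * D)`,
a ramp that ends at `1 / D`. Hence `f_j` is its value at infinity plus ramps (`scanInv`,
`fPart_eq_ramps`). Taking the minimum with the first-stage cost freezes the ramps to the left of a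
point `cap`, and a frozen ramp is a difference of two ramps (`min_ramps`). With `2n` levels this
writes `f` as an affine function plus `4n` ramps (`f_eq_sum`). Their locations contain all
breakpoints, and a minimum lies at `0` or at one of them (`exists_candidate_le`).

Two sorts, of the levels and of the ramp locations, cost `O(n log n)`; all other loops are linear.
The sweep over the sorted locations keeps two prefix sums, from which each candidate is evaluated in
constant time. -/

namespace RepSel.Instance

/-! ### One part: duality between fractional selections and a common cost level. -/

variable {n m : ℕ} (I : Instance n m)

theorem mem_T {j : Fin m} {i : Fin n} : i ∈ I.T j ↔ I.part i = j := by simp [T]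

/-- The smallest upper bound of a second-stage cost in part `j`. -/
noncomputable def top (j : Fin m) : ℝ :=
  (I.T j).inf' (I.T_nonempty j) fun i => I.cLow i + I.d i

/-- The budget needed to raise all second-stage costs of part `j` to `lam`. -/
noncomputable def need (j : Fin m) (lam : ℝ) : ℝ :=
  ∑ i ∈ I.T j, max 0 (lam - I.cLow i) * (I.d i)⁻¹

/-- The levels of part `j`. -/
noncomputable def levels (j : Fin m) : Finset ℝ :=
  insert (I.top j) ((I.T j).image fun i => min (I.cLow i) (I.top j))

theorem top_le {j : Fin m} {i : Fin n} (hi : i ∈ I.T j) : I.top j ≤ I.cLow i + I.d i :=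
  Finset.inf'_le _ hi

theorem exists_top (j : Fin m) : ∃ i ∈ I.T j, I.top j = I.cLow i + I.d i :=
  Finset.exists_mem_eq_inf' _ _

theorem le_top_of_mem_levels {j : Fin m} {lam : ℝ} (h : lam ∈ I.levels j) : lam ≤ I.top j := by
  simp only [levels, Finset.mem_insert, Finset.mem_image] at h
  rcases h with rfl | ⟨i, -, rfl⟩
  · exact le_rfl
  · exact min_le_right _ _

theorem levels_nonempty (j : Fin m) : (I.levels j).Nonempty := ⟨I.top j, by simp [levels]⟩

/-- Items without deviation have lower bound at least `top`, so the convention `0⁻¹ = 0` in `need`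
is harmless for every level up to `top`. -/
theorem d_pos_of_lt_top {j : Fin m} {i : Fin n} (hi : i ∈ I.T j) (h : I.cLow i < I.top j) :
    0 < I.d i := by
  have := I.top_le hi
  linarith

/-- Weak duality, item by item: raising item `i` to `lam` uses the fraction `θ = (lam - c_i) / d_i ≤
1` of its deviation, and `θ * d_i * y_i ≤ θ * (π + ρ_i) ≤ θ * π + ρ_i`. Summation with `∑ y_i = 1`
gives the bound. -/
theorem le_partValues {j : Fin m} {π v lam : ℝ} (hl : lam ≤ I.top j)
    (hv : v ∈ I.partValues j π) : lam - π * I.need j lam ≤ v := by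
  obtain ⟨y, ρ, hy, hρ, hy01, hρ0, rfl⟩ := hv
  have key : ∀ i ∈ I.T j, lam * y i - π * (max 0 (lam - I.cLow i) * (I.d i)⁻¹) ≤
      I.cLow i * y i + ρ i := by
    intro i hi
    have h1 := hρ i hi
    have h2 := hy01 i hi
    have h3 := hρ0 i hi
    rcases le_total lam (I.cLow i) with h | h
    · rw [max_eq_left (by linarith)]
      nlinarith [mul_nonneg (sub_nonneg.2 h) h2.1]
    -- The tie is treated separately because `d_i` may then vanish; for `c_i < lam` it is positive.
    · rcases h.eq_or_lt with h | h
      · rw [h]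
        simp only [sub_self, max_self, zero_mul, mul_zero, sub_zero]
        linarith
      rw [max_eq_right (by linarith)]
      have hd := I.d_pos_of_lt_top hi (h.trans_le hl)
      have ht := I.top_le hi
      set θ := (lam - I.cLow i) * (I.d i)⁻¹ with hθ
      have hθd : lam - I.cLow i = θ * I.d i := by rw [hθ]; field_simp
      have hθ0 : 0 ≤ θ := mul_nonneg (by linarith) (inv_nonneg.2 hd.le)
      have hθ1 : θ ≤ 1 := by
        rw [hθ, ← div_eq_mul_inv, div_le_one hd]; linarith
      have : (lam - I.cLow i) * y i = θ * (I.d i * y i) := by rw [hθd]; ring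
      nlinarith [mul_le_mul_of_nonneg_left h1 hθ0, mul_nonneg (sub_nonneg.2 hθ1) h3]
  have := Finset.sum_le_sum key
  rw [Finset.sum_sub_distrib, ← Finset.mul_sum, ← Finset.mul_sum, hy, Finset.sum_add_distrib] at this
  simpa [need] using this

theorem share_nonneg {π : ℝ} (hπ : 0 ≤ π) (i : Fin n) : 0 ≤ I.share π i := by
  unfold share
  split_ifs
  · exact zero_le_one
  · exact le_min zero_le_one (div_nonneg hπ (I.d_nonneg i))

theorem share_le_one (π : ℝ) (i : Fin n) : I.share π i ≤ 1 := by
  unfold share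
  split_ifs
  · exact le_rfl
  · exact min_le_left _ _

/-- The expensive pieces cost at least `top ≥ lam` per unit. A cheap piece undercuts `lam` by at
most `lam - c_i` per unit, and its size is at most `π / d_i`, so the total saving is at most `π *
need lam`. -/
theorem le_knapsackValues {j : Fin m} {π v lam : ℝ} (hπ : 0 ≤ π) (hl : lam ≤ I.top j)
    (hv : v ∈ I.knapsackValues j π) : lam - π * I.need j lam ≤ v := by
  obtain ⟨z, w, hs, hz, hw, rfl⟩ := hv
  have key : ∀ i ∈ I.T j, lam * (I.share π i * z i + (1 - I.share π i) * w i) -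
      π * (max 0 (lam - I.cLow i) * (I.d i)⁻¹) ≤
      I.cLow i * I.share π i * z i + (I.cLow i + I.d i) * (1 - I.share π i) * w i := by
    intro i hi
    have ht := I.top_le hi
    have s0 := I.share_nonneg hπ i
    have s1 := I.share_le_one π i
    have hb : 0 ≤ (1 - I.share π i) * w i := mul_nonneg (by linarith) (hw i hi).1
    have ha : 0 ≤ I.share π i * z i := mul_nonneg s0 (hz i hi).1
    have hb' : lam * ((1 - I.share π i) * w i) ≤ (I.cLow i + I.d i) * ((1 - I.share π i) * w i) :=
      mul_le_mul_of_nonneg_right (by linarith) hb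
    suffices lam * (I.share π i * z i) - π * (max 0 (lam - I.cLow i) * (I.d i)⁻¹) ≤
        I.cLow i * (I.share π i * z i) by linarith
    rcases le_or_gt lam (I.cLow i) with h | h
    · rw [max_eq_left (by linarith)]
      nlinarith [mul_nonneg (sub_nonneg.2 h) ha]
    · rw [max_eq_right (by linarith)]
      have hd := I.d_pos_of_lt_top hi (h.trans_le hl)
      have hsp : I.share π i ≤ π * (I.d i)⁻¹ := by
        rw [share, if_neg hd.ne', ← div_eq_mul_inv]; exact min_le_right _ _
      have : I.share π i * z i ≤ π * (I.d i)⁻¹ :=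
        (mul_le_of_le_one_right s0 (hz i hi).2).trans hsp
      nlinarith [mul_le_mul_of_nonneg_left this (sub_nonneg.2 h.le)]
  have := Finset.sum_le_sum key
  rw [Finset.sum_sub_distrib, ← Finset.mul_sum, ← Finset.mul_sum, hs, Finset.sum_add_distrib] at this
  simpa [need] using this

/-- Each amount `y_i` is packed into the cheap piece first and overflows into the expensive one. The
overflow is paid for by `ρ_i`, since `d_i * (y_i - π / d_i) = d_i * y_i - π`. -/
theorem exists_knapsackValues_le {j : Fin m} {π v : ℝ} (hπ : 0 ≤ π)
    (hv : v ∈ I.partValues j π) : ∃ v' ∈ I.knapsackValues j π, v' ≤ v := by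
  obtain ⟨y, ρ, hy, hρ, hy01, hρ0, rfl⟩ := hv
  have low : ∀ i ∈ I.T j, ∃ z w : ℝ, (0 ≤ z ∧ z ≤ 1) ∧ (0 ≤ w ∧ w ≤ 1) ∧
      I.share π i * z + (1 - I.share π i) * w = y i ∧
      I.cLow i * I.share π i * z + (I.cLow i + I.d i) * (1 - I.share π i) * w ≤
        I.cLow i * y i + ρ i := by
    intro i hi
    obtain ⟨y0, y1⟩ := hy01 i hi
    have s0 := I.share_nonneg hπ i
    have s1 := I.share_le_one π i
    have h1 := hρ i hi
    have h3 := hρ0 i hi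
    set s := I.share π i with hs
    rcases le_total (y i) s with h | h
    · rcases s0.eq_or_lt with h0 | h0
      · refine ⟨0, 0, by simp, by simp, ?_, ?_⟩
        · simp; linarith
        · simp only [mul_zero, add_zero]
          exact add_nonneg (mul_nonneg (I.cLow_nonneg i) y0) h3
      · refine ⟨y i / s, 0, ⟨by positivity, (div_le_one h0).2 h⟩, by simp, ?_, ?_⟩
        · field_simp; ring
        · rw [mul_assoc, mul_div_cancel₀ _ h0.ne']; simp; exact h3
    · rcases s1.eq_or_lt with h0 | h0
      · refine ⟨1, 0, by simp, by simp, ?_, ?_⟩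
        · simp; linarith
        · have : y i = 1 := by linarith
          rw [this, h0]; simp; exact h3
      · have h0' : 0 < 1 - s := by linarith
        refine ⟨1, (y i - s) / (1 - s), by simp,
          ⟨div_nonneg (by linarith) h0'.le, (div_le_one h0').2 (by linarith)⟩, ?_, ?_⟩
        · rw [mul_div_cancel₀ _ h0'.ne']; ring
        · rw [mul_assoc _ (1 - s), mul_div_cancel₀ _ h0'.ne']
          -- A share below `1` excludes `d_i = 0` and means that the minimum in the definition is `π
          -- / d_i`.
          have hd : I.d i ≠ 0 := by
            intro hd
            rw [hs, share, if_pos hd] at h0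
            exact lt_irrefl _ h0
          have hsd : I.d i * s = π := by
            have : s = π / I.d i := by
              rw [hs, share, if_neg hd] at h0 ⊢
              rcases min_choice 1 (π / I.d i) with h | h
              · rw [h] at h0; exact absurd h0 (lt_irrefl _)
              · exact h
            rw [this, mul_div_cancel₀ _ hd]
          nlinarith
  choose! z w hz hw hzw hc using low
  refine ⟨_, ⟨z, w, ?_, hz, hw, rfl⟩, ?_⟩
  · rw [Finset.sum_congr rfl hzw, hy]
  · rw [← Finset.sum_add_distrib, ← Finset.sum_add_distrib]
    exact Finset.sum_le_sum hc

theorem d_mul_inv_le_one (i : Fin n) : I.d i * (I.d i)⁻¹ ≤ 1 := mul_inv_le_one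

theorem need_eq_sum_filter (j : Fin m) (lam : ℝ) :
    I.need j lam = ∑ i ∈ (I.T j).filter (fun i => I.cLow i < lam), (lam - I.cLow i) * (I.d i)⁻¹ := by
  rw [need, Finset.sum_filter]
  refine Finset.sum_congr rfl fun i _ => ?_
  split_ifs with h
  · rw [max_eq_right (by linarith)]
  · rw [max_eq_left (by linarith), zero_mul]

/-- The greedy solution when the cheap pieces below `top` do not fill the knapsack: all of them are
taken, and the remainder `r` goes to an item `i₀` that attains `top`, where each unit costs `c + d =
top`. -/
theorem exists_partValues_of_le_one {j : Fin m} {π : ℝ} (hπ : 0 ≤ π)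
    (h : π * ∑ i ∈ (I.T j).filter (fun i => I.cLow i < I.top j), (I.d i)⁻¹ ≤ 1) :
    I.top j - π * I.need j (I.top j) ∈ I.partValues j π := by
  obtain ⟨i₀, hi₀, ht⟩ := I.exists_top j
  set F := (I.T j).filter (fun i => I.cLow i < I.top j) with hF
  set r := 1 - π * ∑ i ∈ F, (I.d i)⁻¹ with hr
  have hr0 : 0 ≤ r := by linarith
  set y : Fin n → ℝ := fun i =>
    (if I.cLow i < I.top j then π * (I.d i)⁻¹ else 0) + if i = i₀ then r else 0 with hydef
  have hsum : ∑ i ∈ I.T j, y i = 1 := by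
    rw [hydef, Finset.sum_add_distrib, ← Finset.sum_filter, ← hF, ← Finset.mul_sum,
      Finset.sum_ite_eq' (I.T j) i₀, if_pos hi₀, hr]
    ring
  have hinv : ∀ i, 0 ≤ (I.d i)⁻¹ := fun i => inv_nonneg.2 (I.d_nonneg i)
  have hy0 : ∀ i, 0 ≤ y i := fun i => by
    simp only [hydef]
    have := mul_nonneg hπ (hinv i)
    split_ifs <;> linarith
  refine ⟨y, fun i => if i = i₀ then I.d i * r else 0, hsum, ?_, ?_, ?_, ?_⟩
  · intro i _
    have h1 : I.d i * (if I.cLow i < I.top j then π * (I.d i)⁻¹ else 0) ≤ π := by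
      split_ifs
      · nlinarith [I.d_mul_inv_le_one i]
      · simpa using hπ
    simp only [hydef, mul_add]
    split_ifs at h1 ⊢ <;> linarith
  · intro i hi
    exact ⟨hy0 i, hsum ▸ Finset.single_le_sum (fun i _ => hy0 i) hi⟩
  · intro i _
    dsimp only
    split_ifs
    · exact mul_nonneg (I.d_nonneg i) hr0
    · exact le_rfl
  · have e1 : ∑ i ∈ I.T j, I.cLow i * y i =
        ∑ i ∈ F, I.cLow i * (π * (I.d i)⁻¹) + I.cLow i₀ * r := by
      simp only [hydef, mul_add, mul_ite, mul_zero]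
      rw [Finset.sum_add_distrib, ← Finset.sum_filter, Finset.sum_ite_eq' (I.T j) i₀, if_pos hi₀]
    rw [e1, Finset.sum_ite_eq' (I.T j) i₀, if_pos hi₀, need_eq_sum_filter, ← hF]
    have e2 : ∑ i ∈ F, (I.top j - I.cLow i) * (I.d i)⁻¹ =
        I.top j * ∑ i ∈ F, (I.d i)⁻¹ - ∑ i ∈ F, I.cLow i * (I.d i)⁻¹ := by
      rw [Finset.mul_sum, ← Finset.sum_sub_distrib]
      exact Finset.sum_congr rfl fun i _ => by ring
    have e3 : ∑ i ∈ F, I.cLow i * (π * (I.d i)⁻¹) = π * ∑ i ∈ F, I.cLow i * (I.d i)⁻¹ := by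
      rw [Finset.mul_sum]
      exact Finset.sum_congr rfl fun i _ => by ring
    rw [e2, e3]
    have e4 : I.cLow i₀ * r + I.d i₀ * r = I.top j * r := by rw [ht]; ring
    rw [add_assoc, e4, hr]
    ring

/-- The greedy solution when the knapsack is filled by cheap pieces at lower bound `lam`: pieces
below `lam` are taken completely, those at `lam` in part, and no `ρ` is needed. -/
theorem exists_partValues_of_critical {j : Fin m} {π lam : ℝ} (hπ : 0 ≤ π)
    (h₁ : π * ∑ i ∈ (I.T j).filter (fun i => I.cLow i < lam), (I.d i)⁻¹ ≤ 1)
    (h₂ : 1 < π * ∑ i ∈ (I.T j).filter (fun i => I.cLow i ≤ lam), (I.d i)⁻¹) :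
    lam - π * I.need j lam ∈ I.partValues j π := by
  set F := (I.T j).filter (fun i => I.cLow i < lam) with hF
  set G := (I.T j).filter (fun i => I.cLow i = lam) with hG
  have hFG : ∑ i ∈ (I.T j).filter (fun i => I.cLow i ≤ lam), (I.d i)⁻¹ =
      ∑ i ∈ F, (I.d i)⁻¹ + ∑ i ∈ G, (I.d i)⁻¹ := by
    rw [hF, hG, Finset.sum_filter, Finset.sum_filter, Finset.sum_filter, ← Finset.sum_add_distrib]
    refine Finset.sum_congr rfl fun i _ => ?_
    rcases lt_trichotomy (I.cLow i) lam with h | h | h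
    · simp [h, h.le, h.ne]
    · simp [h]
    · simp [h.not_gt, h.not_ge, h.ne']
  rw [hFG] at h₂
  set A := π * ∑ i ∈ F, (I.d i)⁻¹ with hA
  set B := π * ∑ i ∈ G, (I.d i)⁻¹ with hB
  have hB1 : 1 - A < B := by rw [hA, hB]; linarith
  have hB0 : 0 < B := by linarith
  -- All items tied at `lam` are scaled by the same factor, chosen so that the total becomes `1`.
  set t := (1 - A) / B with ht
  have ht0 : 0 ≤ t := div_nonneg (by linarith) hB0.le
  have ht1 : t ≤ 1 := (div_le_one hB0).2 hB1.le
  have htB : t * B = 1 - A := div_mul_cancel₀ _ hB0.ne'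
  set y : Fin n → ℝ := fun i => (if I.cLow i < lam then π * (I.d i)⁻¹ else 0) +
    if I.cLow i = lam then t * (π * (I.d i)⁻¹) else 0 with hydef
  have hsum : ∑ i ∈ I.T j, y i = 1 := by
    rw [hydef, Finset.sum_add_distrib, ← Finset.sum_filter, ← Finset.sum_filter, ← hF, ← hG,
      ← Finset.mul_sum, ← Finset.mul_sum, ← Finset.mul_sum, ← hA, ← hB, htB]
    ring
  have hinv : ∀ i, 0 ≤ π * (I.d i)⁻¹ := fun i => mul_nonneg hπ (inv_nonneg.2 (I.d_nonneg i))
  have hy : ∀ i, 0 ≤ y i ∧ y i ≤ π * (I.d i)⁻¹ := fun i => by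
    simp only [hydef]
    have h0 := hinv i
    have h1 := mul_nonneg ht0 h0
    have h2 := mul_le_of_le_one_left h0 ht1
    rcases lt_trichotomy (I.cLow i) lam with h | h | h
    · simp [h, h.ne, h0]
    · simp [h, h1, h2]
    · simp [h.not_gt, h.ne', h0]
  refine ⟨y, 0, hsum, ?_, ?_, ?_, ?_⟩
  · intro i _
    have h1 := mul_le_mul_of_nonneg_left (hy i).2 (I.d_nonneg i)
    simp only [Pi.zero_apply, add_zero]
    nlinarith [I.d_mul_inv_le_one i]
  · intro i hi
    exact ⟨(hy i).1, hsum ▸ Finset.single_le_sum (fun i _ => (hy i).1) hi⟩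
  · intro i _
    exact le_rfl
  · have e1 : ∑ i ∈ I.T j, I.cLow i * y i =
        π * ∑ i ∈ F, I.cLow i * (I.d i)⁻¹ + lam * (t * B) := by
      simp only [hydef, mul_add, mul_ite, mul_zero]
      rw [Finset.sum_add_distrib, ← Finset.sum_filter, ← Finset.sum_filter, ← hF, ← hG, hB,
        Finset.mul_sum, Finset.mul_sum, Finset.mul_sum, Finset.mul_sum]
      congr 1
      · exact Finset.sum_congr rfl fun i _ => by ring
      · refine Finset.sum_congr rfl fun i hi => ?_
        rw [(Finset.mem_filter.1 hi).2]
    have e2 : ∑ i ∈ F, (lam - I.cLow i) * (I.d i)⁻¹ =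
        lam * ∑ i ∈ F, (I.d i)⁻¹ - ∑ i ∈ F, I.cLow i * (I.d i)⁻¹ := by
      rw [Finset.mul_sum, ← Finset.sum_sub_distrib]
      exact Finset.sum_congr rfl fun i _ => by ring
    rw [need_eq_sum_filter, ← hF, e1, e2, htB, hA]
    simp
    ring

theorem exists_critical {j : Fin m} {π : ℝ}
    (h : 1 < π * ∑ i ∈ (I.T j).filter (fun i => I.cLow i < I.top j), (I.d i)⁻¹) :
    ∃ i ∈ I.T j, I.cLow i < I.top j ∧
      π * ∑ l ∈ (I.T j).filter (fun l => I.cLow l < I.cLow i), (I.d l)⁻¹ ≤ 1 ∧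
      1 < π * ∑ l ∈ (I.T j).filter (fun l => I.cLow l ≤ I.cLow i), (I.d l)⁻¹ := by
  set F := (I.T j).filter (fun i => I.cLow i < I.top j) with hF
  set S := F.filter fun i =>
    1 < π * ∑ l ∈ (I.T j).filter (fun l => I.cLow l ≤ I.cLow i), (I.d l)⁻¹ with hS
  have hFne : F.Nonempty := by
    by_contra hne
    rw [Finset.not_nonempty_iff_eq_empty] at hne
    rw [hne] at h
    simp at h
    linarith
  have hSne : S.Nonempty := by
    -- For the largest lower bound below `top` the cumulative sum is the whole sum, which exceeds
    -- `1` by assumption.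
    obtain ⟨i, hi, hmax⟩ := Finset.exists_max_image F I.cLow hFne
    refine ⟨i, Finset.mem_filter.2 ⟨hi, ?_⟩⟩
    convert h using 3
    ext l
    simp only [hF, Finset.mem_filter, and_congr_right_iff]
    intro hl
    refine ⟨fun h => h.trans_lt (Finset.mem_filter.1 hi).2, fun h => hmax l ?_⟩
    exact Finset.mem_filter.2 ⟨hl, h⟩
  obtain ⟨i, hi, hmin⟩ := Finset.exists_min_image S I.cLow hSne
  have hi' := Finset.mem_filter.1 hi
  have hi'' := Finset.mem_filter.1 hi'.1
  refine ⟨i, hi''.1, hi''.2, ?_, hi'.2⟩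
  by_contra hlt
  push Not at hlt
  have hne : ((I.T j).filter (fun l => I.cLow l < I.cLow i)).Nonempty := by
    by_contra hne
    rw [Finset.not_nonempty_iff_eq_empty] at hne
    rw [hne] at hlt
    simp at hlt
    linarith
  -- If the sum strictly below the minimal choice already exceeded `1`, the next smaller lower bound
  -- would also qualify.
  obtain ⟨l, hl, hmax⟩ := Finset.exists_max_image _ I.cLow hne
  have hl' := Finset.mem_filter.1 hl
  refine absurd (hmin l ?_) hl'.2.not_ge
  refine Finset.mem_filter.2 ⟨Finset.mem_filter.2 ⟨hl'.1, hl'.2.trans hi''.2⟩, ?_⟩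
  have : (I.T j).filter (fun k => I.cLow k ≤ I.cLow l) =
      (I.T j).filter (fun k => I.cLow k < I.cLow i) := by
    ext k
    simp only [Finset.mem_filter, and_congr_right_iff]
    exact fun hk => ⟨fun h => h.trans_lt hl'.2, fun h => hmax k (Finset.mem_filter.2 ⟨hk, h⟩)⟩
  rwa [this]

theorem exists_level_partValues (j : Fin m) {π : ℝ} (hπ : 0 ≤ π) :
    ∃ lam ∈ I.levels j, lam - π * I.need j lam ∈ I.partValues j π := by
  rcases le_or_gt (π * ∑ i ∈ (I.T j).filter (fun i => I.cLow i < I.top j), (I.d i)⁻¹) 1 with h | h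
  · exact ⟨I.top j, by simp [levels], I.exists_partValues_of_le_one hπ h⟩
  · obtain ⟨i, hi, hlt, h₁, h₂⟩ := I.exists_critical h
    refine ⟨I.cLow i, ?_, I.exists_partValues_of_critical hπ h₁ h₂⟩
    simp only [levels, Finset.mem_insert, Finset.mem_image]
    exact Or.inr ⟨i, hi, min_eq_left hlt.le⟩

theorem isLeast_partValues (j : Fin m) {π : ℝ} (hπ : 0 ≤ π) :
    IsLeast (I.partValues j π) (I.fPart j π) := by
  obtain ⟨lam, hlam, hmem⟩ := I.exists_level_partValues j hπ
  have h : IsLeast (I.partValues j π) (lam - π * I.need j lam) :=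
    ⟨hmem, fun v hv => I.le_partValues (I.le_top_of_mem_levels hlam) hv⟩
  rwa [fPart, h.csInf_eq]

/-- `f_j` is the optimal value of the dual problem, whose optimum is attained at a level. -/
theorem exists_fPart_eq (j : Fin m) {π : ℝ} (hπ : 0 ≤ π) :
    ∃ lam ∈ I.levels j, I.fPart j π = lam - π * I.need j lam := by
  obtain ⟨lam, hlam, hmem⟩ := I.exists_level_partValues j hπ
  refine ⟨lam, hlam, le_antisymm ((I.isLeast_partValues j hπ).2 hmem) ?_⟩
  exact I.le_partValues (I.le_top_of_mem_levels hlam) (I.isLeast_partValues j hπ).1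

theorem le_fPart {j : Fin m} {π lam : ℝ} (hπ : 0 ≤ π) (hl : lam ≤ I.top j) :
    lam - π * I.need j lam ≤ I.fPart j π :=
  I.le_partValues hl (I.isLeast_partValues j hπ).1

/-- Both problems have the same dual lower bound, it is attained by the part problem, and the
knapsack is at most as expensive; so the two optima coincide. -/
theorem isLeast_knapsackValues (j : Fin m) {π : ℝ} (hπ : 0 ≤ π) :
    IsLeast (I.knapsackValues j π) (I.fPart j π) := by
  obtain ⟨lam, hlam, h⟩ := I.exists_fPart_eq j hπ
  have hlow : ∀ v ∈ I.knapsackValues j π, I.fPart j π ≤ v := fun v hv =>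
    h ▸ I.le_knapsackValues hπ (I.le_top_of_mem_levels hlam) hv
  obtain ⟨v, hv, hle⟩ := I.exists_knapsackValues_le hπ (I.isLeast_partValues j hπ).1
  exact ⟨le_antisymm hle (hlow v hv) ▸ hv, hlow⟩

end RepSel.Instance

/-! ### The adversary against a fixed first-stage selection: duality in the budget. -/

namespace RepSel.Instance

variable {n m : ℕ} (I : Instance n m)

theorem sum_parts (g : Fin n → ℝ) : ∑ j, ∑ i ∈ I.T j, g i = ∑ i, g i :=
  Finset.sum_fiberwise Finset.univ I.part g

/-- The parts in which `x` selects no item. -/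
noncomputable def openParts (x : Fin n → ℝ) : Finset (Fin m) :=
  Finset.univ.filter fun j => ∑ i ∈ I.T j, x i = 0

theorem mem_openParts {x : Fin n → ℝ} {j : Fin m} :
    j ∈ I.openParts x ↔ ∑ i ∈ I.T j, x i = 0 := by simp [openParts]

/-- The cost of the second stage for the open parts `J` and a fixed `π`. -/
noncomputable def dualCost (J : Finset (Fin m)) (π : ℝ) : ℝ :=
  I.Γ * π + ∑ j ∈ J, I.fPart j π

theorem sum_eq_zero_or_one {x : Fin n → ℝ} (hx : x ∈ I.X) (j : Fin m) :
    ∑ i ∈ I.T j, x i = 0 ∨ ∑ i ∈ I.T j, x i = 1 := by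
  by_cases h : ∃ i ∈ I.T j, x i = 1
  · obtain ⟨i, hi, h1⟩ := h
    refine Or.inr (le_antisymm (hx.2 j) ?_)
    rw [← h1]
    refine Finset.single_le_sum (fun i _ => ?_) hi
    rcases hx.1 i with h | h <;> simp [h]
  · push Not at h
    exact Or.inl (Finset.sum_eq_zero fun i hi => (hx.1 i).resolve_right (h i hi))

theorem eq_zero_of_openParts {x : Fin n → ℝ} (hx : ∀ i, 0 ≤ x i) {j : Fin m}
    (hj : ∑ i ∈ I.T j, x i = 0) : ∀ i ∈ I.T j, x i = 0 :=
  (Finset.sum_eq_zero_iff_of_nonneg fun i _ => hx i).1 hj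

theorem nonneg_of_zero_or_one {x : Fin n → ℝ} (h : ∀ i, x i = 0 ∨ x i = 1) (i : Fin n) :
    0 ≤ x i := by
  rcases h i with h | h <;> simp [h]

/-- The second stage is forced in the parts already served by `x` and independent in the open ones,
where the cheapest item is taken. -/
theorem isSecondStageCost_sum_inf {x : Fin n → ℝ} (hx : x ∈ I.X) (c : Fin n → ℝ) :
    I.IsSecondStageCost x c
      (∑ j ∈ I.openParts x, (I.T j).inf' (I.T_nonempty j) c) := by
  have hx0 := nonneg_of_zero_or_one hx.1
  constructor
  · have := fun j => Finset.exists_mem_eq_inf' (I.T_nonempty j) c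
    choose a ha hc using this
    refine ⟨fun i => if I.part i ∈ I.openParts x ∧ i = a (I.part i) then 1 else 0,
      ⟨fun i => ?_, fun j => ?_, fun i => ?_⟩, ?_⟩
    · dsimp only; split_ifs <;> simp
    · rw [Finset.sum_add_distrib]
      by_cases hj : j ∈ I.openParts x
      · rw [I.mem_openParts.1 hj, zero_add, Finset.sum_eq_single_of_mem (a j) (ha j)]
        · have := I.mem_T.1 (ha j)
          simp [this, hj]
        · intro i hi hne
          rw [I.mem_T] at hi
          simp [hi, hne]
      · rw [Finset.sum_eq_zero (f := fun i => if I.part i ∈ _ ∧ _ then (1 : ℝ) else 0),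
          add_zero]
        · exact (I.sum_eq_zero_or_one hx j).resolve_left fun h => hj (I.mem_openParts.2 h)
        · intro i hi
          rw [I.mem_T] at hi
          simp [hi, hj]
    · dsimp only
      split_ifs with h
      · have := I.eq_zero_of_openParts hx0 (I.mem_openParts.1 h.1) i (I.mem_T.2 rfl)
        simp [this]
      · rcases hx.1 i with h | h <;> simp [h]
    · dsimp only
      rw [← I.sum_parts, ← Finset.sum_subset (Finset.subset_univ (I.openParts x))]
      · refine Finset.sum_congr rfl fun j hj => ?_
        rw [hc j, Finset.sum_eq_single_of_mem (a j) (ha j)]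
        · have := I.mem_T.1 (ha j)
          simp [this, hj]
        · intro i hi hne
          rw [I.mem_T] at hi
          simp [hi, hne]
      · intro j _ hj
        refine Finset.sum_eq_zero fun i hi => ?_
        rw [I.mem_T] at hi
        simp [hi, hj]
  · rintro _ ⟨y, hy, rfl⟩
    dsimp only
    have hy0 := nonneg_of_zero_or_one hy.1
    rw [← I.sum_parts, ← Finset.sum_subset (Finset.subset_univ (I.openParts x))]
    · refine Finset.sum_le_sum fun j hj => ?_
      have h1 := hy.2.1 j
      rw [Finset.sum_add_distrib, I.mem_openParts.1 hj, zero_add] at h1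
      rw [← mul_one (Finset.inf' _ _ _), ← h1, Finset.mul_sum]
      exact Finset.sum_le_sum fun i hi =>
        mul_le_mul_of_nonneg_right (Finset.inf'_le _ hi) (hy0 i)
    · intro j _ hj
      have h1 := hy.2.1 j
      rw [Finset.sum_add_distrib, (I.sum_eq_zero_or_one hx j).resolve_left
        fun h => hj (I.mem_openParts.2 h)] at h1
      refine Finset.sum_eq_zero fun i hi => ?_
      rw [I.eq_zero_of_openParts hy0 (by linarith) i hi, mul_zero]

/-- Weak duality. -/
theorem sum_inf_le_dualCost {c : Fin n → ℝ} (hc : c ∈ I.U) (J : Finset (Fin m)) {π : ℝ}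
    (hπ : 0 ≤ π) : ∑ j ∈ J, (I.T j).inf' (I.T_nonempty j) c ≤ I.dualCost J π := by
  obtain ⟨-, δ, hδ, hcδ, hΓ⟩ := hc
  -- The smallest cost is at most the average with the weights `y` of an optimal solution for
  -- `f_j(π)`, and `δ_i * d_i * y_i ≤ δ_i * (π + ρ_i) ≤ π * δ_i + ρ_i`.
  have key : ∀ j, (I.T j).inf' (I.T_nonempty j) c ≤ I.fPart j π + π * ∑ i ∈ I.T j, δ i := by
    intro j
    obtain ⟨y, ρ, hy, hρ, hy01, hρ0, hv⟩ := (I.isLeast_partValues j hπ).1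
    rw [hv, ← mul_one (Finset.inf' _ _ _), ← hy, Finset.mul_sum, Finset.mul_sum,
      ← Finset.sum_add_distrib, ← Finset.sum_add_distrib]
    refine Finset.sum_le_sum fun i hi => ?_
    have h1 : (I.T j).inf' (I.T_nonempty j) c * y i ≤ c i * y i :=
      mul_le_mul_of_nonneg_right (Finset.inf'_le _ hi) (hy01 i hi).1
    rw [hcδ] at h1
    have h2 := mul_le_mul_of_nonneg_left (hρ i hi) (hδ i).1
    have h3 := mul_le_mul_of_nonneg_right (hδ i).2 (hρ0 i hi)
    nlinarith
  have hS : ∑ j ∈ J, ∑ i ∈ I.T j, δ i ≤ I.Γ := by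
    refine le_trans ?_ hΓ
    rw [← I.sum_parts]
    exact Finset.sum_le_sum_of_subset_of_nonneg (Finset.subset_univ _)
      fun j _ _ => Finset.sum_nonneg fun i _ => (hδ i).1
  calc _ ≤ ∑ j ∈ J, (I.fPart j π + π * ∑ i ∈ I.T j, δ i) := Finset.sum_le_sum fun j _ => key j
    _ = ∑ j ∈ J, I.fPart j π + π * ∑ j ∈ J, ∑ i ∈ I.T j, δ i := by
      rw [Finset.sum_add_distrib, Finset.mul_sum]
    _ ≤ _ := by
      rw [dualCost]
      nlinarith [mul_le_mul_of_nonneg_left hS hπ]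

theorem need_nonneg (j : Fin m) (lam : ℝ) : 0 ≤ I.need j lam :=
  Finset.sum_nonneg fun i _ => mul_nonneg (le_max_left _ _) (inv_nonneg.2 (I.d_nonneg i))

/-- Needed in strong duality, where two choices of levels are averaged without exceeding the
averaged budget. -/
theorem need_convex (j : Fin m) {a b s t : ℝ} (hs : 0 ≤ s) (ht : 0 ≤ t) (hst : s + t = 1) :
    I.need j (s * a + t * b) ≤ s * I.need j a + t * I.need j b := by
  rw [need, need, need, Finset.mul_sum, Finset.mul_sum, ← Finset.sum_add_distrib]
  refine Finset.sum_le_sum fun i _ => ?_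
  rw [← mul_assoc, ← mul_assoc, ← add_mul]
  refine mul_le_mul_of_nonneg_right (max_le ?_ ?_) (inv_nonneg.2 (I.d_nonneg i))
  · positivity
  · have h1 := mul_le_mul_of_nonneg_left (le_max_right 0 (a - I.cLow i)) hs
    have h2 := mul_le_mul_of_nonneg_left (le_max_right 0 (b - I.cLow i)) ht
    have : s * a + t * b - I.cLow i = s * (a - I.cLow i) + t * (b - I.cLow i) := by
      linear_combination I.cLow i * hst
    linarith

/-- The adversary can raise the costs in the parts `J` to affordable levels. -/
theorem exists_mem_U (J : Finset (Fin m)) (lam : Fin m → ℝ) (hl : ∀ j ∈ J, lam j ≤ I.top j)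
    (hb : ∑ j ∈ J, I.need j (lam j) ≤ I.Γ) :
    ∃ c ∈ I.U, ∑ j ∈ J, lam j ≤ ∑ j ∈ J, (I.T j).inf' (I.T_nonempty j) c := by
  set δ : Fin n → ℝ := fun i =>
    if I.part i ∈ J then max 0 (lam (I.part i) - I.cLow i) * (I.d i)⁻¹ else 0 with hδdef
  have hδ0 : ∀ i, 0 ≤ δ i := fun i => by
    simp only [hδdef]
    split_ifs
    · exact mul_nonneg (le_max_left _ _) (inv_nonneg.2 (I.d_nonneg i))
    · exact le_rfl
  have hδ1 : ∀ i, δ i ≤ 1 ∧ (I.part i ∈ J → lam (I.part i) ≤ I.cLow i + I.d i * δ i) := fun i => by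
    simp only [hδdef]
    split_ifs with h
    · have hle := hl _ h
      have ht := I.top_le (I.mem_T.2 (rfl : I.part i = _))
      rcases le_or_gt (lam (I.part i)) (I.cLow i) with h' | h'
      · rw [max_eq_left (by linarith)]
        simpa using fun _ => h'
      · rw [max_eq_right (by linarith)]
        have hd : 0 < I.d i := by linarith
        constructor
        · rw [← div_eq_mul_inv, div_le_one hd]; linarith
        · intro _
          field_simp
          linarith
    · exact ⟨zero_le_one, fun h' => absurd h' h⟩
  refine ⟨fun i => I.cLow i + I.d i * δ i, ⟨fun i => ?_, δ, fun i => ⟨hδ0 i, (hδ1 i).1⟩,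
    fun i => rfl, ?_⟩, ?_⟩
  · exact add_nonneg (I.cLow_nonneg i) (mul_nonneg (I.d_nonneg i) (hδ0 i))
  · refine le_trans (le_of_eq ?_) hb
    rw [← I.sum_parts, ← Finset.sum_subset (Finset.subset_univ J)]
    · refine Finset.sum_congr rfl fun j hj => Finset.sum_congr rfl fun i hi => ?_
      rw [I.mem_T] at hi
      simp [hδdef, hi, hj]
    · intro j _ hj
      refine Finset.sum_eq_zero fun i hi => ?_
      rw [I.mem_T] at hi
      simp [hδdef, hi, hj]
  · refine Finset.sum_le_sum fun j hj => Finset.le_inf' _ _ fun i hi => ?_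
    rw [I.mem_T] at hi
    have := (hδ1 i).2
    rw [hi] at this
    exact this hj

/-- One-sided first-order test for a maximum of finitely many affine functions: inactive ones stay
below `v` by continuity, active ones decrease. -/
theorem eventually_affine_lt {ι : Type*} (S : Finset ι) (a b : ι → ℝ) {p v : ℝ}
    (hle : ∀ i ∈ S, a i + b i * p ≤ v) (hneg : ∀ i ∈ S, a i + b i * p = v → b i < 0) :
    ∀ᶠ ε in nhdsWithin (0 : ℝ) (Set.Ioi 0), ∀ i ∈ S, a i + b i * (p + ε) < v := by
  rw [Filter.eventually_all_finset]
  intro i hi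
  rcases (hle i hi).lt_or_eq with h | h
  · have hc : Continuous fun ε : ℝ => a i + b i * (p + ε) := by fun_prop
    have := (hc.tendsto 0).eventually_lt_const (u := v) (by simpa using h)
    exact this.filter_mono nhdsWithin_le_nhds
  · filter_upwards [self_mem_nhdsWithin] with ε hε
    have := mul_neg_of_neg_of_pos (hneg i hi h) hε
    rw [mul_add]
    linarith

/-- The value and the slope of the affine minorants of `dualCost`. -/
theorem dualCost_affine (J : Finset (Fin m)) (lam : Fin m → ℝ) (π : ℝ) :
    I.Γ * π + ∑ j ∈ J, (lam j - π * I.need j (lam j)) =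
      ∑ j ∈ J, lam j + (I.Γ - ∑ j ∈ J, I.need j (lam j)) * π := by
  rw [Finset.sum_sub_distrib, ← Finset.mul_sum]
  ring

theorem affine_le_dualCost (J : Finset (Fin m)) {lam : Fin m → ℝ} (hl : ∀ j, lam j ∈ I.levels j)
    {π : ℝ} (hπ : 0 ≤ π) :
    ∑ j ∈ J, lam j + (I.Γ - ∑ j ∈ J, I.need j (lam j)) * π ≤ I.dualCost J π := by
  rw [← dualCost_affine, dualCost]
  gcongr with j
  exact I.le_fPart hπ (I.le_top_of_mem_levels (hl j))

theorem exists_affine_eq_dualCost (J : Finset (Fin m)) {π : ℝ} (hπ : 0 ≤ π) :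
    ∃ lam : Fin m → ℝ, (∀ j, lam j ∈ I.levels j) ∧
      ∑ j ∈ J, lam j + (I.Γ - ∑ j ∈ J, I.need j (lam j)) * π = I.dualCost J π := by
  choose lam hl h using fun j => I.exists_fPart_eq j hπ
  refine ⟨lam, hl, ?_⟩
  rw [← dualCost_affine, dualCost]
  congr 1
  exact Finset.sum_congr rfl fun j _ => (h j).symm

/-- Strong duality. -/
theorem exists_dualCost_le_sum_inf (J : Finset (Fin m)) {π : ℝ} (hπ : 0 ≤ π)
    (hmin : ∀ π', 0 ≤ π' → I.dualCost J π ≤ I.dualCost J π') :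
    ∃ c ∈ I.U, I.dualCost J π ≤ ∑ j ∈ J, (I.T j).inf' (I.T_nonempty j) c := by
  set S : Finset (Fin m → ℝ) := Fintype.piFinset I.levels with hS
  set a : (Fin m → ℝ) → ℝ := fun lam => ∑ j ∈ J, lam j with ha
  set b : (Fin m → ℝ) → ℝ := fun lam => I.Γ - ∑ j ∈ J, I.need j (lam j) with hb
  have hmem : ∀ lam, lam ∈ S ↔ ∀ j, lam j ∈ I.levels j := fun lam => Fintype.mem_piFinset
  have hle : ∀ lam ∈ S, a lam + b lam * π ≤ I.dualCost J π := fun lam h =>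
    I.affine_le_dualCost J ((hmem _).1 h) hπ
  -- Otherwise all active functions would decrease, and a point slightly to the right of `π` would
  -- have a smaller dual cost.
  have hup : ∃ lam ∈ S, a lam + b lam * π = I.dualCost J π ∧ 0 ≤ b lam := by
    by_contra hno
    push Not at hno
    have hev := eventually_affine_lt S a b hle hno
    obtain ⟨ε, hε, hε0⟩ := (hev.and self_mem_nhdsWithin).exists
    have h0 : 0 ≤ π + ε := add_nonneg hπ (le_of_lt hε0)
    obtain ⟨lam, hl, h⟩ := I.exists_affine_eq_dualCost J h0
    have := hε lam ((hmem _).2 hl)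
    have h2 := hmin _ h0
    simp only [ha, hb] at this
    linarith
  obtain ⟨u, hu, hu1, hu2⟩ := hup
  -- At the boundary `π = 0` there is no room to the left, but nonnegative slope already says that
  -- the levels are affordable, and the value is their sum.
  rcases hπ.eq_or_lt with h0 | h0
  · subst h0
    obtain ⟨c, hc, h⟩ := I.exists_mem_U J u (fun j _ => I.le_top_of_mem_levels ((hmem _).1 hu j))
      (by simp only [hb] at hu2; linarith)
    refine ⟨c, hc, le_trans (le_of_eq ?_) h⟩
    rw [← hu1]
    simp [ha]
  have hdown : ∃ lam ∈ S, a lam + b lam * π = I.dualCost J π ∧ b lam ≤ 0 := by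
    by_contra hno
    push Not at hno
    -- The same test to the left of `π`, after reflecting the line.
    have hev := eventually_affine_lt S a (fun l => - b l) (p := -π) (v := I.dualCost J π)
      (fun l hl => by simpa using hle l hl) (fun l hl h => by
        have := hno l hl (by simpa using h)
        simpa using this)
    have hlt : ∀ᶠ ε in nhdsWithin (0 : ℝ) (Set.Ioi 0), ε < π :=
      (eventually_lt_nhds h0).filter_mono nhdsWithin_le_nhds
    obtain ⟨ε, hε, hε0⟩ := (hev.and hlt).exists
    have h0 : 0 ≤ π - ε := by linarith
    obtain ⟨lam, hl, h⟩ := I.exists_affine_eq_dualCost J h0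
    have := hε lam ((hmem _).2 hl)
    have h2 := hmin _ h0
    simp only [ha, hb] at this
    linarith
  obtain ⟨w, hw, hw1, hw2⟩ := hdown
  -- The mixture has slope zero: its averaged budget is exactly `Γ`, and its value no longer depends
  -- on `π`.
  obtain ⟨s, t, hs, ht, hst, hslope⟩ : ∃ s t : ℝ, 0 ≤ s ∧ 0 ≤ t ∧ s + t = 1 ∧
      s * b u + t * b w = 0 := by
    rcases hu2.eq_or_lt with h | h
    · exact ⟨1, 0, by simp, by simp, by simp, by simp [← h]⟩
    · have hpos : 0 < b u - b w := by linarith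
      refine ⟨-b w / (b u - b w), b u / (b u - b w), div_nonneg (by linarith) hpos.le,
        div_nonneg hu2 hpos.le, ?_, ?_⟩
      · field_simp; ring
      · field_simp; ring
  have hl : ∀ j ∈ J, s * u j + t * w j ≤ I.top j := by
    intro j _
    have h1 := mul_le_mul_of_nonneg_left (I.le_top_of_mem_levels ((hmem _).1 hu j)) hs
    have h2 := mul_le_mul_of_nonneg_left (I.le_top_of_mem_levels ((hmem _).1 hw j)) ht
    have h3 : I.top j = s * I.top j + t * I.top j := by rw [← add_mul, hst, one_mul]
    linarith
  have hneed : ∑ j ∈ J, I.need j (s * u j + t * w j) ≤ I.Γ := by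
    have h1 := Finset.sum_le_sum fun j (_ : j ∈ J) =>
      I.need_convex j (a := u j) (b := w j) hs ht hst
    rw [Finset.sum_add_distrib, ← Finset.mul_sum, ← Finset.mul_sum] at h1
    simp only [hb] at hslope
    have h3 : I.Γ = s * I.Γ + t * I.Γ := by rw [← add_mul, hst, one_mul]
    linarith
  obtain ⟨c, hc, h⟩ := I.exists_mem_U J (fun j => s * u j + t * w j) hl hneed
  refine ⟨c, hc, le_trans (le_of_eq ?_) h⟩
  rw [Finset.sum_add_distrib, ← Finset.mul_sum, ← Finset.mul_sum]
  simp only [ha] at hu1 hw1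
  have h1 : I.dualCost J π = (s + t) * I.dualCost J π := by rw [hst, one_mul]
  rw [h1, add_mul]
  nth_rewrite 1 [← hu1]
  rw [← hw1]
  linear_combination π * hslope

/-! ### Behaviour of `f_j` for large `π` and existence of an optimal multiplier. -/

/-- The smallest lower bound of a second-stage cost in part `j`. -/
noncomputable def low (j : Fin m) : ℝ := (I.T j).inf' (I.T_nonempty j) I.cLow

theorem low_le {j : Fin m} {i : Fin n} (hi : i ∈ I.T j) : I.low j ≤ I.cLow i :=
  Finset.inf'_le _ hi

theorem low_le_top (j : Fin m) : I.low j ≤ I.top j := by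
  obtain ⟨i, hi, h⟩ := I.exists_top j
  have := I.low_le hi
  have := I.d_nonneg i
  linarith

theorem need_low (j : Fin m) : I.need j (I.low j) = 0 := by
  refine Finset.sum_eq_zero fun i hi => ?_
  rw [max_eq_left (by linarith [I.low_le hi]), zero_mul]

theorem low_le_fPart (j : Fin m) {π : ℝ} (hπ : 0 ≤ π) : I.low j ≤ I.fPart j π := by
  have := I.le_fPart hπ (I.low_le_top j)
  rwa [need_low, mul_zero, sub_zero] at this

theorem need_pos {j : Fin m} {lam : ℝ} (h1 : I.low j < lam) (h2 : lam ≤ I.top j) :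
    0 < I.need j lam := by
  obtain ⟨i, hi, h⟩ := Finset.exists_mem_eq_inf' (I.T_nonempty j) I.cLow
  refine Finset.sum_pos' (fun i _ => mul_nonneg (le_max_left _ _) (inv_nonneg.2 (I.d_nonneg i)))
    ⟨i, hi, ?_⟩
  have hlt : I.cLow i < lam := by rwa [low, h] at h1
  have := I.d_pos_of_lt_top hi (hlt.trans_le h2)
  rw [max_eq_right (by linarith)]
  exact mul_pos (by linarith) (inv_pos.2 this)

/-- Every line belonging to a level above `low` has strictly negative slope, by `need_pos`, so it
falls below `low` eventually. -/
theorem eventually_fPart_le_low (j : Fin m) : ∀ᶠ π in Filter.atTop, I.fPart j π ≤ I.low j := by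
  have h : ∀ᶠ π : ℝ in Filter.atTop, ∀ lam ∈ I.levels j, lam - π * I.need j lam ≤ I.low j := by
    rw [Filter.eventually_all_finset]
    intro lam hl
    filter_upwards [Filter.eventually_ge_atTop ((lam - I.low j) / I.need j lam),
      Filter.eventually_ge_atTop 0] with π h1 h0
    rcases le_or_gt lam (I.low j) with h | h
    · nlinarith [mul_nonneg h0 (I.need_nonneg j lam)]
    · rw [div_le_iff₀ (I.need_pos h (I.le_top_of_mem_levels hl))] at h1
      linarith
  filter_upwards [h, Filter.eventually_ge_atTop 0] with π hπ h0
  obtain ⟨lam, hl, h⟩ := I.exists_fPart_eq j h0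
  exact h ▸ hπ lam hl

theorem fPart_eq_sup (j : Fin m) {π : ℝ} (hπ : 0 ≤ π) :
    I.fPart j π = (I.levels j).sup' (I.levels_nonempty j) fun lam => lam - π * I.need j lam := by
  apply le_antisymm
  · obtain ⟨lam, hl, h⟩ := I.exists_fPart_eq j hπ
    rw [h]
    exact Finset.le_sup' (fun lam => lam - π * I.need j lam) hl
  · exact Finset.sup'_le _ _ fun lam hl => I.le_fPart hπ (I.le_top_of_mem_levels hl)

theorem continuousOn_fPart (j : Fin m) : ContinuousOn (I.fPart j) (Set.Ici 0) := by
  have : Continuous fun π : ℝ =>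
      (I.levels j).sup' (I.levels_nonempty j) fun lam => lam - π * I.need j lam :=
    Continuous.finset_sup'_apply _ fun lam _ => by fun_prop
  exact this.continuousOn.congr fun π hπ => I.fPart_eq_sup j hπ

/-- Beyond some `P` the parts cannot get cheaper than `low` and `Γ * π` does not decrease, so
compactness of `[0, P]` and continuity suffice. -/
theorem exists_min_dualCost (J : Finset (Fin m)) :
    ∃ π, 0 ≤ π ∧ ∀ π', 0 ≤ π' → I.dualCost J π ≤ I.dualCost J π' := by
  have hev : ∀ᶠ π : ℝ in Filter.atTop, ∀ j ∈ J, I.fPart j π ≤ I.low j := by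
    rw [Filter.eventually_all_finset]
    exact fun j _ => I.eventually_fPart_le_low j
  obtain ⟨P, hP, hP0⟩ := (hev.and (Filter.eventually_ge_atTop 0)).exists
  have hcont : ContinuousOn (I.dualCost J) (Set.Icc 0 P) := by
    have : ContinuousOn (I.dualCost J) (Set.Ici 0) := by
      unfold dualCost
      refine ContinuousOn.add (by fun_prop) ?_
      exact continuousOn_finsetSum _ fun j _ => I.continuousOn_fPart j
    exact this.mono Set.Icc_subset_Ici_self
  obtain ⟨π, hπ, hmin⟩ := isCompact_Icc.exists_isMinOn (Set.nonempty_Icc.2 hP0) hcont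
  refine ⟨π, hπ.1, fun π' h' => ?_⟩
  rcases le_total π' P with h | h
  · exact hmin ⟨h', h⟩
  · refine (hmin ⟨hP0, le_rfl⟩).trans ?_
    unfold dualCost
    gcongr with j hj
    · exact I.Γ_nonneg
    · exact (hP j hj).trans (I.low_le_fPart j h')

/-- At a minimising multiplier weak and strong duality meet, which also shows that the maximum over
`U` is attained. -/
theorem isRobustCost_of_min {x : Fin n → ℝ} (hx : x ∈ I.X) {π : ℝ} (hπ : 0 ≤ π)
    (hmin : ∀ π', 0 ≤ π' → I.dualCost (I.openParts x) π ≤ I.dualCost (I.openParts x) π') :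
    I.IsRobustCost x (∑ i, I.C i * x i + I.dualCost (I.openParts x) π) := by
  refine ⟨_, ⟨?_, ?_⟩, rfl⟩
  · obtain ⟨c, hc, h⟩ := I.exists_dualCost_le_sum_inf _ hπ hmin
    refine ⟨c, hc, ?_⟩
    rw [le_antisymm h (I.sum_inf_le_dualCost hc _ hπ)]
    exact I.isSecondStageCost_sum_inf hx c
  · rintro w ⟨c, hc, hw⟩
    rw [hw.unique (I.isSecondStageCost_sum_inf hx c)]
    exact I.sum_inf_le_dualCost hc _ hπ

theorem IsRobustCost.unique {x : Fin n → ℝ} {v v' : ℝ} (h : I.IsRobustCost x v)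
    (h' : I.IsRobustCost x v') : v = v' := by
  obtain ⟨w, hw, rfl⟩ := h
  obtain ⟨w', hw', rfl⟩ := h'
  rw [hw.unique hw']

theorem IsOptimal.unique {x x' : Fin n → ℝ} {v v' : ℝ} (h : I.IsOptimal x v)
    (h' : I.IsOptimal x' v') : v = v' := by
  apply le_antisymm
  · obtain ⟨w, hw, hle⟩ := h.2.2 x' h'.1
    rwa [hw.unique I h'.2.1] at hle
  · obtain ⟨w, hw, hle⟩ := h'.2.2 x h.1
    rwa [hw.unique I h.2.1] at hle

/-! ### Eliminating the first stage: reduction of both problems to the minimisation of `f`. -/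

/-- The smallest first-stage cost in part `j`. -/
noncomputable def minC (j : Fin m) : ℝ := (I.T j).inf' (I.T_nonempty j) I.C

theorem f_eq (π : ℝ) : I.f π = I.Γ * π + ∑ j, min (I.minC j) (I.fPart j π) := rfl

/-- An open part pays at least `f_j`, as first-stage costs are nonnegative; a part served by `x`
pays at least its smallest first-stage cost. -/
theorem f_le {x : Fin n → ℝ} (hx : ∀ i, 0 ≤ x i)
    (h01 : ∀ j, ∑ i ∈ I.T j, x i = 0 ∨ ∑ i ∈ I.T j, x i = 1) (π : ℝ) :
    I.f π ≤ ∑ i, I.C i * x i + I.dualCost (I.openParts x) π := by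
  have : ∑ j, min (I.minC j) (I.fPart j π) ≤
      ∑ i, I.C i * x i + ∑ j ∈ I.openParts x, I.fPart j π := by
    rw [← I.sum_parts, openParts, Finset.sum_filter, ← Finset.sum_add_distrib]
    refine Finset.sum_le_sum fun j _ => ?_
    rcases h01 j with h | h
    · rw [if_pos h]
      have : 0 ≤ ∑ i ∈ I.T j, I.C i * x i :=
        Finset.sum_nonneg fun i _ => mul_nonneg (I.C_nonneg i) (hx i)
      linarith [min_le_right (I.minC j) (I.fPart j π)]
    · rw [if_neg (by rw [h]; exact one_ne_zero), add_zero]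
      refine (min_le_left _ _).trans ?_
      rw [← mul_one (I.minC j), ← h, Finset.mul_sum]
      exact Finset.sum_le_sum fun i hi =>
        mul_le_mul_of_nonneg_right (Finset.inf'_le _ hi) (hx i)
  rw [f_eq, dualCost]
  linarith

/-- The restriction of `y` and `ρ` to an open part is feasible in the problem that defines `f_j`,
and the remaining terms are nonnegative. -/
theorem f_le_mipCost {x y : Fin n → ℝ} {π : ℝ} {ρ : Fin n → ℝ} (h : I.MIPFeasible x y π ρ) :
    I.f π ≤ I.mipCost x y π ρ := by
  obtain ⟨hxy, -, hd, hx, hy, hπ, hρ⟩ := h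
  have hx0 := nonneg_of_zero_or_one hx
  have hX : x ∈ I.X := by
    refine ⟨hx, fun j => ?_⟩
    rw [← hxy j]
    exact Finset.sum_le_sum fun i _ => le_add_of_nonneg_right (hy i).1
  refine (I.f_le hx0 (I.sum_eq_zero_or_one hX) π).trans ?_
  have : ∑ j ∈ I.openParts x, I.fPart j π ≤ ∑ i, I.cLow i * y i + ∑ i, ρ i := by
    rw [← I.sum_parts, ← I.sum_parts, ← Finset.sum_add_distrib]
    refine le_trans (Finset.sum_le_sum fun j hj => ?_)
      (Finset.sum_le_sum_of_subset_of_nonneg (Finset.subset_univ (I.openParts x)) ?_)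
    · refine (I.isLeast_partValues j hπ).2 ⟨y, ρ, ?_, fun i _ => hd i, fun i _ => hy i,
        fun i _ => hρ i, rfl⟩
      have := hxy j
      rwa [Finset.sum_add_distrib, I.mem_openParts.1 hj, zero_add] at this
    · intro j _ _
      exact add_nonneg (Finset.sum_nonneg fun i _ => mul_nonneg (I.cLow_nonneg i) (hy i).1)
        (Finset.sum_nonneg fun i _ => hρ i)
  rw [dualCost, mipCost]
  linarith

/-- Optimal solutions of the open parts for the common `π` are glued together and extended by zero.
-/
theorem exists_mipFeasible {x : Fin n → ℝ} (hx : x ∈ I.X) {π : ℝ} (hπ : 0 ≤ π) :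
    ∃ y ρ, I.MIPFeasible x y π ρ ∧
      I.mipCost x y π ρ = ∑ i, I.C i * x i + I.dualCost (I.openParts x) π := by
  have hx0 := nonneg_of_zero_or_one hx.1
  choose y ρ hy hd hy01 hρ hv using fun j => (I.isLeast_partValues j hπ).1
  have hT : ∀ i, i ∈ I.T (I.part i) := fun i => I.mem_T.2 rfl
  have hoff : ∀ {j i}, i ∈ I.T j → (I.part i ∈ I.openParts x ↔ j ∈ I.openParts x) :=
    fun hi => by rw [I.mem_T.1 hi]
  refine ⟨fun i => if I.part i ∈ I.openParts x then y (I.part i) i else 0,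
    fun i => if I.part i ∈ I.openParts x then ρ (I.part i) i else 0,
    ⟨fun j => ?_, fun i => ?_, fun i => ?_, hx.1, fun i => ?_, hπ, fun i => ?_⟩, ?_⟩
  · rw [Finset.sum_add_distrib]
    by_cases hj : j ∈ I.openParts x
    · rw [I.mem_openParts.1 hj, zero_add, ← hy j]
      refine Finset.sum_congr rfl fun i hi => ?_
      rw [I.mem_T] at hi
      simp [hi, hj]
    · rw [(I.sum_eq_zero_or_one hx j).resolve_left fun h => hj (I.mem_openParts.2 h),
        Finset.sum_eq_zero, add_zero]
      intro i hi
      rw [I.mem_T] at hi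
      simp [hi, hj]
  · dsimp only
    split_ifs with h
    · rw [I.eq_zero_of_openParts hx0 (I.mem_openParts.1 h) i (hT i), zero_add]
      exact (hy01 _ i (hT i)).2
    · rcases hx.1 i with h | h <;> simp [h]
  · dsimp only
    split_ifs
    · exact hd _ i (hT i)
    · simpa using hπ
  · dsimp only
    split_ifs
    · exact hy01 _ i (hT i)
    · simp
  · dsimp only
    split_ifs
    · exact hρ _ i (hT i)
    · simp
  · have : ∑ i, I.cLow i * (if I.part i ∈ I.openParts x then y (I.part i) i else 0) +
        ∑ i, (if I.part i ∈ I.openParts x then ρ (I.part i) i else 0) =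
        ∑ j ∈ I.openParts x, I.fPart j π := by
      rw [← I.sum_parts, ← I.sum_parts
        (fun i => if I.part i ∈ I.openParts x then ρ (I.part i) i else 0), ← Finset.sum_add_distrib,
        ← Finset.sum_subset (Finset.subset_univ (I.openParts x))]
      · refine Finset.sum_congr rfl fun j hj => ?_
        rw [hv j]
        congr 1 <;>
        · refine Finset.sum_congr rfl fun i hi => ?_
          rw [I.mem_T] at hi
          simp [hi, hj]
      · intro j _ hj
        have : ∀ i ∈ I.T j, I.part i ∉ I.openParts x := fun i hi => by rwa [hoff hi]
        rw [Finset.sum_eq_zero fun i hi => by simp [this i hi],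
          Finset.sum_eq_zero fun i hi => by simp [this i hi], add_zero]
    rw [mipCost, dualCost]
    linarith

/-- A minimiser of `f`, and a selection that attains the minima in `f`, are optimal. -/
theorem isOptimal_of_min {x : Fin n → ℝ} (hx : ∀ i, x i = 0 ∨ x i = 1) {π : ℝ} (hπ : 0 ≤ π)
    (hmin : ∀ π', 0 ≤ π' → I.f π ≤ I.f π')
    (hpart : ∀ j, (∑ i ∈ I.T j, x i = 0 ∧ I.fPart j π ≤ I.minC j) ∨
      (∑ i ∈ I.T j, x i = 1 ∧ ∑ i ∈ I.T j, I.C i * x i = I.minC j ∧ I.minC j ≤ I.fPart j π)) :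
    I.IsOptimal x (I.f π) ∧ I.IsMIPOptimal x π (I.f π) := by
  have hx0 := nonneg_of_zero_or_one hx
  have hX : x ∈ I.X := by
    refine ⟨hx, fun j => ?_⟩
    rcases hpart j with h | h
    · rw [h.1]; exact zero_le_one
    · rw [h.1]
  have hval : ∑ i, I.C i * x i + I.dualCost (I.openParts x) π = I.f π := by
    have : ∑ j, min (I.minC j) (I.fPart j π) =
        ∑ i, I.C i * x i + ∑ j ∈ I.openParts x, I.fPart j π := by
      rw [← I.sum_parts, openParts, Finset.sum_filter, ← Finset.sum_add_distrib]
      refine Finset.sum_congr rfl fun j _ => ?_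
      rcases hpart j with ⟨h1, h2⟩ | ⟨h1, h2, h3⟩
      · rw [if_pos h1, min_eq_right h2, Finset.sum_eq_zero, zero_add]
        intro i hi
        rw [I.eq_zero_of_openParts hx0 h1 i hi, mul_zero]
      · rw [if_neg (by rw [h1]; exact one_ne_zero), min_eq_left h3, h2, add_zero]
    rw [f_eq, dualCost]
    linarith
  have hle : ∀ x' ∈ I.X, ∀ π', 0 ≤ π' →
      I.f π ≤ ∑ i, I.C i * x' i + I.dualCost (I.openParts x') π' := fun x' hx' π' hπ' =>
    (hmin π' hπ').trans (I.f_le (nonneg_of_zero_or_one hx'.1) (I.sum_eq_zero_or_one hx') π')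
  refine ⟨⟨hX, ?_, fun x' hx' => ?_⟩, ?_, fun x' y' π' ρ' h => ?_⟩
  · rw [← hval]
    -- For this `x` the upper bound on `f` is tight at `π`, so a minimiser of `f` also minimises the
    -- dual cost of `x`.
    refine I.isRobustCost_of_min hX hπ fun π' hπ' => ?_
    have := hle x hX π' hπ'
    linarith
  · obtain ⟨π', hπ', hm⟩ := I.exists_min_dualCost (I.openParts x')
    exact ⟨_, I.isRobustCost_of_min hx' hπ' hm, hle x' hx' π' hπ'⟩
  · rw [← hval]
    exact I.exists_mipFeasible hX hπ
  · exact (hmin π' h.2.2.2.2.2.1).trans (I.f_le_mipCost h)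

end RepSel.Instance

/-! ### From sorted levels to ramps, and cutting the ramps at a constant. -/

namespace RepSel

/-! Scanning a sequence of levels `lev k`, with reciprocal deviations `e k` and part indices
`p k`. -/

section Scan

variable (lev e : ℕ → ℝ) (p : ℕ → ℕ) (C : ℕ → ℝ)

/-- The sum of the reciprocal deviations of part `j` among the first `k` levels. -/
noncomputable def accInv : ℕ → ℕ → ℝ
  | 0, _ => 0
  | k + 1, j => if j = p k then accInv k j + e k else accInv k j

/-- The last of the first `k` levels that belongs to part `j`. -/
noncomputable def lastLevel : ℕ → ℕ → ℝ
  | 0, _ => 0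
  | k + 1, j => if j = p k then lev k else lastLevel k j

/-- The location of the ramp that starts at level `k`. -/
noncomputable def rampLoc (k : ℕ) : ℝ := 1 / accInv e p k (p k)

/-- The slope of the ramp that starts at level `k`. -/
noncomputable def rampWeight (k : ℕ) : ℝ := (lev k - lastLevel lev p k (p k)) * accInv e p k (p k)

/-- The sum of the slopes of part `j` among the first `k` levels. -/
noncomputable def accWeight : ℕ → ℕ → ℝ
  | 0, _ => 0
  | k + 1, j => if j = p k then accWeight k j + rampWeight lev e p k else accWeight k j

/-- The point up to which selecting in the first stage is better. -/
noncomputable def cap : ℕ → ℕ → ℝ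
  | 0, _ => 0
  | k + 1, j => if j = p k then max (cap k j) ((lev k - C j) / accWeight lev e p (k + 1) j)
      else cap k j

/-- The sum of the ramps of part `j` among the first `k` levels. -/
noncomputable def ramps (k j : ℕ) (π : ℝ) : ℝ :=
  ∑ l ∈ Finset.range k, if p l = j then rampWeight lev e p l * max 0 (rampLoc e p l - π) else 0

/-- The budget needed for raising part `j` to `lam`. -/
noncomputable def seqNeed (K j : ℕ) (lam : ℝ) : ℝ :=
  ∑ l ∈ Finset.range K, if p l = j then max 0 (lam - lev l) * e l else 0

/-- The properties of the levels of part `j` in a sorted sequence of `K` levels. -/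
structure IsLevelSeq (K j : ℕ) (lo top : ℝ) : Prop where
  mono : ∀ k l, k ≤ l → l < K → lev k ≤ lev l
  e_nonneg : ∀ k < K, 0 ≤ e k
  lo_le : ∀ k < K, p k = j → lo ≤ lev k
  exists_lo : ∃ k < K, p k = j ∧ lev k = lo
  le_top : ∀ k < K, p k = j → lev k ≤ top
  top_of_e : ∀ k < K, p k = j → e k = 0 → lev k = top

variable {lev e p C} {K j : ℕ} {lo top : ℝ}

theorem accInv_eq_sum (k : ℕ) : accInv e p k j = ∑ l ∈ Finset.range k, if p l = j then e l else 0 := by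
  induction k with
  | zero => rfl
  | succ k ih =>
    rw [Finset.sum_range_succ, ← ih, accInv]
    split_ifs with h1 h2 h2
    · rfl
    · exact absurd h1.symm h2
    · exact absurd h2.symm h1
    · rw [add_zero]

theorem accInv_nonneg {k : ℕ} (h : ∀ l < k, 0 ≤ e l) : 0 ≤ accInv e p k j := by
  rw [accInv_eq_sum]
  refine Finset.sum_nonneg fun l hl => ?_
  split_ifs
  · exact h l (Finset.mem_range.1 hl)
  · exact le_rfl

theorem seqNeed_nonneg (h : IsLevelSeq lev e p K j lo top) (lam : ℝ) :
    0 ≤ seqNeed lev e p K j lam := by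
  refine Finset.sum_nonneg fun l hl => ?_
  split_ifs
  · exact mul_nonneg (le_max_left _ _) (h.e_nonneg l (Finset.mem_range.1 hl))
  · exact le_rfl

theorem seqNeed_lo (h : IsLevelSeq lev e p K j lo top) : seqNeed lev e p K j lo = 0 := by
  refine Finset.sum_eq_zero fun l hl => ?_
  split_ifs with hp
  · rw [max_eq_left (by linarith [h.lo_le l (Finset.mem_range.1 hl) hp]), zero_mul]
  · rfl

theorem seqNeed_pos (h : IsLevelSeq lev e p K j lo top) {lam : ℝ} (h1 : lo < lam) (h2 : lam ≤ top) :
    0 < seqNeed lev e p K j lam := by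
  obtain ⟨k, hk, hp, hlo⟩ := h.exists_lo
  refine Finset.sum_pos' (fun l hl => ?_) ⟨k, Finset.mem_range.2 hk, ?_⟩
  · split_ifs
    · exact mul_nonneg (le_max_left _ _) (h.e_nonneg l (Finset.mem_range.1 hl))
    · exact le_rfl
  · rw [if_pos hp, max_eq_right (by linarith)]
    refine mul_pos (by linarith) ((h.e_nonneg k hk).lt_of_ne fun he => ?_)
    have := h.top_of_e k hk hp he.symm
    linarith

/-- The budget grows between two consecutive levels at the rate `accInv`. -/
theorem seqNeed_step (h : IsLevelSeq lev e p K j lo top) {k : ℕ} (hk : k < K) {last : ℝ}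
    (h1 : ∀ l < k, p l = j → lev l ≤ last) (h2 : last ≤ lev k) :
    seqNeed lev e p K j (lev k) = seqNeed lev e p K j last + (lev k - last) * accInv e p k j := by
  have hs : Finset.range k ⊆ Finset.range K := Finset.range_subset_range.2 hk.le
  -- By sortedness the levels from `k` on lie above `lam` and contribute nothing.
  have hz : ∀ lam ≤ lev k, seqNeed lev e p K j lam =
      ∑ l ∈ Finset.range k, if p l = j then max 0 (lam - lev l) * e l else 0 := by
    intro lam hlam
    rw [seqNeed, ← Finset.sum_subset hs]
    intro l hl hl'
    rw [Finset.mem_range] at hl hl'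
    have := h.mono k l (not_lt.1 hl') hl
    rw [max_eq_left (by linarith)]
    simp
  rw [hz _ le_rfl, hz _ h2, accInv_eq_sum, Finset.mul_sum, ← Finset.sum_add_distrib]
  refine Finset.sum_congr rfl fun l hl => ?_
  split_ifs with hp
  · have := h1 l (Finset.mem_range.1 hl) hp
    rw [max_eq_right (by linarith), max_eq_right (by linarith)]
    ring
  · ring

/-- The state of a part of which at least one level has been scanned. -/
structure ScanInv (lev e : ℕ → ℝ) (p : ℕ → ℕ) (C : ℕ → ℝ) (K j : ℕ) (lo top : ℝ) (k : ℕ) :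
    Prop where
  exists_last : ∃ l < k, p l = j ∧ lastLevel lev p k j = lev l
  le_last : ∀ l < k, p l = j → lev l ≤ lastLevel lev p k j
  last_eq_top : accInv e p k j = 0 → lastLevel lev p k j = top
  weight : accWeight lev e p k j = seqNeed lev e p K j (lastLevel lev p k j)
  line_le : ∀ π, 0 ≤ π → ∀ l < k, p l = j →
    lev l - π * seqNeed lev e p K j (lev l) ≤ lo + ramps lev e p k j π
  exists_line : ∀ π, 0 ≤ π → ∃ l < k, p l = j ∧
    lo + ramps lev e p k j π = lev l - π * seqNeed lev e p K j (lev l)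
  last_line : ∀ π, 0 ≤ π → π * accInv e p k j ≤ 1 → lo + ramps lev e p k j π =
    lastLevel lev p k j - π * seqNeed lev e p K j (lastLevel lev p k j)
  le_cap : ∀ l < k, p l = j → (lev l - C j) / seqNeed lev e p K j (lev l) ≤ cap lev e p C k j
  exists_cap : cap lev e p C k j = 0 ∨ ∃ l < k, p l = j ∧
    cap lev e p C k j = (lev l - C j) / seqNeed lev e p K j (lev l)

theorem cap_nonneg (k : ℕ) : 0 ≤ cap lev e p C k j := by
  induction k with
  | zero => exact le_rfl
  | succ k ih =>
    rw [cap]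
    split_ifs
    · exact ih.trans (le_max_left _ _)
    · exact ih

theorem ramps_succ (k : ℕ) (π : ℝ) : ramps lev e p (k + 1) j π = ramps lev e p k j π +
    if p k = j then rampWeight lev e p k * max 0 (rampLoc e p k - π) else 0 :=
  Finset.sum_range_succ _ _

theorem unvisited {k : ℕ} (hk : ∀ l < k, p l ≠ j) : accInv e p k j = 0 ∧
    accWeight lev e p k j = 0 ∧ cap lev e p C k j = 0 ∧ ∀ π, ramps lev e p k j π = 0 := by
  induction k with
  | zero => exact ⟨rfl, rfl, rfl, fun _ => rfl⟩
  | succ k ih =>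
    obtain ⟨h1, h2, h3, h4⟩ := ih fun l hl => hk l (hl.trans k.lt_succ_self)
    have hne : ¬ j = p k := fun h => hk k k.lt_succ_self h.symm
    have hne' : ¬ p k = j := fun h => hne h.symm
    refine ⟨by rw [accInv, if_neg hne, h1], by rw [accWeight, if_neg hne, h2],
      by rw [cap, if_neg hne, h3], fun π => by rw [ramps_succ, if_neg hne', h4, add_zero]⟩

/-- The first level of a part is `lo` because the sequence is sorted. Its ramp has weight `0`, and
its quotient in `cap` is a division by `0`, hence `0`, so neither needs a special case in the
program. -/
theorem scanInv_of_first (h : IsLevelSeq lev e p K j lo top) {k : ℕ} (hk : k < K) (hp : p k = j)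
    (hf : ∀ l < k, p l ≠ j) : ScanInv lev e p C K j lo top (k + 1) := by
  obtain ⟨h1, h2, h3, h4⟩ := unvisited (lev := lev) (e := e) (C := C) hf
  have hlev : lev k = lo := by
    obtain ⟨l, hl, hpl, hlo⟩ := h.exists_lo
    refine le_antisymm ?_ (h.lo_le k hk hp)
    rw [← hlo]
    exact h.mono k l (not_lt.1 fun hlt => hf l hlt hpl) hl
  have hw : rampWeight lev e p k = 0 := by rw [rampWeight, hp, h1, mul_zero]
  have e1 : accInv e p (k + 1) j = e k := by rw [accInv, if_pos hp.symm, h1, zero_add]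
  have e2 : lastLevel lev p (k + 1) j = lo := by rw [lastLevel, if_pos hp.symm, hlev]
  have e3 : accWeight lev e p (k + 1) j = 0 := by rw [accWeight, if_pos hp.symm, h2, hw, add_zero]
  have e4 : cap lev e p C (k + 1) j = 0 := by rw [cap, if_pos hp.symm, h3, e3, div_zero, max_self]
  have e5 : ∀ π, ramps lev e p (k + 1) j π = 0 := fun π => by
    rw [ramps_succ, h4, hw, zero_mul, ite_self, add_zero]
  have hlt : ∀ l < k + 1, p l = j → l = k := fun l hl hpl => by
    by_contra hne
    exact hf l (by omega) hpl
  have hk1 := k.lt_succ_self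
  have hn := seqNeed_lo h
  refine ⟨⟨k, hk1, hp, by rw [e2, hlev]⟩, ?_, ?_, ?_, ?_, ?_, ?_, ?_, Or.inl e4⟩
  · intro l hl hpl
    rw [hlt l hl hpl, e2, hlev]
  · rw [e1, e2, ← hlev]
    exact h.top_of_e k hk hp
  · rw [e3, e2, hn]
  · intro π _ l hl hpl
    rw [hlt l hl hpl, hlev, hn, e5]
    simp
  · intro π _
    exact ⟨k, hk1, hp, by rw [hlev, hn, e5]; simp⟩
  · intro π _ _
    rw [e5, e2, hn]
    simp
  · intro l hl hpl
    rw [hlt l hl hpl, hlev, hn, e4, div_zero]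

theorem ScanInv.skip {k : ℕ} (hI : ScanInv lev e p C K j lo top k) (hp : p k ≠ j) :
    ScanInv lev e p C K j lo top (k + 1) := by
  have hne : ¬ j = p k := fun h => hp h.symm
  have e1 : accInv e p (k + 1) j = accInv e p k j := by rw [accInv, if_neg hne]
  have e2 : lastLevel lev p (k + 1) j = lastLevel lev p k j := by rw [lastLevel, if_neg hne]
  have e3 : accWeight lev e p (k + 1) j = accWeight lev e p k j := by rw [accWeight, if_neg hne]
  have e4 : cap lev e p C (k + 1) j = cap lev e p C k j := by rw [cap, if_neg hne]
  have e5 : ∀ π, ramps lev e p (k + 1) j π = ramps lev e p k j π := fun π => by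
    rw [ramps_succ, if_neg hp, add_zero]
  have hall : ∀ {q : ℕ → Prop}, (∀ l < k, p l = j → q l) → ∀ l < k + 1, p l = j → q l := by
    intro q hq l hl hpl
    rcases Nat.lt_succ_iff_lt_or_eq.1 hl with hl | rfl
    · exact hq l hl hpl
    · exact absurd hpl hp
  have hex : ∀ {q : ℕ → Prop}, (∃ l < k, p l = j ∧ q l) → ∃ l < k + 1, p l = j ∧ q l :=
    fun ⟨l, hl, hq⟩ => ⟨l, hl.trans k.lt_succ_self, hq⟩
  constructor
  · rw [e2]; exact hex hI.exists_last
  · rw [e2]; exact hall hI.le_last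
  · rw [e1, e2]; exact hI.last_eq_top
  · rw [e3, e2]; exact hI.weight
  · intro π hπ; rw [e5]; exact hall (hI.line_le π hπ)
  · intro π hπ; rw [e5]; exact hex (hI.exists_line π hπ)
  · intro π hπ; rw [e5, e1, e2]; exact hI.last_line π hπ
  · rw [e4]; exact hall hI.le_cap
  · rw [e4]; exact hI.exists_cap.imp_right hex

/-- The new line exceeds the line of the previous level by `gap * (1 - π * D)`. As long as this is
nonnegative the previous line is the maximum so far (`last_line`), and afterwards the new line is
irrelevant; adding the positive part therefore updates the upper envelope in both cases. -/
theorem ScanInv.step {k : ℕ} (hI : ScanInv lev e p C K j lo top k)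
    (h : IsLevelSeq lev e p K j lo top) (hk : k < K) (hp : p k = j) :
    ScanInv lev e p C K j lo top (k + 1) := by
  have hlast : lastLevel lev p k j ≤ lev k := by
    obtain ⟨l, hl, -, he⟩ := hI.exists_last
    exact he ▸ h.mono l k hl.le hk
  have hD0 : 0 ≤ accInv e p k j := accInv_nonneg fun l hl => h.e_nonneg l (hl.trans hk)
  have hstep := seqNeed_step h hk hI.le_last hlast
  set D := accInv e p k j with hD
  set last := lastLevel lev p k j with hlastdef
  -- If `D = 0`, the location `1 / D` is meaningless, but the previous level is already `top` and
  -- the gap vanishes.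
  have hgap : D = 0 → lev k = last := fun h0 => by
    have := hI.last_eq_top h0
    have := h.le_top k hk hp
    linarith
  have hramp : ∀ π, 0 ≤ π → rampWeight lev e p k * max 0 (rampLoc e p k - π) =
      (lev k - last) * max 0 (1 - π * D) := by
    intro π hπ
    rw [rampWeight, rampLoc, hp, ← hD, ← hlastdef]
    rcases hD0.eq_or_lt with h0 | h0
    · rw [hgap h0.symm]
      simp
    · rw [mul_assoc, mul_max_of_nonneg _ _ hD0, mul_zero, mul_sub, mul_one_div_cancel h0.ne',
        mul_comm D π]
  have e1 : accInv e p (k + 1) j = D + e k := by rw [accInv, if_pos hp.symm]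
  have e2 : lastLevel lev p (k + 1) j = lev k := by rw [lastLevel, if_pos hp.symm]
  have e3 : accWeight lev e p (k + 1) j = seqNeed lev e p K j (lev k) := by
    rw [accWeight, if_pos hp.symm, hI.weight, hstep, rampWeight, hp]
  have e4 : cap lev e p C (k + 1) j =
      max (cap lev e p C k j) ((lev k - C j) / seqNeed lev e p K j (lev k)) := by
    rw [cap, if_pos hp.symm, e3]
  have e5 : ∀ π, 0 ≤ π → ramps lev e p (k + 1) j π =
      ramps lev e p k j π + (lev k - last) * max 0 (1 - π * D) := fun π hπ => by
    rw [ramps_succ, if_pos hp, hramp π hπ]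
  have hk1 := k.lt_succ_self
  have he0 := h.e_nonneg k hk
  have hinc : ∀ π, ramps lev e p k j π ≤
      ramps lev e p k j π + (lev k - last) * max 0 (1 - π * D) := fun π =>
    le_add_of_nonneg_right (mul_nonneg (by linarith) (le_max_left _ _))
  have hnew : ∀ π, 0 ≤ π → π * D ≤ 1 →
      lo + (ramps lev e p k j π + (lev k - last) * max 0 (1 - π * D)) =
        lev k - π * seqNeed lev e p K j (lev k) := by
    intro π hπ hπD
    have := hI.last_line π hπ hπD
    rw [max_eq_right (by linarith), hstep]
    linear_combination this
  constructor
  · exact ⟨k, hk1, hp, e2⟩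
  · intro l hl hpl
    rw [e2]
    exact h.mono l k (Nat.lt_succ_iff.1 hl) hk
  · rw [e1, e2]
    intro h0
    exact h.top_of_e k hk hp (by linarith)
  · rw [e3, e2]
  · intro π hπ l hl hpl
    rw [e5 π hπ]
    rcases Nat.lt_succ_iff_lt_or_eq.1 hl with hl | rfl
    · linarith [hI.line_le π hπ l hl hpl, hinc π]
    -- To the left of the ramp's end the new line is the envelope; to the right it lies below the
    -- line of the previous level.
    · rcases le_total (π * D) 1 with hle | hge
      · exact (hnew π hπ hle).ge
      · have h1 : last - π * seqNeed lev e p K j last ≤ lo + ramps lev e p l j π := by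
          obtain ⟨i, hi, hpi, he⟩ := hI.exists_last
          rw [← hlastdef] at he
          rw [he]
          exact hI.line_le π hπ i hi hpi
        rw [hstep]
        nlinarith [hinc π]
  · intro π hπ
    rw [e5 π hπ]
    rcases le_total (π * D) 1 with hle | hge
    · exact ⟨k, hk1, hp, hnew π hπ hle⟩
    · obtain ⟨l, hl, hpl, he⟩ := hI.exists_line π hπ
      refine ⟨l, hl.trans hk1, hpl, ?_⟩
      rw [max_eq_left (by linarith), mul_zero, add_zero, he]
  · intro π hπ hle
    rw [e5 π hπ, e2]
    refine hnew π hπ ?_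
    rw [e1] at hle
    -- Enlarging `D` by `e k ≥ 0` only strengthens the condition on `π`.
    nlinarith [mul_nonneg hπ he0]
  · intro l hl hpl
    rw [e4]
    rcases Nat.lt_succ_iff_lt_or_eq.1 hl with hl | rfl
    · exact (hI.le_cap l hl hpl).trans (le_max_left _ _)
    · exact le_max_right _ _
  · rw [e4]
    rcases max_choice (cap lev e p C k j) ((lev k - C j) / seqNeed lev e p K j (lev k)) with hm | hm
    · rw [hm]
      exact hI.exists_cap.imp_right fun ⟨l, hl, hq⟩ => ⟨l, hl.trans hk1, hq⟩
    · rw [hm]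
      exact Or.inr ⟨k, hk1, hp, rfl⟩

theorem scanInv (h : IsLevelSeq lev e p K j lo top) : ScanInv lev e p C K j lo top K := by
  have key : ∀ k ≤ K, (∀ l < k, p l ≠ j) ∨ ScanInv lev e p C K j lo top k := by
    intro k
    induction k with
    | zero => exact fun _ => Or.inl fun l hl => absurd hl l.not_lt_zero
    | succ k ih =>
      intro hk
      by_cases hp : p k = j
      · right
        rcases ih (Nat.le_of_succ_le hk) with hf | hI
        · exact scanInv_of_first h hk hp hf
        · exact hI.step h hk hp
      · refine (ih (Nat.le_of_succ_le hk)).imp (fun hf l hl => ?_) fun hI => hI.skip hp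
        rcases Nat.lt_succ_iff_lt_or_eq.1 hl with hl | rfl
        · exact hf l hl
        · exact hp
  refine (key K le_rfl).resolve_left fun hf => ?_
  obtain ⟨k, hk, hp, -⟩ := h.exists_lo
  exact hf k hk hp

theorem lo_le_ramps (h : IsLevelSeq lev e p K j lo top) {π : ℝ} (hπ : 0 ≤ π) :
    lo ≤ lo + ramps lev e p K j π := by
  obtain ⟨k, hk, hp, hlo⟩ := h.exists_lo
  have := (scanInv (C := 0) h).line_le π hπ k hk hp
  rwa [hlo, seqNeed_lo h, mul_zero, sub_zero] at this

/-- The line of a level above `lo` meets the constant `C` at `(lev - C) / need`, and `cap` is at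
least all these crossings. Only the constant line at `lo` can stay above `C`, hence the maximum on
the right. -/
theorem ramps_le_of_cap_le (h : IsLevelSeq lev e p K j lo top) {π : ℝ}
    (hq : cap lev e p C K j ≤ π) : lo + ramps lev e p K j π ≤ max lo (C j) := by
  have hπ : 0 ≤ π := (cap_nonneg K).trans hq
  have hI := scanInv (C := C) h
  obtain ⟨l, hl, hp, he⟩ := hI.exists_line π hπ
  rw [he]
  rcases (h.lo_le l hl hp).eq_or_lt with hlo | hlo
  · rw [← hlo, seqNeed_lo h]
    simp
  · have hN := seqNeed_pos h hlo (h.le_top l hl hp)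
    have := (hI.le_cap l hl hp).trans hq
    rw [div_le_iff₀ hN] at this
    exact le_max_of_le_right (by linarith)

/-- To the left of `cap` the line whose crossing defines `cap` is still at least `C`, and the
envelope lies above it. -/
theorem le_ramps_of_le_cap (h : IsLevelSeq lev e p K j lo top) {π : ℝ} (hπ : 0 ≤ π)
    (hq : π < cap lev e p C K j) : C j ≤ lo + ramps lev e p K j π := by
  have hI := scanInv (C := C) h
  rcases hI.exists_cap with h0 | ⟨l, hl, hp, he⟩
  · linarith
  · have hN : 0 < seqNeed lev e p K j (lev l) := by
      refine (seqNeed_nonneg h _).lt_of_ne fun h0 => ?_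
      rw [← h0, div_zero] at he
      linarith
    have := hI.line_le π hπ l hl hp
    rw [he, lt_div_iff₀ hN] at hq
    linarith

/-- Freezing a ramp to the left of `q` amounts to subtracting a second ramp; if the first one ends
before `q`, the two cancel. -/
theorem ramp_sub_ramp (x q π : ℝ) :
    max 0 (x - π) - max 0 (min x q - π) = max 0 (x - max π q) := by
  rcases le_total x q with h1 | h1 <;> rcases le_total π q with h2 | h2 <;>
    rcases le_total x π with h3 | h3 <;> rcases le_total q π with h4 | h4 <;>
    simp_all <;> linarith

theorem sum_ramp_sub_ramp (q π : ℝ) :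
    (∑ l ∈ Finset.range K, if p l = j then rampWeight lev e p l *
      (max 0 (rampLoc e p l - π) - max 0 (min (rampLoc e p l) q - π)) else 0) =
    ramps lev e p K j (max π q) := by
  simp only [ramp_sub_ramp]
  rfl

/-- The minimum of a constant and the ramps is again a sum of ramps. -/
theorem min_ramps (h : IsLevelSeq lev e p K j lo top) {π : ℝ} (hπ : 0 ≤ π) :
    min (C j) (lo + ramps lev e p K j π) =
      min lo (C j) + ramps lev e p K j (max π (cap lev e p C K j)) := by
  set q := cap lev e p C K j with hq
  have hm : 0 ≤ max π q := hπ.trans (le_max_left _ _)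
  have h1 := lo_le_ramps h hπ
  have h2 := lo_le_ramps h hm
  have h3 := ramps_le_of_cap_le (C := C) h (le_max_right π q)
  -- If the first stage is never more expensive, the ramps already vanish at `cap`, and both sides
  -- equal `C`.
  rcases le_total (C j) lo with hC | hC
  · rw [min_eq_right hC, min_eq_left (hC.trans h1)]
    rw [max_eq_left hC] at h3
    linarith
  · rw [min_eq_left hC]
    rw [max_eq_right hC] at h3
    rcases le_or_gt q π with hle | hlt
    · rw [max_eq_left hle] at h3 ⊢
      exact min_eq_right h3
    · rw [min_eq_left (le_ramps_of_le_cap h hπ hlt)]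
      -- It remains to see that the envelope has the value `C` at `cap` itself; the line that
      -- defines a positive `cap` passes through `C` there.
      refine le_antisymm ?_ h3
      have hI := scanInv (C := C) h
      rw [max_eq_right hlt.le]
      have hq0 : 0 < q := hπ.trans_lt hlt
      rcases hI.exists_cap with h0 | ⟨l, hl, hp, he⟩
      · exact absurd h0 hq0.ne'
      · have := hI.line_le q hq0.le l hl hp
        have hN : seqNeed lev e p K j (lev l) ≠ 0 := by
          intro h0
          rw [h0, div_zero] at he
          exact hq0.ne' he
        rw [eq_div_iff hN] at he
        linarith

end Scan

end RepSel

/-! ### The function `f` as an affine function plus `4n` ramps. -/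

namespace RepSel

/-- `σ` sorts the indices below `N` by the keys `key`. -/
structure Sorts (key : ℕ → ℝ) (N : ℕ) (σ : ℕ → ℕ) : Prop where
  bij : Set.BijOn σ (Set.Iio N) (Set.Iio N)
  mono : ∀ k l, k ≤ l → l < N → key (σ k) ≤ key (σ l)

theorem Sorts.sum_comp {key : ℕ → ℝ} {N : ℕ} {σ : ℕ → ℕ} (h : Sorts key N σ) (g : ℕ → ℝ) :
    ∑ k ∈ Finset.range N, g (σ k) = ∑ k ∈ Finset.range N, g k := by
  refine Finset.sum_nbij σ (fun k hk => ?_) ?_ ?_ fun _ _ => rfl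
  · exact Finset.mem_range.2 (h.bij.mapsTo (Finset.mem_range.1 hk))
  · simpa [Finset.coe_range] using h.bij.injOn
  · simpa [Finset.coe_range] using h.bij.surjOn

namespace Instance

variable {n m : ℕ} (I : Instance n m)

/-- The levels of all parts: the `2n` cells of the arrays hold the levels `min (c_i, top)` and
`top`, with the reciprocal deviations `1 / d_i` and `0`. -/
structure IsLevelData (L E : ℕ → ℝ) (P : ℕ → ℕ) : Prop where
  level : ∀ i : Fin n, L i = min (I.cLow i) (I.top (I.part i))
  level_add : ∀ i : Fin n, L (n + i) = I.top (I.part i)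
  inv : ∀ i : Fin n, E i = (I.d i)⁻¹
  inv_add : ∀ i : Fin n, E (n + i) = 0
  part : ∀ i : Fin n, P i = I.part i
  part_add : ∀ i : Fin n, P (n + i) = I.part i

variable {I} {L E : ℕ → ℝ} {P : ℕ → ℕ}

theorem index_cases {i : ℕ} (hi : i < n + n) :
    (∃ k : Fin n, i = k) ∨ ∃ k : Fin n, i = n + k := by
  rcases lt_or_ge i n with h | h
  · exact Or.inl ⟨⟨i, h⟩, rfl⟩
  · exact Or.inr ⟨⟨i - n, by omega⟩, by simp; omega⟩

theorem IsLevelData.le_top (h : I.IsLevelData L E P) {j : Fin m} {i : ℕ} (hi : i < n + n)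
    (hj : P i = j) : L i ≤ I.top j := by
  rcases index_cases hi with ⟨k, rfl⟩ | ⟨k, rfl⟩
  · rw [h.part, Fin.val_inj] at hj
    rw [h.level, hj]
    exact min_le_right _ _
  · rw [h.part_add, Fin.val_inj] at hj
    rw [h.level_add, hj]

theorem IsLevelData.mem_levels (h : I.IsLevelData L E P) {j : Fin m} {lam : ℝ}
    (hl : lam ∈ I.levels j) : ∃ i < n + n, P i = j ∧ L i = lam := by
  simp only [levels, Finset.mem_insert, Finset.mem_image] at hl
  rcases hl with rfl | ⟨i, hi, rfl⟩
  · obtain ⟨i, hi⟩ := I.T_nonempty j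
    rw [I.mem_T] at hi
    exact ⟨n + i, by omega, by rw [h.part_add, hi], by rw [h.level_add, hi]⟩
  · rw [I.mem_T] at hi
    exact ⟨i, by omega, by rw [h.part, hi], by rw [h.level, hi]⟩

theorem low_mem_levels (j : Fin m) : I.low j ∈ I.levels j := by
  obtain ⟨i, hi, h⟩ := Finset.exists_mem_eq_inf' (I.T_nonempty j) I.cLow
  simp only [levels, Finset.mem_insert, Finset.mem_image]
  have h' : I.low j = I.cLow i := h
  exact Or.inr ⟨i, hi, by rw [← h', min_eq_left (I.low_le_top j)]⟩

/-- A vanishing reciprocal comes from an added copy of `top` or from `d_i = 0`; in the latter case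
`c_i ≥ top`, so the truncated level is `top` as well. -/
theorem IsLevelData.isLevelSeq (h : I.IsLevelData L E P) {σ : ℕ → ℕ} (hσ : Sorts L (n + n) σ)
    (j : Fin m) : IsLevelSeq (fun k => L (σ k)) (fun k => E (σ k)) (fun k => P (σ k)) (n + n) j
      (I.low j) (I.top j) := by
  have hm : ∀ k < n + n, σ k < n + n := fun k hk => hσ.bij.mapsTo hk
  refine ⟨hσ.mono, fun k hk => ?_, fun k hk hj => ?_, ?_, fun k hk hj => h.le_top (hm k hk) hj,
    fun k hk hj hE => ?_⟩
  · rcases index_cases (hm k hk) with ⟨i, hi⟩ | ⟨i, hi⟩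
    · rw [hi, h.inv]
      exact inv_nonneg.2 (I.d_nonneg i)
    · rw [hi, h.inv_add]
  · rcases index_cases (hm k hk) with ⟨i, hi⟩ | ⟨i, hi⟩
    · rw [hi, h.part, Fin.val_inj] at hj
      rw [hi, h.level, hj]
      exact le_min (I.low_le (I.mem_T.2 hj)) (I.low_le_top j)
    · rw [hi, h.part_add, Fin.val_inj] at hj
      rw [hi, h.level_add, hj]
      exact I.low_le_top j
  · obtain ⟨i, hi, hP, hL⟩ := h.mem_levels (low_mem_levels j)
    obtain ⟨k, hk, rfl⟩ := hσ.bij.surjOn hi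
    exact ⟨k, hk, hP, hL⟩
  · rcases index_cases (hm k hk) with ⟨i, hi⟩ | ⟨i, hi⟩
    · rw [hi, h.part, Fin.val_inj] at hj
      rw [hi, h.inv, inv_eq_zero] at hE
      rw [hi, h.level, hj]
      have := I.top_le (I.mem_T.2 hj)
      exact min_eq_right (by linarith)
    · rw [hi, h.part_add, Fin.val_inj] at hj
      rw [hi, h.level_add, hj]

/-- Truncating lower bounds at `top` and adding copies of `top` changes nothing for levels up to
`top`: the truncated terms vanish, the copies have reciprocal `0`. -/
theorem IsLevelData.seqNeed_eq (h : I.IsLevelData L E P) {σ : ℕ → ℕ} (hσ : Sorts L (n + n) σ)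
    {j : Fin m} {lam : ℝ} (hl : lam ≤ I.top j) :
    seqNeed (fun k => L (σ k)) (fun k => E (σ k)) (fun k => P (σ k)) (n + n) j lam =
      I.need j lam := by
  rw [seqNeed, hσ.sum_comp fun i => if P i = j then max 0 (lam - L i) * E i else 0,
    Finset.sum_range_add, Finset.sum_range, Finset.sum_range]
  simp only [h.level, h.level_add, h.inv, h.inv_add, h.part, h.part_add, mul_zero, ite_self,
    Finset.sum_const_zero, add_zero, Fin.val_inj]
  rw [need, T, Finset.sum_filter]
  refine Finset.sum_congr rfl fun i _ => ?_
  split_ifs with hj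
  · congr 1
    rw [hj]
    rcases le_total (I.cLow i) (I.top j) with hc | hc
    · rw [min_eq_left hc]
    · rw [min_eq_right hc, max_eq_left (by linarith), max_eq_left (by linarith)]
  · rfl

/-- Both sides are the upper envelope of the same lines, one from duality and the other from the
scan. -/
theorem IsLevelData.fPart_eq_ramps (h : I.IsLevelData L E P) {σ : ℕ → ℕ}
    (hσ : Sorts L (n + n) σ) (j : Fin m) {π : ℝ} (hπ : 0 ≤ π) : I.fPart j π =
      I.low j + ramps (fun k => L (σ k)) (fun k => E (σ k)) (fun k => P (σ k)) (n + n) j π := by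
  have hI := scanInv (C := 0) (h.isLevelSeq hσ j)
  apply le_antisymm
  · obtain ⟨lam, hl, he⟩ := I.exists_fPart_eq j hπ
    obtain ⟨i, hi, hP, hL⟩ := h.mem_levels hl
    obtain ⟨k, hk, rfl⟩ := hσ.bij.surjOn hi
    have := hI.line_le π hπ k hk hP
    rw [hL, h.seqNeed_eq hσ (I.le_top_of_mem_levels hl)] at this
    rwa [he]
  · obtain ⟨l, hl, hp, he⟩ := hI.exists_line π hπ
    have ht := h.le_top (hσ.bij.mapsTo hl) hp
    rw [he, h.seqNeed_eq hσ ht]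
    exact I.le_fPart hπ ht

/-- The ramps of `f`, in `4n` cells with the locations `Q` and the slopes `V`. -/
structure IsRampData (lev e : ℕ → ℝ) (p : ℕ → ℕ) (C : ℕ → ℝ) (K : ℕ) (Q V : ℕ → ℝ) : Prop where
  loc : ∀ k < K, Q k = rampLoc e p k
  weight : ∀ k < K, V k = rampWeight lev e p k
  loc_add : ∀ k < K, Q (K + k) = min (rampLoc e p k) (cap lev e p C K (p k))
  weight_add : ∀ k < K, V (K + k) = - rampWeight lev e p k

/-- The two halves of the arrays pair each ramp with the one that freezes it at the `cap` of its
part; regrouping by parts gives the frozen sums. -/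
theorem IsRampData.sum_eq {lev e : ℕ → ℝ} {p : ℕ → ℕ} {C : ℕ → ℝ} {K : ℕ} {Q V : ℕ → ℝ}
    (h : IsRampData lev e p C K Q V) (hp : ∀ k < K, p k < m) (π : ℝ) :
    ∑ i ∈ Finset.range (K + K), V i * max 0 (Q i - π) =
      ∑ j : Fin m, ramps lev e p K j (max π (cap lev e p C K j)) := by
  rw [Finset.sum_range_add, ← Finset.sum_add_distrib]
  simp only [← sum_ramp_sub_ramp]
  rw [Finset.sum_comm]
  refine Finset.sum_congr rfl fun k hk => ?_
  rw [Finset.mem_range] at hk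
  rw [h.loc k hk, h.weight k hk, h.loc_add k hk, h.weight_add k hk,
    Finset.sum_eq_single_of_mem ⟨p k, hp k hk⟩ (Finset.mem_univ _)]
  · simp only [if_true]
    ring
  · intro j _ hj
    exact if_neg fun he => hj (Fin.ext he.symm)

theorem IsRampData.loc_nonneg {lev e : ℕ → ℝ} {p : ℕ → ℕ} {C : ℕ → ℝ} {K : ℕ} {Q V : ℕ → ℝ}
    (h : IsRampData lev e p C K Q V) (he : ∀ k < K, 0 ≤ e k) {i : ℕ} (hi : i < K + K) :
    0 ≤ Q i := by
  have hloc : ∀ k < K, 0 ≤ rampLoc e p k := fun k hk =>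
    one_div_nonneg.2 (accInv_nonneg fun l hl => he l (hl.trans hk))
  rcases lt_or_ge i K with hK | hK
  · rw [h.loc i hK]
    exact hloc i hK
  · have := h.loc_add (i - K) (by omega)
    rw [show K + (i - K) = i by omega] at this
    rw [this]
    exact le_min (hloc _ (by omega)) (cap_nonneg K)

theorem IsLevelData.f_eq_sum (h : I.IsLevelData L E P) {σ : ℕ → ℕ} (hσ : Sorts L (n + n) σ)
    {C Q V : ℕ → ℝ} (hC : ∀ j : Fin m, C j = I.minC j)
    (hQ : IsRampData (fun k => L (σ k)) (fun k => E (σ k)) (fun k => P (σ k)) C (n + n) Q V)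
    {π : ℝ} (hπ : 0 ≤ π) :
    I.f π = I.Γ * π + ∑ j, min (I.low j) (I.minC j) +
      ∑ i ∈ Finset.range (n + n + (n + n)), V i * max 0 (Q i - π) := by
  have hp : ∀ k < n + n, P (σ k) < m := by
    intro k hk
    rcases index_cases (hσ.bij.mapsTo hk) with ⟨i, hi⟩ | ⟨i, hi⟩
    · rw [hi, h.part]; exact Fin.isLt _
    · rw [hi, h.part_add]; exact Fin.isLt _
  rw [hQ.sum_eq hp, f_eq, add_assoc, ← Finset.sum_add_distrib]
  congr 1
  refine Finset.sum_congr rfl fun j _ => ?_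
  rw [h.fPart_eq_ramps hσ j hπ, ← hC j]
  exact min_ramps (h.isLevelSeq hσ j) hπ

end Instance

/-! ### Minima and breakpoints of sums of ramps. -/

/-- A nondecreasing affine function plus ramps is minimal at `0` or at a ramp. -/
theorem exists_candidate_le {N : ℕ} {g : ℝ → ℝ} {γ β : ℝ} {Q V : ℕ → ℝ} (hγ : 0 ≤ γ)
    (hQ : ∀ i < N, 0 ≤ Q i)
    (hg : ∀ π, 0 ≤ π → g π = γ * π + β + ∑ i ∈ Finset.range N, V i * max 0 (Q i - π))
    {π : ℝ} (hπ : 0 ≤ π) : ∃ q, (q = 0 ∨ ∃ i < N, q = Q i) ∧ g q ≤ g π := by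
  set B : Finset ℝ := insert 0 ((Finset.range N).image Q) with hB
  have hmem : ∀ q, q ∈ B ↔ q = 0 ∨ ∃ i < N, q = Q i := by
    intro q
    simp only [hB, Finset.mem_insert, Finset.mem_image, Finset.mem_range]
    refine or_congr_right ⟨fun ⟨i, hi, h⟩ => ⟨i, hi, h.symm⟩, fun ⟨i, hi, h⟩ => ⟨i, hi, h.symm⟩⟩
  have hB0 : ∀ q ∈ B, 0 ≤ q := by
    intro q hq
    rcases (hmem q).1 hq with rfl | ⟨i, hi, rfl⟩
    · exact le_rfl
    · exact hQ i hi
  -- Between the last candidate `a ≤ π` and the next location the function is affine. It is followed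
  -- to the left or to the right according to the sign of its slope.
  obtain ⟨a, ha, hamax⟩ := Finset.exists_max_image (B.filter (· ≤ π)) id
    ⟨0, Finset.mem_filter.2 ⟨by simp [hB], hπ⟩⟩
  rw [Finset.mem_filter] at ha
  have ha0 := hB0 a ha.1
  have hsplit : ∀ i < N, Q i ≤ a ∨ π < Q i := by
    intro i hi
    by_contra! hno
    exact absurd (hamax (Q i) (Finset.mem_filter.2 ⟨(hmem _).2 (Or.inr ⟨i, hi, rfl⟩), hno.2⟩))
      (not_le.2 hno.1)
  set F := (Finset.range N).filter fun i => π < Q i with hF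
  have haff : ∀ x, 0 ≤ x → a ≤ x → (∀ i ∈ F, x ≤ Q i) →
      g x = γ * x + β + ∑ i ∈ F, V i * (Q i - x) := by
    intro x hx0 hax hxF
    rw [hg x hx0, hF, Finset.sum_filter]
    congr 1
    refine Finset.sum_congr rfl fun i hi => ?_
    split_ifs with hlt
    · rw [max_eq_right]
      have := hxF i (Finset.mem_filter.2 ⟨hi, hlt⟩)
      linarith
    · have := (hsplit i (Finset.mem_range.1 hi)).resolve_right hlt
      rw [max_eq_left (by linarith), mul_zero]
  have hlin : ∀ x, ∑ i ∈ F, V i * (Q i - x) = ∑ i ∈ F, V i * Q i - (∑ i ∈ F, V i) * x := by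
    intro x
    rw [Finset.sum_mul, ← Finset.sum_sub_distrib]
    exact Finset.sum_congr rfl fun i _ => by ring
  have hFlt : ∀ i ∈ F, π < Q i := fun i hi => (Finset.mem_filter.1 hi).2
  have hgπ := haff π hπ ha.2 fun i hi => (hFlt i hi).le
  have hga := haff a ha0 le_rfl fun i hi => ha.2.trans (hFlt i hi).le
  rw [hlin] at hgπ hga
  rcases le_or_gt 0 (γ - ∑ i ∈ F, V i) with hs | hs
  · refine ⟨a, (hmem a).1 ha.1, ?_⟩
    rw [hgπ, hga]
    nlinarith [mul_le_mul_of_nonneg_left ha.2 hs]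
  -- A negative slope can only be caused by ramps still ahead, because `γ ≥ 0`; so there is a
  -- location to the right.
  · have hFne : F.Nonempty := by
      by_contra hne
      rw [Finset.not_nonempty_iff_eq_empty] at hne
      rw [hne] at hs
      simp at hs
      linarith
    obtain ⟨i, hi, hmin⟩ := Finset.exists_min_image F Q hFne
    have hiN := Finset.mem_range.1 (Finset.mem_filter.1 hi).1
    refine ⟨Q i, Or.inr ⟨i, hiN, rfl⟩, ?_⟩
    have hlt := hFlt i hi
    have hgi := haff (Q i) (hQ i hiN) (ha.2.trans hlt.le) hmin
    rw [hlin] at hgi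
    rw [hgi, hgπ]
    nlinarith [mul_lt_mul_of_neg_left hlt hs]

/-- On an interval without a location in its interior each ramp is either zero or linear. -/
theorem piecewiseLinearWith_ramps {N : ℕ} {g : ℝ → ℝ} {γ β : ℝ} {Q V : ℕ → ℝ}
    (hg : ∀ π, 0 ≤ π → g π = γ * π + β + ∑ i ∈ Finset.range N, V i * max 0 (Q i - π)) :
    PiecewiseLinearWith g ((Finset.range N).image Q) := by
  constructor
  · have : Continuous fun π : ℝ => γ * π + β + ∑ i ∈ Finset.range N, V i * max 0 (Q i - π) := by
      fun_prop
    exact this.continuousOn.congr fun π hπ => hg π hπ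
  · intro a b ha hab hQ
    have hsplit : ∀ i ∈ Finset.range N, Q i ≤ a ∨ b ≤ Q i := by
      intro i hi
      by_contra! hno
      exact hQ _ (Finset.mem_image_of_mem Q hi) hno
    have haff : ∀ i ∈ Finset.range N, ∃ s t : ℝ, ∀ π ∈ Set.Icc a b,
        V i * max 0 (Q i - π) = s + t * π := by
      intro i hi
      rcases hsplit i hi with h | h
      · refine ⟨0, 0, fun π hπ => ?_⟩
        rw [max_eq_left (by linarith [hπ.1])]
        ring
      · refine ⟨V i * Q i, -V i, fun π hπ => ?_⟩
        rw [max_eq_right (by linarith [hπ.2])]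
        ring
    choose! s t hst using haff
    refine ⟨β + ∑ i ∈ Finset.range N, s i, γ + ∑ i ∈ Finset.range N, t i, fun π hπ => ?_⟩
    rw [hg π (ha.trans hπ.1), Finset.sum_congr rfl fun i hi => hst i hi π hπ,
      Finset.sum_add_distrib, ← Finset.sum_mul]
    ring

end RepSel

/-! ### Program logic: frames, loop-free code and timed loops. -/

namespace RealRAM

@[simp] theorem State.setInt_int (s : State) (a i v b j : ℕ) :
    (s.setInt a i v).int b j = if b = a ∧ j = i then v else s.int b j := by
  by_cases h : b = a
  · subst h
    simp [State.setInt, Function.update_apply]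
  · simp [State.setInt, h]

@[simp] theorem State.setInt_real (s : State) (a i v : ℕ) : (s.setInt a i v).real = s.real := rfl

@[simp] theorem State.setReal_real (s : State) (a i : ℕ) (v : ℝ) (b j : ℕ) :
    (s.setReal a i v).real b j = if b = a ∧ j = i then v else s.real b j := by
  by_cases h : b = a
  · subst h
    simp [State.setReal, Function.update_apply]
  · simp [State.setReal, h]

@[simp] theorem State.setReal_int (s : State) (a i : ℕ) (v : ℝ) :
    (s.setReal a i v).int = s.int := rfl

namespace Prog

/-- The integer arrays that a program writes. -/
def intWrites : Prog → List ℕ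
  | skip => []
  | setInt a _ _ => [a]
  | setReal _ _ _ => []
  | seq p q => p.intWrites ++ q.intWrites
  | ite _ p q => p.intWrites ++ q.intWrites
  | Prog.while _ p => p.intWrites

/-- The real arrays that a program writes. -/
def realWrites : Prog → List ℕ
  | skip => []
  | setInt _ _ _ => []
  | setReal a _ _ => [a]
  | seq p q => p.realWrites ++ q.realWrites
  | ite _ p q => p.realWrites ++ q.realWrites
  | Prog.while _ p => p.realWrites

/-- The memories agree on the arrays that the program does not write. -/
structure Frame (p : Prog) (s s' : State) : Prop where
  int : ∀ a, a ∉ p.intWrites → s'.int a = s.int a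
  real : ∀ a, a ∉ p.realWrites → s'.real a = s.real a

theorem Frame.refl (p : Prog) (s : State) : p.Frame s s := ⟨fun _ _ => rfl, fun _ _ => rfl⟩

theorem Frame.trans {p : Prog} {s s' s'' : State} (h : p.Frame s s') (h' : p.Frame s' s'') :
    p.Frame s s'' :=
  ⟨fun a ha => (h'.int a ha).trans (h.int a ha), fun a ha => (h'.real a ha).trans (h.real a ha)⟩

theorem Frame.of_subset {p q : Prog} {s s' : State} (h : p.Frame s s')
    (hi : p.intWrites ⊆ q.intWrites) (hr : p.realWrites ⊆ q.realWrites) : q.Frame s s' :=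
  ⟨fun a ha => h.int a fun h' => ha (hi h'), fun a ha => h.real a fun h' => ha (hr h')⟩

/-- A program without loops. -/
def flat : Prog → Bool
  | seq p q => p.flat && q.flat
  | ite _ p q => p.flat && q.flat
  | Prog.while _ _ => false
  | _ => true

open Classical in
/-- The effect of a program without loops. -/
noncomputable def run : Prog → State → State
  | skip, s => s
  | setInt a i v, s => s.setInt a (i.eval s) (v.eval s)
  | setReal a i v, s => s.setReal a (i.eval s) (v.eval s)
  | seq p q, s => q.run (p.run s)
  | ite b p q, s => if b.Holds s then p.run s else q.run s
  | Prog.while _ _, s => s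

theorem run_ite_pos {b : Test} {s : State} (h : b.Holds s) (p q : Prog) :
    (ite b p q).run s = p.run s := if_pos h

theorem run_ite_neg {b : Test} {s : State} (h : ¬ b.Holds s) (p q : Prog) :
    (ite b p q).run s = q.run s := if_neg h

theorem run_seq (p q : Prog) (s : State) : (seq p q).run s = q.run (p.run s) := rfl

theorem run_setInt (a : ℕ) (i v : IExp) (s : State) :
    (setInt a i v).run s = s.setInt a (i.eval s) (v.eval s) := rfl

theorem run_setReal (a : ℕ) (i : IExp) (v : RExp) (s : State) :
    (setReal a i v).run s = s.setReal a (i.eval s) (v.eval s) := rfl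

theorem run_skip (s : State) : skip.run s = s := rfl

/-- A bound on the running time of a program without loops. -/
def bound : Prog → ℕ
  | skip => 1
  | setInt _ i v => i.cost + v.cost + 1
  | setReal _ i v => i.cost + v.cost + 1
  | seq p q => p.bound + q.bound
  | ite b p q => b.cost + 1 + (p.bound + q.bound)
  | Prog.while _ _ => 0

/-- Programs one after the other. -/
def block : List Prog → Prog
  | [] => skip
  | [p] => p
  | p :: q :: ps => seq p (block (q :: ps))

/-- A loop with the counter in cell `0` of integer array `c`. -/
def forLoop (c : ℕ) (N : IExp) (body : Prog) : Prog :=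
  seq (setInt c (.lit 0) (.lit 0))
    (Prog.while (.intLE (.add (.get c (.lit 0)) (.lit 1)) N)
      (seq body (setInt c (.lit 0) (.add (.get c (.lit 0)) (.lit 1)))))

end Prog

/-- The written arrays can be read off the syntax, so persistence of data across the phases reduces
to list membership, decidable for concrete programs. -/
theorem Exec.frame {p : Prog} {s s' : State} {t : ℕ} (h : Exec p s s' t) : p.Frame s s' := by
  induction h with
  | skip s => exact .refl _ _
  | setInt a i v s =>
    refine ⟨fun b hb => ?_, fun _ _ => rfl⟩
    have : b ≠ a := by simpa [Prog.intWrites] using hb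
    funext j
    simp [this]
  | setReal a i v s =>
    refine ⟨fun _ _ => rfl, fun b hb => ?_⟩
    have : b ≠ a := by simpa [Prog.realWrites] using hb
    funext j
    simp [this]
  | seq _ _ h1 h2 =>
    exact (h1.of_subset (List.subset_append_left _ _) (List.subset_append_left _ _)).trans
      (h2.of_subset (List.subset_append_right _ _) (List.subset_append_right _ _))
  | ite_true _ _ h1 => exact h1.of_subset (List.subset_append_left _ _) (List.subset_append_left _ _)
  | ite_false _ _ h1 =>
    exact h1.of_subset (List.subset_append_right _ _) (List.subset_append_right _ _)
  | while_false _ => exact .refl _ _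
  | while_true _ _ _ h1 h2 => exact Prog.Frame.trans ⟨h1.int, h1.real⟩ h2

/-- Started in `s`, the program halts within `T` steps in a memory that satisfies `Q`. -/
def Runs (p : Prog) (s : State) (T : ℕ) (Q : State → Prop) : Prop :=
  ∃ s' t, Exec p s s' t ∧ t ≤ T ∧ Q s'

theorem Runs.mono {p : Prog} {s : State} {T T' : ℕ} {Q Q' : State → Prop} (h : Runs p s T Q)
    (hT : T ≤ T') (hQ : ∀ s', Q s' → Q' s') : Runs p s T' Q' := by
  obtain ⟨s', t, he, ht, hq⟩ := h
  exact ⟨s', t, he, ht.trans hT, hQ s' hq⟩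

theorem Runs.frame {p : Prog} {s : State} {T : ℕ} {Q : State → Prop} (h : Runs p s T Q) :
    Runs p s T fun s' => Q s' ∧ p.Frame s s' := by
  obtain ⟨s', t, he, ht, hq⟩ := h
  exact ⟨s', t, he, ht, hq, he.frame⟩

theorem Runs.seq {p q : Prog} {s : State} {T T' : ℕ} {Q R : State → Prop} (h : Runs p s T Q)
    (h' : ∀ s', Q s' → Runs q s' T' R) : Runs (.seq p q) s (T + T') R := by
  obtain ⟨s', t, he, ht, hq⟩ := h
  obtain ⟨s'', t', he', ht', hr⟩ := h' s' hq
  exact ⟨s'', t + t', .seq he he', Nat.add_le_add ht ht', hr⟩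

theorem exec_run {p : Prog} (hp : p.flat = true) (s : State) :
    ∃ t ≤ p.bound, Exec p s (p.run s) t := by
  induction p generalizing s with
  | skip => exact ⟨_, le_rfl, .skip s⟩
  | setInt a i v => exact ⟨_, le_rfl, .setInt a i v s⟩
  | setReal a i v => exact ⟨_, le_rfl, .setReal a i v s⟩
  | seq p q hp' hq' =>
    simp only [Prog.flat, Bool.and_eq_true] at hp
    obtain ⟨t, ht, he⟩ := hp' hp.1 s
    obtain ⟨t', ht', he'⟩ := hq' hp.2 (p.run s)
    exact ⟨t + t', Nat.add_le_add ht ht', .seq he he'⟩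
  | ite b p q hp' hq' =>
    simp only [Prog.flat, Bool.and_eq_true] at hp
    obtain ⟨t, ht, he⟩ := hp' hp.1 s
    obtain ⟨t', ht', he'⟩ := hq' hp.2 s
    by_cases hb : b.Holds s
    · refine ⟨b.cost + 1 + t, by simp only [Prog.bound]; omega, ?_⟩
      rw [Prog.run, if_pos hb]
      exact .ite_true hb he
    · refine ⟨b.cost + 1 + t', by simp only [Prog.bound]; omega, ?_⟩
      rw [Prog.run, if_neg hb]
      exact .ite_false hb he'
  | _ => simp [Prog.flat] at hp

theorem Runs.of_flat {p : Prog} (hp : p.flat = true) {s : State} {Q : State → Prop}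
    (h : Q (p.run s)) : Runs p s p.bound Q := by
  obtain ⟨t, ht, he⟩ := exec_run hp s
  exact ⟨_, t, he, ht, h⟩

/-- Every round of the loop is paid for by a potential. -/
theorem Runs.while {b : Test} {p : Prog} {Inv : ℕ → State → Prop}
    (h : ∀ r s, Inv r s → b.Holds s →
      ∃ T, Runs p s T fun s' => ∃ r', Inv r' s' ∧ r' + T + b.cost + 1 ≤ r)
    {r : ℕ} {s : State} (h0 : Inv r s) :
    Runs (.while b p) s (r + b.cost + 1) fun s' => (∃ r', Inv r' s') ∧ ¬ b.Holds s' := by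
  induction r using Nat.strong_induction_on generalizing s with
  | _ r ih =>
    by_cases hb : b.Holds s
    · obtain ⟨T, s', t, he, ht, r', hr', hle⟩ := h r s h0 hb
      obtain ⟨s'', t', he', ht', hq⟩ := ih r' (by omega) hr'
      exact ⟨s'', _, .while_true hb he he', by omega, hq⟩
    · exact ⟨s, _, .while_false hb, by omega, ⟨r, h0⟩, hb⟩

/-- A loop over the numbers below `N`. -/
theorem Runs.forLoop {c : ℕ} {e : IExp} {body : Prog} {s : State} {N : ℕ}
    (Inv : ℕ → State → Prop) (hflat : body.flat = true) (hc : c ∉ body.intWrites)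
    (h0 : Inv 0 (s.setInt c 0 0))
    (hN : ∀ k s', (Prog.forLoop c e body).Frame s s' → Inv k s' → e.eval s' = N)
    (hstep : ∀ k < N, ∀ s', (Prog.forLoop c e body).Frame s s' → s'.int c 0 = k → Inv k s' →
      Inv (k + 1) ((body.run s').setInt c 0 (k + 1))) :
    Runs (Prog.forLoop c e body) s ((N + 1) * (body.bound + e.cost + 20))
      fun s' => Inv N s' ∧ (Prog.forLoop c e body).Frame s s' := by
  set P := Prog.forLoop c e body with hP
  set W := body.bound + (e.cost + 12) with hW
  -- The potential reserves `W` for every remaining round, enough for body, counter update and test.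
  set J : ℕ → State → Prop := fun r s' =>
    ∃ k ≤ N, r = (N - k) * W ∧ s'.int c 0 = k ∧ Inv k s' ∧ P.Frame s s' with hJ
  have hfr0 : P.Frame s (s.setInt c 0 0) :=
    (Exec.setInt c (.lit 0) (.lit 0) s).frame.of_subset (by simp [hP, Prog.forLoop, Prog.intWrites])
      (by simp [Prog.realWrites])
  have hloop := Runs.while (b := .intLE (.add (.get c (.lit 0)) (.lit 1)) e)
    (p := .seq body (.setInt c (.lit 0) (.add (.get c (.lit 0)) (.lit 1)))) (Inv := J)
    (r := N * W) (s := s.setInt c 0 0) ?_ ⟨0, N.zero_le, by simp, by simp, h0, hfr0⟩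
  · have h1 : Runs (.setInt c (.lit 0) (.lit 0)) s 3 (fun s' => s' = s.setInt c 0 0) :=
      ⟨_, _, .setInt c (.lit 0) (.lit 0) s, le_rfl, rfl⟩
    refine (h1.seq fun s' hs' => hs' ▸ hloop).mono ?_ ?_
    · simp only [Test.cost, IExp.cost, hW]
      ring_nf
      omega
    · rintro s' ⟨⟨r, k, hk, -, hck, hI, hfr⟩, hnot⟩
      have he := hN k s' hfr hI
      simp only [Test.Holds, IExp.eval, he, hck] at hnot
      have : k = N := by omega
      subst this
      exact ⟨hI, hfr⟩
  · rintro r s' ⟨k, hk, rfl, hck, hI, hfr⟩ hb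
    have he := hN k s' hfr hI
    simp only [Test.Holds, IExp.eval, he, hck] at hb
    obtain ⟨t, ht, hex⟩ := exec_run hflat s'
    have hc' : (body.run s').int c 0 = k := by rw [hex.frame.int c hc, hck]
    have hex' := Exec.seq hex
      (Exec.setInt c (.lit 0) (.add (.get c (.lit 0)) (.lit 1)) (body.run s'))
    have hev : (IExp.add (.get c (.lit 0)) (.lit 1)).eval (body.run s') = k + 1 := by
      simp [IExp.eval, hc']
    have hlit : (IExp.lit 0).eval (body.run s') = 0 := rfl
    rw [hev, hlit] at hex'
    refine ⟨body.bound + 6, _, _, hex', ?_, (N - (k + 1)) * W, ⟨k + 1, hb, rfl, by simp,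
      hstep k hb s' hfr hck hI, hfr.trans (hex'.frame.of_subset ?_ ?_)⟩, ?_⟩
    · simp only [IExp.cost]
      omega
    · intro a ha
      exact List.mem_append_right _ ha
    · intro a ha
      exact List.mem_append_right _ ha
    · have : N - k = N - (k + 1) + 1 := by omega
      rw [this, add_mul, one_mul]
      simp only [Test.cost, IExp.cost, hW]
      omega

end RealRAM

/-! ### Bottom-up merge sort of indices in `O(N log N)` steps. -/

namespace RealRAM

/-- Cell `0` of integer array `a`. -/
abbrev IExp.var (a : ℕ) : IExp := .get a (.lit 0)

/-- The minimum of two integers. -/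
def IExp.minExp (e₁ e₂ : IExp) : IExp := .sub e₁ (.sub e₁ e₂)

@[simp] theorem IExp.eval_minExp (e₁ e₂ : IExp) (s : State) :
    (IExp.minExp e₁ e₂).eval s = min (e₁.eval s) (e₂.eval s) := by
  simp only [minExp, eval]
  omega

/-- Increase cell `0` of integer array `a`. -/
abbrev Prog.inc (a : ℕ) : Prog := .setInt a (.lit 0) (.add (.var a) (.lit 1))

/-! Merge sort. The indices are sorted in integer array `10`; `11` is a buffer. -/

/-- The cells `a, …, b - 1` of an array. -/
def seg (f : ℕ → ℕ) (a b : ℕ) : List ℕ := (List.range' a (b - a)).map f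

theorem seg_of_le {f : ℕ → ℕ} {a b : ℕ} (h : b ≤ a) : seg f a b = [] := by
  simp [seg, Nat.sub_eq_zero_of_le h]

theorem seg_cons {f : ℕ → ℕ} {a b : ℕ} (h : a < b) : seg f a b = f a :: seg f (a + 1) b := by
  have : b - a = (b - (a + 1)) + 1 := by omega
  rw [seg, this, List.range'_succ]
  rfl

theorem seg_append {f : ℕ → ℕ} {a b c : ℕ} (h : a ≤ b) (h' : b ≤ c) :
    seg f a c = seg f a b ++ seg f b c := by
  rw [seg, seg, seg, ← List.map_append]
  congr 1
  have := List.range'_append_1 (s := a) (m := b - a) (n := c - b)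
  rw [show a + (b - a) = b by omega, show b - a + (c - b) = c - a by omega] at this
  exact this.symm

theorem seg_snoc {f : ℕ → ℕ} {a b : ℕ} (h : a ≤ b) : seg f a (b + 1) = seg f a b ++ [f b] := by
  rw [seg_append h (Nat.le_succ b), seg_cons b.lt_succ_self, seg_of_le le_rfl]

theorem seg_congr {f g : ℕ → ℕ} {a b : ℕ} (h : ∀ x, a ≤ x → x < b → f x = g x) :
    seg f a b = seg g a b := by
  refine List.map_congr_left fun x hx => ?_
  rw [List.mem_range'_1] at hx
  exact h x hx.1 (by omega)

theorem pairwise_seg {f : ℕ → ℕ} {a b : ℕ} {R : ℕ → ℕ → Prop} :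
    (seg f a b).Pairwise R ↔ ∀ x y, a ≤ x → x < y → y < b → R (f x) (f y) := by
  rw [seg, List.pairwise_map, List.pairwise_iff_getElem]
  simp only [List.length_range', List.getElem_range', one_mul]
  constructor
  · intro h x y hx hxy hy
    have := h (x - a) (y - a) (by omega) (by omega) (by omega)
    rwa [show a + (x - a) = x by omega, show a + (y - a) = y by omega] at this
  · intro h i j hi hj hij
    exact h _ _ (by omega) (by omega) (by omega)

/-- Comparison of indices by their keys. -/
noncomputable def keyLE (key : ℕ → ℝ) (x y : ℕ) : Bool := decide (key x ≤ key y)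

/-- The next index is taken from the first run. -/
def mergeTest (kArr : ℕ) : Test :=
  .and (.intLE (.add (.var 17) (.lit 1)) (.var 15))
    (.not (.and (.intLE (.add (.var 18) (.lit 1)) (.var 16))
      (.not (.realLE (.get kArr (.get 10 (.var 17))) (.get kArr (.get 10 (.var 18)))))))

/-- Move the smaller one of the two first remaining indices to the buffer. -/
def mergeStep (kArr : ℕ) : Prog := .block [
  .ite (mergeTest kArr)
    (.block [.setInt 11 (.var 19) (.get 10 (.var 17)), .inc 17])
    (.block [.setInt 11 (.var 19) (.get 10 (.var 18)), .inc 18]),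
  .inc 19]

/-- Merge two adjacent runs. -/
def mergeLoop (kArr : ℕ) : Prog :=
  .while (.intLE (.add (.var 19) (.lit 1)) (.var 16)) (mergeStep kArr)

theorem mergeStep_run (kArr : ℕ) (s : State) :
    (mergeStep kArr).run s =
      if s.int 17 0 + 1 ≤ s.int 15 0 ∧ ¬ (s.int 18 0 + 1 ≤ s.int 16 0 ∧
        ¬ s.real kArr (s.int 10 (s.int 17 0)) ≤ s.real kArr (s.int 10 (s.int 18 0))) then
        ((s.setInt 11 (s.int 19 0) (s.int 10 (s.int 17 0))).setInt 17 0 (s.int 17 0 + 1)).setInt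
          19 0 (s.int 19 0 + 1)
      else
        ((s.setInt 11 (s.int 19 0) (s.int 10 (s.int 18 0))).setInt 18 0 (s.int 18 0 + 1)).setInt
          19 0 (s.int 19 0 + 1) := by
  split_ifs with h
  · have hb : (mergeTest kArr).Holds s := h
    simp [mergeStep, Prog.block, Prog.run_seq, Prog.run_ite_pos hb, Prog.run_setInt, IExp.eval]
  · have hb : ¬ (mergeTest kArr).Holds s := h
    simp [mergeStep, Prog.block, Prog.run_seq, Prog.run_ite_neg hb, Prog.run_setInt, IExp.eval]

theorem runs_mergeLoop (kArr : ℕ) {s : State} {lo mid hi : ℕ} (hlm : lo ≤ mid) (hmh : mid ≤ hi)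
    (h15 : s.int 15 0 = mid) (h16 : s.int 16 0 = hi) (h17 : s.int 17 0 = lo)
    (h18 : s.int 18 0 = mid) (h19 : s.int 19 0 = lo) :
    Runs (mergeLoop kArr) s ((hi - lo) * 80 + 10) fun s' =>
      (∀ x, x < lo ∨ hi ≤ x → s'.int 11 x = s.int 11 x) ∧
      seg (s'.int 11) lo hi =
        (seg (s.int 10) lo mid).merge (seg (s.int 10) mid hi) (keyLE (s.real kArr)) := by
  set A := s.int 10 with hA
  set le := keyLE (s.real kArr) with hle
  set L := (seg A lo mid).merge (seg A mid hi) le with hL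
  -- The buffer followed by the merge of the two remaining runs is always the final result. The
  -- count `(mid - i) + (hi - j) = hi - k` guarantees that both runs are exhausted when the buffer
  -- is full.
  set J : ℕ → State → Prop := fun r s' => ∃ i j k, s'.int 17 0 = i ∧ s'.int 18 0 = j ∧
    s'.int 19 0 = k ∧ s'.int 15 0 = mid ∧ s'.int 16 0 = hi ∧ s'.int 10 = A ∧
    s'.real kArr = s.real kArr ∧ r = (hi - k) * 80 ∧ lo ≤ i ∧ i ≤ mid ∧ mid ≤ j ∧ j ≤ hi ∧
    lo ≤ k ∧ k ≤ hi ∧ (mid - i) + (hi - j) = hi - k ∧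
    (∀ x, x < lo ∨ hi ≤ x → s'.int 11 x = s.int 11 x) ∧
    seg (s'.int 11) lo k ++ (seg A i mid).merge (seg A j hi) le = L with hJ
  have h0 : J ((hi - lo) * 80) s := ⟨lo, mid, lo, h17, h18, h19, h15, h16, rfl, rfl, rfl, le_rfl,
    hlm, le_rfl, hmh, le_rfl, by omega, by omega, fun _ _ => rfl, by
      rw [seg_of_le le_rfl, List.nil_append]⟩
  refine (Runs.while (b := .intLE (.add (.var 19) (.lit 1)) (.var 16)) (p := mergeStep kArr)
    (Inv := J) ?_ h0).mono (by simp only [Test.cost, IExp.cost]; omega) ?_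
  · rintro r s' ⟨i, j, k, g17, g18, g19, g15, g16, g10, gk, rfl, hloi, himid, hmj, hjhi, hlok, hkhi,
      hcount, hout, hseg⟩ hb
    simp only [Test.Holds, IExp.eval, g19, g16] at hb
    refine ⟨_, Runs.of_flat rfl ⟨(hi - (k + 1)) * 80, ?_, ?_⟩⟩
    · rw [mergeStep_run, g17, g18, g19, g15, g16, g10, gk]
      have hbuf : ∀ v, seg (fun x => if x = k then v else s'.int 11 x) lo (k + 1) =
          seg (s'.int 11) lo k ++ [v] := by
        intro v
        rw [seg_snoc hlok, if_pos rfl]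
        congr 1
        exact seg_congr fun x _ hx => if_neg hx.ne
      split_ifs with hc
      · obtain ⟨hi1, hi2⟩ := hc
        refine ⟨i + 1, j, k + 1, ?_, ?_, ?_, ?_, ?_, ?_, gk, rfl, by omega, hi1, hmj, hjhi,
          by omega, hb, by omega, ?_, ?_⟩
        · simp
        · simp [g18]
        · simp
        · simp [g15]
        · simp [g16]
        · funext x; simp [g10]
        · intro x hx
          have : x ≠ k := by omega
          simp [this, hout x hx]
        · rw [← hseg]
          have hB : ((((s'.setInt 11 k (A i)).setInt 17 0 (i + 1)).setInt 19 0 (k + 1)).int 11) =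
              fun x => if x = k then A i else s'.int 11 x := by funext x; simp
          rw [hB, hbuf, List.append_assoc, seg_cons (show i < mid by omega)]
          congr 1
          rcases hjhi.eq_or_lt with hj | hj
          · rw [seg_of_le hj.ge, List.merge_right, List.merge_right]
            rfl
          · rw [seg_cons hj, List.cons_merge_cons, if_pos]
            · rfl
            · rw [hle, keyLE, decide_eq_true_eq]
              by_contra hn
              exact hi2 ⟨hj, hn⟩
      · have hj : j < hi := by
          by_contra hj
          refine hc ⟨by omega, fun h => hj ?_⟩
          exact h.1
        refine ⟨i, j + 1, k + 1, ?_, ?_, ?_, ?_, ?_, ?_, gk, rfl, hloi, himid, by omega, hj,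
          by omega, hb, by omega, ?_, ?_⟩
        · simp [g17]
        · simp
        · simp
        · simp [g15]
        · simp [g16]
        · funext x; simp [g10]
        · intro x hx
          have : x ≠ k := by omega
          simp [this, hout x hx]
        · rw [← hseg]
          have hB : ((((s'.setInt 11 k (A j)).setInt 18 0 (j + 1)).setInt 19 0 (k + 1)).int 11) =
              fun x => if x = k then A j else s'.int 11 x := by funext x; simp
          rw [hB, hbuf, List.append_assoc, seg_cons hj]
          congr 1
          rcases himid.eq_or_lt with hm | hm
          · rw [seg_of_le hm.ge, List.nil_merge, List.nil_merge]
            rfl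
          · rw [seg_cons hm, List.cons_merge_cons, if_neg]
            · rfl
            · rw [hle, keyLE, decide_eq_true_eq]
              intro hn
              exact hc ⟨hm, fun h => h.2 hn⟩
    · have hbound : (mergeStep kArr).bound ≤ 70 := by
        simp [mergeStep, mergeTest, Prog.block, Prog.bound, Test.cost, IExp.cost, RExp.cost]
      have : hi - k = (hi - (k + 1)) + 1 := by omega
      rw [this, add_mul]
      simp only [Test.cost, IExp.cost]
      omega
  · rintro s' ⟨⟨r, i, j, k, g17, g18, g19, g15, g16, g10, gk, rfl, hloi, himid, hmj, hjhi, hlok, hkhi,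
      hcount, hout, hseg⟩, hnot⟩
    simp only [Test.Holds, IExp.eval, g19, g16] at hnot
    have hk : k = hi := by omega
    subst hk
    refine ⟨hout, ?_⟩
    rw [← hseg, seg_of_le (show mid ≤ i by omega), seg_of_le (show k ≤ j by omega), List.nil_merge,
      List.append_nil]

/-- Merge the run that starts at the current position with the next one. -/
def mergeBlock (nArr kArr : ℕ) : Prog := .seq
  (.block [
    .setInt 15 (.lit 0) (.minExp (.add (.var 14) (.var 13)) (.var nArr)),
    .setInt 16 (.lit 0) (.minExp (.add (.var 15) (.var 13)) (.var nArr)),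
    .setInt 17 (.lit 0) (.var 14),
    .setInt 18 (.lit 0) (.var 15),
    .setInt 19 (.lit 0) (.var 14)])
  (.seq (mergeLoop kArr) (.setInt 14 (.lit 0) (.var 16)))

/-- Merge all pairs of adjacent runs into the buffer. -/
def mergePairs (nArr kArr : ℕ) : Prog := .seq
  (.setInt 14 (.lit 0) (.lit 0))
  (.while (.intLE (.add (.var 14) (.lit 1)) (.var nArr)) (mergeBlock nArr kArr))

/-- Double the length of the sorted runs. -/
def mergePass (nArr kArr : ℕ) : Prog := .seq (mergePairs nArr kArr)
  (.seq (.forLoop 12 (.var nArr) (.setInt 10 (.var 12) (.get 11 (.var 12))))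
    (.setInt 13 (.lit 0) (.add (.var 13) (.var 13))))

/-- Sort the indices below cell `0` of integer array `nArr` by the keys in real array `kArr`. -/
def sort (nArr kArr : ℕ) : Prog := .seq
  (.forLoop 12 (.var nArr) (.setInt 10 (.var 12) (.var 12)))
  (.seq (.setInt 13 (.lit 0) (.lit 1))
    (.while (.intLE (.add (.var 13) (.lit 1)) (.var nArr)) (mergePass nArr kArr)))

/-- The runs of length `w` are sorted. -/
def RunsSorted (key : ℕ → ℝ) (w N : ℕ) (f : ℕ → ℕ) : Prop :=
  ∀ x y, x < y → y < N → x / w = y / w → key (f x) ≤ key (f y)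

theorem runs_mergeBlock (nArr kArr : ℕ) (hn : 20 ≤ nArr ∨ nArr < 10) {s : State} {N w lo : ℕ}
    (hN : s.int nArr 0 = N) (h13 : s.int 13 0 = w) (h14 : s.int 14 0 = lo) (hlo : lo < N) :
    Runs (mergeBlock nArr kArr) s ((min (min (lo + w) N + w) N - lo) * 80 + 75) fun s' =>
      (∀ x, x < lo ∨ min (min (lo + w) N + w) N ≤ x → s'.int 11 x = s.int 11 x) ∧
      s'.int 14 0 = min (min (lo + w) N + w) N ∧
      seg (s'.int 11) lo (min (min (lo + w) N + w) N) =
        (seg (s.int 10) lo (min (lo + w) N)).merge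
          (seg (s.int 10) (min (lo + w) N) (min (min (lo + w) N + w) N)) (keyLE (s.real kArr)) := by
  set mid := min (lo + w) N with hmid
  set hi := min (mid + w) N with hhi
  have hne : nArr ≠ 15 ∧ nArr ≠ 16 ∧ nArr ≠ 17 ∧ nArr ≠ 18 ∧ nArr ≠ 19 := by omega
  obtain ⟨n15, n16, n17, n18, n19⟩ := hne
  refine (Runs.seq (Q := fun s' => s'.int 15 0 = mid ∧ s'.int 16 0 = hi ∧ s'.int 17 0 = lo ∧
    s'.int 18 0 = mid ∧ s'.int 19 0 = lo ∧ s'.int 10 = s.int 10 ∧ s'.int 11 = s.int 11 ∧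
    s'.real = s.real) (Runs.of_flat rfl ?_) fun s' hs' => Runs.seq
      ((runs_mergeLoop kArr (s := s') (lo := lo) (mid := mid) (hi := hi) (by omega) (by omega)
        hs'.1 hs'.2.1 hs'.2.2.1 hs'.2.2.2.1 hs'.2.2.2.2.1).frame) fun s'' hs'' =>
        Runs.of_flat (Q := fun s' => (∀ x, x < lo ∨ hi ≤ x → s'.int 11 x = s.int 11 x) ∧
          s'.int 14 0 = hi ∧ seg (s'.int 11) lo hi = (seg (s.int 10) lo mid).merge
          (seg (s.int 10) mid hi) (keyLE (s.real kArr))) rfl ?_).mono ?_ fun s' h => h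
  · simp only [Prog.block, Prog.run, IExp.eval, IExp.eval_minExp]
    refine ⟨?_, ?_, ?_, ?_, ?_, ?_, ?_, ?_⟩
    · simp [h13, h14, hN, n15, hmid]
    · simp [h13, h14, hN, n15, hmid, hhi]
    · simp [h14]
    · simp [h13, h14, hN, n15, hmid]
    · simp [h14]
    · funext x; simp
    · funext x; simp
    · simp
  · obtain ⟨-, h16, -, -, -, e10, e11, er⟩ := hs'
    obtain ⟨⟨hout, hseg⟩, hfr⟩ := hs''
    have f16 : s''.int 16 0 = hi := by
      rw [hfr.int 16 (by simp [mergeLoop, mergeStep, Prog.block, Prog.intWrites]), h16]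
    rw [e10, er] at hseg
    have hB : ∀ v, (s''.setInt 14 0 v).int 11 = s''.int 11 := fun v => by funext x; simp
    simp only [Prog.run, IExp.eval, hB]
    refine ⟨fun x hx => by rw [hout x hx, e11], by simp [f16], hseg⟩
  · simp [Prog.block, Prog.bound, IExp.minExp, IExp.cost]
    omega

end RealRAM

namespace RealRAM

theorem mergeBlock_writes (nArr kArr : ℕ) :
    (mergeBlock nArr kArr).intWrites = [15, 16, 17, 18, 19, 11, 17, 11, 18, 19, 14] ∧
    (mergeBlock nArr kArr).realWrites = [] := ⟨rfl, rfl⟩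

theorem div_eq_of_mul_le {b w x : ℕ} (h1 : w * b ≤ x) (h2 : x < w * (b + 1)) : x / w = b := by
  have hw : 0 < w := by
    rcases Nat.eq_zero_or_pos w with rfl | h
    · simp at h2
    · exact h
  exact Nat.div_eq_of_lt_le (by rwa [mul_comm]) (by rwa [mul_comm])

theorem keyLE_trans (key : ℕ → ℝ) (a b c : ℕ) (h : keyLE key a b = true)
    (h' : keyLE key b c = true) : keyLE key a c = true := by
  simp only [keyLE, decide_eq_true_eq] at *
  exact h.trans h'

theorem keyLE_total (key : ℕ → ℝ) (a b : ℕ) : (keyLE key a b || keyLE key b a) = true := by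
  simp only [keyLE, Bool.or_eq_true, decide_eq_true_eq]
  exact le_total _ _

theorem RunsSorted.pairwise {key : ℕ → ℝ} {w N b lo hi : ℕ} {f : ℕ → ℕ}
    (h : RunsSorted key w N f) (hlo : w * b ≤ lo) (hhi : hi ≤ w * (b + 1)) (hN : hi ≤ N) :
    (seg f lo hi).Pairwise fun x y => keyLE key x y = true := by
  rw [pairwise_seg]
  intro x y hx hxy hy
  rw [keyLE, decide_eq_true_eq]
  refine h x y hxy (by omega) ?_
  rw [div_eq_of_mul_le (b := b) (by omega) (by omega), div_eq_of_mul_le (b := b) (by omega) (by omega)]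

/-- The position is always a multiple of `2w` until it reaches `N`, so blocks of the buffer are
aligned with quotients by `w + w`. Each block advances by at least one index, which pays its
constant overhead. -/
theorem runs_mergePairs (nArr kArr : ℕ) (hn : 20 ≤ nArr ∨ nArr < 10) {s : State} {N w : ℕ}
    (hN : s.int nArr 0 = N) (h13 : s.int 13 0 = w) (hw : 0 < w)
    (hA : RunsSorted (s.real kArr) w N (s.int 10)) :
    Runs (mergePairs nArr kArr) s (N * 200 + 20) fun s' =>
      RunsSorted (s.real kArr) (w + w) N (s'.int 11) ∧
      (seg (s'.int 11) 0 N).Perm (seg (s.int 10) 0 N) := by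
  set A := s.int 10 with hAdef
  set key := s.real kArr with hkey
  set J : ℕ → State → Prop := fun r s' => ∃ lo ≤ N, s'.int 14 0 = lo ∧ r = (N - lo) * 200 ∧
    (lo = N ∨ ∃ b, lo = (w + w) * b) ∧ (seg (s'.int 11) 0 lo).Perm (seg A 0 lo) ∧
    RunsSorted key (w + w) lo (s'.int 11) ∧ (mergePairs nArr kArr).Frame s s' with hJ
  have hw14 : nArr ≠ 14 ∧ nArr ∉ (mergePairs nArr kArr).intWrites := by
    simp only [mergePairs, Prog.intWrites, (mergeBlock_writes nArr kArr).1]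
    simp
    omega
  have h10 : 10 ∉ (mergePairs nArr kArr).intWrites := by
    simp [mergePairs, Prog.intWrites, (mergeBlock_writes nArr kArr).1]
  have h13' : 13 ∉ (mergePairs nArr kArr).intWrites := by
    simp [mergePairs, Prog.intWrites, (mergeBlock_writes nArr kArr).1]
  have hk : kArr ∉ (mergePairs nArr kArr).realWrites := by
    simp [mergePairs, Prog.realWrites, (mergeBlock_writes nArr kArr).2]
  have hfirst : Runs (.setInt 14 (.lit 0) (.lit 0)) s 3 (J (N * 200)) := by
    refine ⟨_, _, .setInt 14 (.lit 0) (.lit 0) s, le_rfl, 0, N.zero_le, by simp [IExp.eval], rfl,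
      Or.inr ⟨0, rfl⟩, by rw [seg_of_le le_rfl, seg_of_le le_rfl], fun x y _ hy => by omega, ?_⟩
    exact (Exec.setInt 14 (.lit 0) (.lit 0) s).frame.of_subset
      (List.subset_append_left _ _) (List.subset_append_left _ _)
  refine (hfirst.seq fun s₀ h₀ => Runs.while (Inv := J) ?_ h₀).mono
    (by simp only [Test.cost, IExp.cost]; omega) ?_
  · rintro r s' ⟨lo, hlo, h14, rfl, hdiv, hperm, hsorted, hfr⟩ hb
    have gN : s'.int nArr 0 = N := by rw [hfr.int _ hw14.2, hN]
    have g13 : s'.int 13 0 = w := by rw [hfr.int _ h13', h13]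
    have g10 : s'.int 10 = A := hfr.int _ h10
    have gk : s'.real kArr = key := hfr.real _ hk
    simp only [Test.Holds, IExp.eval, gN, h14] at hb
    have hblk := (runs_mergeBlock nArr kArr hn gN g13 h14 (by omega)).frame
    rw [g10, gk] at hblk
    set mid := min (lo + w) N with hmid
    set hi := min (mid + w) N with hhi
    refine ⟨_, hblk.mono le_rfl ?_⟩
    rintro s'' ⟨⟨hout, h14', hseg⟩, hfr'⟩
    obtain ⟨b, hb'⟩ := hdiv.resolve_left (by omega)
    have hlow : seg (s''.int 11) 0 lo = seg (s'.int 11) 0 lo :=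
      seg_congr fun x _ hx => hout x (Or.inl hx)
    have hb2 : lo = w * (2 * b) := by rw [hb']; ring
    have hb3 : w * (2 * b + 1) = lo + w := by rw [hb2]; ring
    have hb4 : w * (2 * b + 1 + 1) = lo + w + w := by rw [hb2]; ring
    have hp1 := hA.pairwise (b := 2 * b) (lo := lo) (hi := mid) hb2.ge (by omega) (by omega)
    have hp2 : (seg A mid hi).Pairwise fun x y => keyLE key x y = true := by
      rcases le_total (lo + w) N with h | h
      · exact hA.pairwise (b := 2 * b + 1) (by omega) (by omega) (by omega)
      · rw [seg_of_le (by omega)]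
        exact List.Pairwise.nil
    have hm := List.pairwise_merge (keyLE_trans key) (keyLE_total key) _ _ hp1 hp2
    rw [← hseg, pairwise_seg] at hm
    refine ⟨(N - hi) * 200, ⟨hi, by omega, h14', rfl, ?_, ?_, ?_, ?_⟩, ?_⟩
    · rcases le_total (lo + w + w) N with h | h
      · exact Or.inr ⟨b + 1, by rw [mul_add, ← hb']; omega⟩
      · exact Or.inl (by omega)
    · rw [seg_append (Nat.zero_le lo) (show lo ≤ hi by omega),
        seg_append (Nat.zero_le lo) (show lo ≤ hi by omega), hlow, hseg]
      refine hperm.append ((List.merge_perm_append _).trans ?_)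
      rw [← seg_append (show lo ≤ mid by omega) (show mid ≤ hi by omega)]
    · intro x y hxy hy hdivxy
      rcases lt_or_ge y lo with hylo | hylo
      · rw [hout x (Or.inl (by omega)), hout y (Or.inl hylo)]
        exact hsorted x y hxy hylo hdivxy
      -- An index before the block and one inside it have different quotients, so nothing is claimed
      -- about them.
      · rcases lt_or_ge x lo with hxlo | hxlo
        · have h1 : x / (w + w) < b := by
            rw [Nat.div_lt_iff_lt_mul (by omega), mul_comm]
            omega
          have h2 : b ≤ y / (w + w) := by
            rw [Nat.le_div_iff_mul_le (by omega), mul_comm]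
            omega
          omega
        · have := hm x y hxlo hxy hy
          rwa [keyLE, decide_eq_true_eq] at this
    · refine hfr.trans (hfr'.of_subset (List.subset_append_right _ _) (List.subset_append_right _ _))
    · have h1 : lo + 1 ≤ hi := by omega
      simp only [Test.cost, IExp.cost]
      omega
  · rintro s' ⟨⟨r, lo, hlo, h14, rfl, hdiv, hperm, hsorted, hfr⟩, hnot⟩
    have gN : s'.int nArr 0 = N := by rw [hfr.int _ hw14.2, hN]
    simp only [Test.Holds, IExp.eval, gN, h14] at hnot
    have : lo = N := by omega
    subst this
    exact ⟨hsorted, hperm⟩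

theorem runs_mergePass (nArr kArr : ℕ) (hn : 20 ≤ nArr ∨ nArr < 10) {s : State} {N w : ℕ}
    (hN : s.int nArr 0 = N) (h13 : s.int 13 0 = w) (hw : 0 < w)
    (hA : RunsSorted (s.real kArr) w N (s.int 10)) :
    Runs (mergePass nArr kArr) s ((N + 1) * 300) fun s' =>
      s'.int 13 0 = w + w ∧ RunsSorted (s.real kArr) (w + w) N (s'.int 10) ∧
      (seg (s'.int 10) 0 N).Perm (seg (s.int 10) 0 N) := by
  have hw12 : nArr ≠ 12 ∧ nArr ≠ 10 ∧ nArr ∉ (mergePairs nArr kArr).intWrites := by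
    simp only [mergePairs, Prog.intWrites, (mergeBlock_writes nArr kArr).1]
    simp
    omega
  refine ((runs_mergePairs nArr kArr hn hN h13 hw hA).frame.seq
    (T' := (N + 1) * 40 + 10) fun s₁ ⟨⟨hs, hp⟩, hfr⟩ => ?_).mono (by omega) fun s' h => h
  have g13 : s₁.int 13 0 = w := by
    rw [hfr.int 13 (by simp [mergePairs, Prog.intWrites, (mergeBlock_writes nArr kArr).1]), h13]
  have gN : s₁.int nArr 0 = N := by rw [hfr.int _ hw12.2.2, hN]
  refine ((Runs.forLoop (c := 12) (e := .var nArr) (N := N)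
    (body := .setInt 10 (.var 12) (.get 11 (.var 12))) (s := s₁)
    (fun k s' => (∀ x < k, s'.int 10 x = s₁.int 11 x)) rfl (by simp [Prog.intWrites])
    (by simp) ?_ ?_).seq (T' := 7) fun s₂ ⟨hcopy, hfr₂⟩ => Runs.of_flat rfl ?_).mono ?_ fun s' h => h
  · intro k s' hf _
    have : s'.int nArr = s₁.int nArr := hf.int nArr (by
      simp [Prog.forLoop, Prog.intWrites, hw12.1, hw12.2.1])
    simp [IExp.eval, this, gN]
  · intro k _ s' hf hck hI x hx
    have h11 : s'.int 11 = s₁.int 11 := hf.int 11 (by simp [Prog.forLoop, Prog.intWrites])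
    simp only [Prog.run, IExp.eval, hck, h11]
    rcases Nat.lt_succ_iff_lt_or_eq.1 hx with hx' | rfl
    · simp [hx'.ne, hI x hx']
    · simp
  · have h13' : s₂.int 13 = s₁.int 13 := hfr₂.int 13 (by simp [Prog.forLoop, Prog.intWrites])
    have h10 : ∀ v, (s₂.setInt 13 0 v).int 10 = s₂.int 10 := fun v => by funext x; simp
    simp only [Prog.run, IExp.eval, h10]
    refine ⟨by simp [h13', g13], fun x y hxy hy => ?_, ?_⟩
    · rw [hcopy x (by omega), hcopy y hy]
      exact hs x y hxy hy
    · rwa [seg_congr (g := s₁.int 11) fun x _ hx => hcopy x hx]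
  · simp only [Prog.bound, IExp.cost]
    omega

theorem seg_zero (f : ℕ → ℕ) (N : ℕ) : seg f 0 N = (List.range N).map f := by
  rw [seg, Nat.sub_zero, List.range_eq_range']

theorem bijOn_of_perm {f : ℕ → ℕ} {N : ℕ} (h : ((List.range N).map f).Perm (List.range N)) :
    Set.BijOn f (Set.Iio N) (Set.Iio N) := by
  refine ⟨fun x hx => ?_, fun x hx y hy hxy => ?_, fun x hx => ?_⟩
  · exact List.mem_range.1 (h.subset (List.mem_map_of_mem (List.mem_range.2 hx)))
  · have := h.nodup_iff.2 List.nodup_range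
    exact List.inj_on_of_nodup_map this (List.mem_range.2 hx) (List.mem_range.2 hy) hxy
  · obtain ⟨y, hy, he⟩ := List.mem_map.1 (h.symm.subset (List.mem_range.2 hx))
    exact ⟨y, List.mem_range.1 hy, he⟩

/-- After `t` passes the runs have length `2 ^ t`, so `Nat.clog 2 N` passes of linear cost suffice;
being a permutation is carried along. -/
theorem runs_sort (nArr kArr : ℕ) (hn : 20 ≤ nArr ∨ nArr < 10) {s : State} {N : ℕ}
    (hN : s.int nArr 0 = N) :
    Runs (sort nArr kArr) s ((N + 1) * (Nat.clog 2 N + 1) * 400) fun s' =>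
      RepSel.Sorts (s.real kArr) N (s'.int 10) := by
  set key := s.real kArr with hkey
  have hpass : (mergePass nArr kArr).intWrites = 14 :: [15, 16, 17, 18, 19, 11, 17, 11, 18, 19, 14]
      ++ [12, 10, 12, 13] ∧ (mergePass nArr kArr).realWrites = [] := ⟨rfl, rfl⟩
  have hnw : nArr ≠ 10 ∧ nArr ≠ 12 ∧ nArr ≠ 13 ∧ nArr ∉ (mergePass nArr kArr).intWrites := by
    rw [hpass.1]
    simp
    omega
  set J : ℕ → State → Prop := fun r s' => ∃ t ≤ Nat.clog 2 N, s'.int 13 0 = 2 ^ t ∧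
    r = (Nat.clog 2 N - t) * ((N + 1) * 310) ∧ s'.int nArr 0 = N ∧ s'.real kArr = key ∧
    RunsSorted key (2 ^ t) N (s'.int 10) ∧ (seg (s'.int 10) 0 N).Perm (List.range N) with hJ
  refine ((Runs.forLoop (c := 12) (e := .var nArr) (N := N)
    (body := .setInt 10 (.var 12) (.var 12)) (s := s)
    (fun k s' => ∀ x < k, s'.int 10 x = x) rfl (by simp [Prog.intWrites])
    (by simp) ?_ ?_).seq (T' := (Nat.clog 2 N * ((N + 1) * 310)) + 20)
    fun s₁ ⟨hid, hfr⟩ => ?_).mono ?_ fun s' h => h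
  · intro k s' hf _
    have : s'.int nArr = s.int nArr := hf.int nArr (by
      simp [Prog.forLoop, Prog.intWrites, hnw.1, hnw.2.1])
    simp [IExp.eval, this, hN]
  · intro k _ s' hf hck hI x hx
    simp only [Prog.run, IExp.eval, hck]
    rcases Nat.lt_succ_iff_lt_or_eq.1 hx with hx' | rfl
    · simp [hx'.ne, hI x hx']
    · simp
  · have gN : s₁.int nArr = s.int nArr := hfr.int nArr (by
      simp [Prog.forLoop, Prog.intWrites, hnw.1, hnw.2.1])
    have gk : s₁.real kArr = s.real kArr := hfr.real kArr (by
      simp [Prog.forLoop, Prog.realWrites])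
    have h10 : ∀ v, (s₁.setInt 13 0 v).int 10 = s₁.int 10 := fun v => by funext x; simp
    have hstart : Runs (.setInt 13 (.lit 0) (.lit 1)) s₁ 3 (J (Nat.clog 2 N * ((N + 1) * 310))) := by
      refine Runs.of_flat rfl ⟨0, Nat.zero_le _, by simp [Prog.run, IExp.eval], rfl, ?_, gk, ?_, ?_⟩
      · simp [Prog.run, IExp.eval, hnw.2.2.1, gN, hN]
      · intro x y hxy hy h
        simp at h
        omega
      · simp only [Prog.run, IExp.eval, h10]
        rw [seg_zero, List.map_congr_left (g := id) fun x hx => hid x (List.mem_range.1 hx),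
          List.map_id]
    refine (hstart.seq fun s₂ h₂ => Runs.while (Inv := J) ?_ h₂).mono ?_ ?_
    · rintro r s' ⟨t, ht, h13, rfl, gN', gk', hsort, hperm⟩ hb
      simp only [Test.Holds, IExp.eval, gN', h13] at hb
      have htlt : t < Nat.clog 2 N := (Nat.lt_clog_iff_pow_lt Nat.one_lt_two).2 hb
      rw [← gk'] at hsort
      have hp := (runs_mergePass nArr kArr hn gN' h13 (Nat.two_pow_pos t) hsort).frame
      refine ⟨_, hp.mono le_rfl ?_⟩
      rintro s'' ⟨⟨h13', hsort', hperm'⟩, hfr'⟩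
      refine ⟨_, ⟨t + 1, htlt, by rw [h13', pow_succ]; omega, rfl, ?_, ?_, ?_, ?_⟩, ?_⟩
      · rw [hfr'.int _ hnw.2.2.2, gN']
      · rw [hfr'.real _ (by simp [hpass.2]), gk']
      · rw [gk'] at hsort'
        rwa [pow_succ, mul_two]
      · exact hperm'.trans hperm
      · have : Nat.clog 2 N - t = (Nat.clog 2 N - (t + 1)) + 1 := by omega
        have hmul : ∀ M, (Nat.clog 2 N - t) * M = (Nat.clog 2 N - (t + 1)) * M + M := fun M => by
          rw [this, Nat.succ_mul]
        rw [hmul]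
        generalize (Nat.clog 2 N - (t + 1)) * ((N + 1) * 310) = z
        simp only [Test.cost, IExp.cost]
        omega
    · simp only [Test.cost, IExp.cost]
      omega
    · rintro s' ⟨⟨r, t, ht, h13, rfl, gN', gk', hsort, hperm⟩, hnot⟩
      simp only [Test.Holds, IExp.eval, gN', h13] at hnot
      rw [seg_zero] at hperm
      refine ⟨bijOn_of_perm hperm, fun k l hkl hl => ?_⟩
      rcases hkl.eq_or_lt with rfl | hlt
      · exact le_rfl
      · refine hsort k l hlt hl ?_
        -- The run length is now at least `N`, so all indices lie in run `0`.
        rw [Nat.div_eq_of_lt (by omega), Nat.div_eq_of_lt (by omega)]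
  · simp only [Prog.bound, IExp.cost]
    ring_nf
    omega

end RealRAM

/-! ### The linear-time loops before and after the sweep. -/

namespace RealRAM

/-- Write the minimum of two reals. -/
def Prog.setMin (a : ℕ) (i : IExp) (v w : RExp) : Prog :=
  .ite (.realLE v w) (.setReal a i v) (.setReal a i w)

/-- Write the maximum of two reals. -/
def Prog.setMax (a : ℕ) (i : IExp) (v w : RExp) : Prog :=
  .ite (.realLE v w) (.setReal a i w) (.setReal a i v)

theorem Prog.run_setMin (a : ℕ) (i : IExp) (v w : RExp) (s : State) :
    (setMin a i v w).run s = s.setReal a (i.eval s) (min (v.eval s) (w.eval s)) := by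
  rcases le_or_gt (v.eval s) (w.eval s) with h | h
  · rw [min_eq_left h]
    exact run_ite_pos (b := .realLE v w) h _ _
  · rw [min_eq_right h.le]
    exact run_ite_neg (b := .realLE v w) h.not_ge _ _

theorem Prog.run_setMax (a : ℕ) (i : IExp) (v w : RExp) (s : State) :
    (setMax a i v w).run s = s.setReal a (i.eval s) (max (v.eval s) (w.eval s)) := by
  rcases le_or_gt (v.eval s) (w.eval s) with h | h
  · rw [max_eq_right h]
    exact run_ite_pos (b := .realLE v w) h _ _
  · rw [max_eq_left h.le]
    exact run_ite_neg (b := .realLE v w) h.not_ge _ _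

end RealRAM

namespace RepSel

open RealRAM

/-! The memory layout. Integer arrays: `4`, `5`, `6` hold for every part the successor of the item
with minimal `C`, `c + d`, `c`; `7` the parts of the levels; `8`, `9` the numbers of levels and
ramps; `12` the loop counter. Real arrays: `5`, `13` hold the locations and slopes of the ramps; `6`
holds `c + d`; `7`, `8` hold the levels with their reciprocal deviations; `9`, `10`, `11`, `12` hold
the state of the scan; `14` the value of `f` at infinity without the term `Γ π`; `15`, `16` the
state of the sweep; `17` is a scratch register. -/

/-- Compute the upper bounds of the costs. -/
def upperLoop : Prog := .forLoop 12 (.var 0)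
  (.setReal 6 (.var 12) (.add (.get 2 (.var 12)) (.get 3 (.var 12))))

theorem runs_upperLoop {s : State} {n : ℕ} (hn : s.int 0 0 = n) :
    Runs upperLoop s ((n + 1) * 50) fun s' =>
      (∀ i < n, s'.real 6 i = s.real 2 i + s.real 3 i) ∧ upperLoop.Frame s s' := by
  refine (Runs.forLoop (N := n) (fun k s' => ∀ i < k, s'.real 6 i = s.real 2 i + s.real 3 i) rfl
    (by decide) (by simp) (fun k s' hf _ => ?_) fun k _ s' hf hck hI i hi => ?_).mono ?_
    fun _ h => h
  · simp [IExp.eval, hf.int 0 (by decide), hn]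
  · have h2 : s'.real 2 = s.real 2 := hf.real 2 (by decide)
    have h3 : s'.real 3 = s.real 3 := hf.real 3 (by decide)
    simp only [Prog.run, IExp.eval, RExp.eval, State.setInt_real, State.setReal_real, hck, h2, h3]
    rcases Nat.lt_succ_iff_lt_or_eq.1 hi with hi' | rfl
    · simp [hi'.ne, hI i hi']
    · simp
  · exact Nat.mul_le_mul_left _ (by decide)

/-- The current item has to be recorded as the best one of its part. -/
def argminTest (key out : ℕ) : Test :=
  .not (.and (.intLE (.lit 1) (.get out (.get 1 (.var 12))))
    (.not (.realLE (.get key (.var 12)) (.get key (.sub (.get out (.get 1 (.var 12))) (.lit 1))))))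

/-- Compute for every part the successor of an item with the smallest key. -/
def argminLoop (key out : ℕ) : Prog := .forLoop 12 (.var 0)
  (.ite (argminTest key out) (.setInt out (.get 1 (.var 12)) (.add (.var 12) (.lit 1))) .skip)

/-- Storing successors makes `0` the mark of a part not yet seen, which is why the output array has
to be zero initially. -/
theorem runs_argminLoop {key out : ℕ} (ho : out ≠ 0 ∧ out ≠ 1 ∧ out ≠ 12) {s : State} {n : ℕ}
    (hn : s.int 0 0 = n) (hout : ∀ j, s.int out j = 0) :
    Runs (argminLoop key out) s ((n + 1) * 80) fun s' =>
      ((∀ i < n, 1 ≤ s'.int out (s.int 1 i) ∧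
        s.real key (s'.int out (s.int 1 i) - 1) ≤ s.real key i) ∧
      ∀ j, 1 ≤ s'.int out j → s'.int out j ≤ n ∧ s.int 1 (s'.int out j - 1) = j) ∧
      (argminLoop key out).Frame s s' := by
  obtain ⟨ho0, ho1, ho12⟩ := ho
  have hw : (argminLoop key out).intWrites = [12, out, 12] := rfl
  have hwr : (argminLoop key out).realWrites = [] := rfl
  refine (Runs.forLoop (N := n) (fun k s' => (∀ i < k, 1 ≤ s'.int out (s.int 1 i) ∧
        s.real key (s'.int out (s.int 1 i) - 1) ≤ s.real key i) ∧
      ∀ j, 1 ≤ s'.int out j → s'.int out j ≤ k ∧ s.int 1 (s'.int out j - 1) = j) rfl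
    (by simp [Prog.intWrites, Ne.symm ho12]) ?_ (fun k s' hf _ => ?_)
    fun k _ s' hf hck hI => ?_).mono ?_ fun _ h => h
  · simp [ho12, hout]
  · have : s'.int 0 = s.int 0 := hf.int 0 (by rw [← argminLoop, hw]; simp [ho0.symm])
    simp [IExp.eval, this, hn]
  · have h1 : s'.int 1 = s.int 1 := hf.int 1 (by rw [← argminLoop, hw]; simp [ho1.symm])
    have hk : s'.real key = s.real key := hf.real key (by rw [← argminLoop, hwr]; simp)
    obtain ⟨hI1, hI2⟩ := hI
    have hI2' : ∀ j, 1 ≤ s'.int out j → s'.int out j ≤ k + 1 ∧ s.int 1 (s'.int out j - 1) = j :=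
      fun j hj => ⟨(hI2 j hj).1.trans (Nat.le_succ k), (hI2 j hj).2⟩
    by_cases hb : (argminTest key out).Holds s'
    · rw [Prog.run_ite_pos hb, Prog.run_setInt]
      simp only [argminTest, Test.Holds, IExp.eval, RExp.eval, hck, h1, hk] at hb
      simp only [IExp.eval, hck, h1, State.setInt_int, ho12, false_and, if_false, true_and]
      constructor
      · intro i hi
        split_ifs with hij
        · refine ⟨by omega, ?_⟩
          rw [Nat.add_sub_cancel]
          rcases Nat.lt_succ_iff_lt_or_eq.1 hi with hi' | rfl
          · obtain ⟨h3, h4⟩ := hI1 i hi'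
            rw [hij] at h3 h4
            refine le_trans ?_ h4
            by_contra hlt
            exact hb ⟨h3, hlt⟩
          · exact le_rfl
        · refine hI1 i ?_
          rcases Nat.lt_succ_iff_lt_or_eq.1 hi with hi' | rfl
          · exact hi'
          · exact absurd rfl hij
      · intro j
        split_ifs with hj
        · intro _
          exact ⟨le_rfl, by rw [Nat.add_sub_cancel, hj]⟩
        · exact hI2' j
    · rw [Prog.run_ite_neg hb, Prog.run_skip]
      simp only [argminTest, Test.Holds, IExp.eval, RExp.eval, hck, h1, hk, not_not] at hb
      simp only [State.setInt_int, ho12, false_and, if_false]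
      refine ⟨fun i hi => ?_, hI2'⟩
      rcases Nat.lt_succ_iff_lt_or_eq.1 hi with hi' | rfl
      · exact hI1 i hi'
      · exact ⟨hb.1, (not_le.1 hb.2).le⟩
  · exact Nat.mul_le_mul_left _ (by simp [Prog.bound, argminTest, Test.cost, IExp.cost, RExp.cost])

/-- Compute the levels. -/
def levelLoop : Prog := .forLoop 12 (.var 0) (.block [
  .setReal 17 (.lit 0) (.get 6 (.sub (.get 5 (.get 1 (.var 12))) (.lit 1))),
  .setMin 7 (.var 12) (.get 2 (.var 12)) (.get 17 (.lit 0)),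
  .setReal 7 (.add (.var 0) (.var 12)) (.get 17 (.lit 0)),
  .setReal 8 (.var 12) (.div (.lit 1) (.get 3 (.var 12))),
  .setInt 7 (.var 12) (.get 1 (.var 12)),
  .setInt 7 (.add (.var 0) (.var 12)) (.get 1 (.var 12))])

/-- Only the first `n` reciprocals are written: the copies of `top` in the second half rely on the
initial zeros of their array. -/
theorem runs_levelLoop {s : State} {n : ℕ} (hn : s.int 0 0 = n) (h8 : ∀ i, s.real 8 i = 0) :
    Runs levelLoop s ((n + 1) * 200) fun s' =>
      ((∀ i < n, s'.real 7 i = min (s.real 2 i) (s.real 6 (s.int 5 (s.int 1 i) - 1)) ∧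
        s'.real 7 (n + i) = s.real 6 (s.int 5 (s.int 1 i) - 1) ∧
        s'.real 8 i = (s.real 3 i)⁻¹ ∧ s'.int 7 i = s.int 1 i ∧ s'.int 7 (n + i) = s.int 1 i) ∧
      ∀ i, n ≤ i → s'.real 8 i = 0) ∧ levelLoop.Frame s s' := by
  refine (Runs.forLoop (N := n) (fun k s' =>
    (∀ i < k, s'.real 7 i = min (s.real 2 i) (s.real 6 (s.int 5 (s.int 1 i) - 1)) ∧
        s'.real 7 (n + i) = s.real 6 (s.int 5 (s.int 1 i) - 1) ∧
        s'.real 8 i = (s.real 3 i)⁻¹ ∧ s'.int 7 i = s.int 1 i ∧ s'.int 7 (n + i) = s.int 1 i) ∧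
      ∀ i, n ≤ i → s'.real 8 i = 0) rfl
    (by decide) (by simp [h8]) (fun k s' hf _ => ?_) fun k hk s' hf hck hI => ?_).mono ?_
    fun _ h => h
  · simp [IExp.eval, hf.int 0 (by decide), hn]
  · have r2 : s'.real 2 = s.real 2 := hf.real 2 (by decide)
    have r3 : s'.real 3 = s.real 3 := hf.real 3 (by decide)
    have r6 : s'.real 6 = s.real 6 := hf.real 6 (by decide)
    have i0 : s'.int 0 = s.int 0 := hf.int 0 (by decide)
    have i1 : s'.int 1 = s.int 1 := hf.int 1 (by decide)
    have i5 : s'.int 5 = s.int 5 := hf.int 5 (by decide)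
    simp only [Prog.block, Prog.run_seq, Prog.run_setInt, Prog.run_setReal, Prog.run_setMin]
    simp [IExp.eval, RExp.eval, hck, r2, r3, r6, i0, i1, i5, hn]
    obtain ⟨hI1, hI2⟩ := hI
    refine ⟨fun i hi => ?_, fun i hi => ?_⟩
    · rcases Nat.le_iff_lt_or_eq.1 hi with hi' | rfl
      · have e1 : i ≠ n + k := by omega
        have e2 : i ≠ k := by omega
        have e3 : n + i ≠ k := by omega
        simp [e1, e2, e3, hI1 i hi']
      · have e3 : n ≠ 0 := by omega
        simp [e3]
    · have e2 : i ≠ k := by omega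
      simp [e2, hI2 i hi]
  · exact Nat.mul_le_mul_left _ (by
      simp [Prog.block, Prog.setMin, Prog.bound, Test.cost, IExp.cost, RExp.cost])

/-- Scan the sorted levels. -/
def scanLoop : Prog := .forLoop 12 (.var 8) (.block [
  .setInt 21 (.lit 0) (.get 10 (.var 12)),
  .setInt 20 (.lit 0) (.get 7 (.var 21)),
  .setReal 5 (.var 12) (.div (.lit 1) (.get 9 (.var 20))),
  .setReal 13 (.var 12)
    (.mul (.sub (.get 7 (.var 21)) (.get 10 (.var 20))) (.get 9 (.var 20))),
  .setReal 11 (.var 20) (.add (.get 11 (.var 20)) (.get 13 (.var 12))),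
  .setReal 10 (.var 20) (.get 7 (.var 21)),
  .setReal 9 (.var 20) (.add (.get 9 (.var 20)) (.get 8 (.var 21))),
  .setMax 12 (.var 20) (.get 12 (.var 20))
    (.div (.sub (.get 7 (.var 21)) (.get 1 (.sub (.get 4 (.var 20)) (.lit 1))))
      (.get 11 (.var 20)))])

/-- The order of the assignments mirrors the recursions: location and weight of a ramp use the old
accumulators, while `cap` uses the already updated weight. -/
theorem runs_scanLoop {s : State} {K : ℕ} (hK : s.int 8 0 = K) (h9 : ∀ j, s.real 9 j = 0)
    (h10 : ∀ j, s.real 10 j = 0) (h11 : ∀ j, s.real 11 j = 0) (h12 : ∀ j, s.real 12 j = 0)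
    {lev e : ℕ → ℝ} {p : ℕ → ℕ} {C : ℕ → ℝ} (hlev : ∀ k, lev k = s.real 7 (s.int 10 k))
    (he : ∀ k, e k = s.real 8 (s.int 10 k)) (hp : ∀ k, p k = s.int 7 (s.int 10 k))
    (hC : ∀ j, C j = s.real 1 (s.int 4 j - 1)) :
    Runs scanLoop s ((K + 1) * 200) fun s' =>
      ((∀ j, s'.real 9 j = accInv e p K j) ∧ (∀ j, s'.real 10 j = lastLevel lev p K j) ∧
        (∀ j, s'.real 11 j = accWeight lev e p K j) ∧ (∀ j, s'.real 12 j = cap lev e p C K j) ∧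
        ∀ k < K, s'.real 5 k = rampLoc e p k ∧ s'.real 13 k = rampWeight lev e p k) ∧
      scanLoop.Frame s s' := by
  refine (Runs.forLoop (N := K) (fun K s' => 
      (∀ j, s'.real 9 j = accInv e p K j) ∧ (∀ j, s'.real 10 j = lastLevel lev p K j) ∧
        (∀ j, s'.real 11 j = accWeight lev e p K j) ∧ (∀ j, s'.real 12 j = cap lev e p C K j) ∧
        ∀ k < K, s'.real 5 k = rampLoc e p k ∧ s'.real 13 k = rampWeight lev e p k) rfl
    (by decide) (by simp [h9, h10, h11, h12, accInv, lastLevel, accWeight, cap])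
    (fun k s' hf _ => ?_) fun k hk s' hf hck hI => ?_).mono ?_
    fun _ h => h
  · simp [IExp.eval, hf.int 8 (by decide), hK]
  · have r1 : s'.real 1 = s.real 1 := hf.real 1 (by decide)
    have r7 : s'.real 7 = s.real 7 := hf.real 7 (by decide)
    have r8 : s'.real 8 = s.real 8 := hf.real 8 (by decide)
    have i4 : s'.int 4 = s.int 4 := hf.int 4 (by decide)
    have i7 : s'.int 7 = s.int 7 := hf.int 7 (by decide)
    have i10 : s'.int 10 = s.int 10 := hf.int 10 (by decide)
    obtain ⟨g9, g10, g11, g12, g5⟩ := hI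
    simp only [Prog.block, Prog.run_seq, Prog.run_setInt, Prog.run_setReal, Prog.run_setMax]
    simp [IExp.eval, RExp.eval, hck, r1, r7, r8, i4, i7, i10, ← hp, ← hlev, ← he, ← hC,
      g9, g10, g11, g12]
    refine ⟨fun j => ?_, fun j => ?_, fun j => ?_, fun j => ?_, fun i hi => ?_⟩
    · rw [accInv]
      split_ifs with h
      · rw [h]
      · rfl
    · rw [lastLevel]
    · rw [accWeight, rampWeight]
      split_ifs with h
      · rw [h]
      · rfl
    · rw [cap, accWeight, rampWeight]
      split_ifs with h
      · rw [h]
      · rfl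
    · rcases Nat.le_iff_lt_or_eq.1 hi with hi' | rfl
      · simp [hi'.ne, g5 i hi']
      · simp [rampLoc, rampWeight]
  · exact Nat.mul_le_mul_left _ (by
      simp [Prog.block, Prog.setMax, Prog.bound, Test.cost, IExp.cost, RExp.cost])

/-- Cut off the ramps. -/
def cutLoop : Prog := .forLoop 12 (.var 8) (.block [
  .setMin 5 (.add (.var 8) (.var 12)) (.get 5 (.var 12)) (.get 12 (.get 7 (.get 10 (.var 12)))),
  .setReal 13 (.add (.var 8) (.var 12)) (.sub (.lit 0) (.get 13 (.var 12)))])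

theorem runs_cutLoop {s : State} {K : ℕ} (hK : s.int 8 0 = K) :
    Runs cutLoop s ((K + 1) * 100) fun s' =>
      (∀ k < K, s'.real 5 k = s.real 5 k ∧ s'.real 13 k = s.real 13 k ∧
        s'.real 5 (K + k) = min (s.real 5 k) (s.real 12 (s.int 7 (s.int 10 k))) ∧
        s'.real 13 (K + k) = - s.real 13 k) ∧ cutLoop.Frame s s' := by
  refine (Runs.forLoop (N := K) (fun k s' =>
      (∀ i < K, s'.real 5 i = s.real 5 i ∧ s'.real 13 i = s.real 13 i) ∧
      ∀ i < k, s'.real 5 (K + i) = min (s.real 5 i) (s.real 12 (s.int 7 (s.int 10 i))) ∧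
        s'.real 13 (K + i) = - s.real 13 i) rfl
    (by decide) (by simp) (fun k s' hf _ => ?_) fun k hk s' hf hck hI => ?_).mono ?_
    fun s' h => ⟨fun k hk => ⟨(h.1.1 k hk).1, (h.1.1 k hk).2, h.1.2 k hk⟩, h.2⟩
  · simp [IExp.eval, hf.int 8 (by decide), hK]
  · have r12 : s'.real 12 = s.real 12 := hf.real 12 (by decide)
    have i7 : s'.int 7 = s.int 7 := hf.int 7 (by decide)
    have i8 : s'.int 8 = s.int 8 := hf.int 8 (by decide)
    have i10 : s'.int 10 = s.int 10 := hf.int 10 (by decide)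
    obtain ⟨g1, g2⟩ := hI
    simp only [Prog.block, Prog.run_seq, Prog.run_setReal, Prog.run_setMin]
    simp [IExp.eval, RExp.eval, hck, r12, i7, i8, i10, hK]
    refine ⟨fun i hi => ?_, fun i hi => ?_⟩
    · have : i ≠ K + k := by omega
      simp [this, g1 i hi]
    · rcases Nat.le_iff_lt_or_eq.1 hi with hi' | rfl
      · simp [hi'.ne, g2 i hi']
      · simp [g1 i hk]
  · exact Nat.mul_le_mul_left _ (by
      simp [Prog.block, Prog.setMin, Prog.bound, Test.cost, IExp.cost, RExp.cost])

/-- Add the values of the parts at infinity. -/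
def baseLoop : Prog := .forLoop 12 (.get 0 (.lit 1)) (.block [
  .setMin 17 (.lit 0) (.get 2 (.sub (.get 6 (.var 12)) (.lit 1)))
    (.get 1 (.sub (.get 4 (.var 12)) (.lit 1))),
  .setReal 14 (.lit 0) (.add (.get 14 (.lit 0)) (.get 17 (.lit 0)))])

theorem runs_baseLoop {s : State} {m : ℕ} (hm : s.int 0 1 = m) (h14 : s.real 14 0 = 0) :
    Runs baseLoop s ((m + 1) * 100) fun s' =>
      s'.real 14 0 = ∑ j ∈ Finset.range m,
        min (s.real 2 (s.int 6 j - 1)) (s.real 1 (s.int 4 j - 1)) ∧ baseLoop.Frame s s' := by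
  refine (Runs.forLoop (N := m) (fun k s' => s'.real 14 0 = ∑ j ∈ Finset.range k,
        min (s.real 2 (s.int 6 j - 1)) (s.real 1 (s.int 4 j - 1))) rfl
    (by decide) (by simp [h14]) (fun k s' hf _ => ?_) fun k hk s' hf hck hI => ?_).mono ?_
    fun s' h => h
  · simp [IExp.eval, hf.int 0 (by decide), hm]
  · have r1 : s'.real 1 = s.real 1 := hf.real 1 (by decide)
    have r2 : s'.real 2 = s.real 2 := hf.real 2 (by decide)
    have i4 : s'.int 4 = s.int 4 := hf.int 4 (by decide)
    have i6 : s'.int 6 = s.int 6 := hf.int 6 (by decide)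
    simp only [Prog.block, Prog.run_seq, Prog.run_setReal, Prog.run_setMin]
    simp [IExp.eval, RExp.eval, hck, r1, r2, i4, i6, hI, Finset.sum_range_succ]
  · exact Nat.mul_le_mul_left _ (by
      simp [Prog.block, Prog.setMin, Prog.bound, Test.cost, IExp.cost, RExp.cost])

/-- The item is selected in the first stage. -/
def selectTest : Test :=
  .and (.and (.intLE (.get 4 (.get 1 (.var 12))) (.add (.var 12) (.lit 1)))
      (.intLE (.add (.var 12) (.lit 1)) (.get 4 (.get 1 (.var 12)))))
    (.not (.and
      (.not (.realLE (.get 1 (.var 12)) (.get 2 (.sub (.get 6 (.get 1 (.var 12))) (.lit 1)))))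
      (.realLE (.get 12 (.get 1 (.var 12))) (.get 4 (.lit 1)))))

/-- Write the first-stage selection. -/
def selectLoop : Prog := .forLoop 12 (.var 0) (.ite selectTest (.setInt 2 (.var 12) (.lit 1)) .skip)

theorem runs_selectLoop {s : State} {n : ℕ} (hn : s.int 0 0 = n) (h2 : ∀ i, s.int 2 i = 0) :
    Runs selectLoop s ((n + 1) * 100) fun s' =>
      (∀ i < n, (s'.int 2 i = 0 ∨ s'.int 2 i = 1) ∧ (s'.int 2 i = 1 ↔ s.int 4 (s.int 1 i) = i + 1 ∧
        (s.real 1 i ≤ s.real 2 (s.int 6 (s.int 1 i) - 1) ∨ s.real 4 1 < s.real 12 (s.int 1 i)))) ∧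
      selectLoop.Frame s s' := by
  refine (Runs.forLoop (N := n) (fun k s' =>
    (∀ i < k, (s'.int 2 i = 0 ∨ s'.int 2 i = 1) ∧ (s'.int 2 i = 1 ↔ s.int 4 (s.int 1 i) = i + 1 ∧
        (s.real 1 i ≤ s.real 2 (s.int 6 (s.int 1 i) - 1) ∨ s.real 4 1 < s.real 12 (s.int 1 i)))) ∧
    ∀ i, k ≤ i → s'.int 2 i = 0) rfl
    (by decide) (by simp [h2]) (fun k s' hf _ => ?_) fun k hk s' hf hck hI => ?_).mono ?_
    fun s' h => ⟨h.1.1, h.2⟩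
  · simp [IExp.eval, hf.int 0 (by decide), hn]
  · have r1 : s'.real 1 = s.real 1 := hf.real 1 (by decide)
    have r2 : s'.real 2 = s.real 2 := hf.real 2 (by decide)
    have r4 : s'.real 4 = s.real 4 := hf.real 4 (by decide)
    have r12 : s'.real 12 = s.real 12 := hf.real 12 (by decide)
    have i1 : s'.int 1 = s.int 1 := hf.int 1 (by decide)
    have i4 : s'.int 4 = s.int 4 := hf.int 4 (by decide)
    have i6 : s'.int 6 = s.int 6 := hf.int 6 (by decide)
    have htest : selectTest.Holds s' ↔ s.int 4 (s.int 1 k) = k + 1 ∧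
        (s.real 1 k ≤ s.real 2 (s.int 6 (s.int 1 k) - 1) ∨ s.real 4 1 < s.real 12 (s.int 1 k)) := by
      simp only [selectTest, Test.Holds, IExp.eval, RExp.eval, hck, r1, r2, r4, r12, i1, i4, i6]
      -- Equality of integers is tested by two comparisons.
      rw [← le_antisymm_iff, not_and_or, not_not, not_le]
    obtain ⟨g1, g2⟩ := hI
    by_cases hb : selectTest.Holds s'
    · rw [Prog.run_ite_pos hb, Prog.run_setInt]
      simp [IExp.eval, hck]
      refine ⟨fun i hi => ?_, fun i hi => ?_⟩
      · rcases Nat.le_iff_lt_or_eq.1 hi with hi' | rfl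
        · simpa only [hi'.ne, if_false, not_false_eq_true, true_imp_iff] using g1 i hi'
        · simpa using htest.1 hb
      · have : i ≠ k := by omega
        simp [this, g2 i (by omega)]
    · rw [Prog.run_ite_neg hb, Prog.run_skip]
      simp
      refine ⟨fun i hi => ?_, fun i hi => g2 i (by omega)⟩
      rcases Nat.le_iff_lt_or_eq.1 hi with hi' | rfl
      · exact g1 i hi'
      · rw [g2 i le_rfl, ← htest]
        simp [hb]
  · exact Nat.mul_le_mul_left _ (by
      simp [selectTest, Prog.bound, Test.cost, IExp.cost, RExp.cost])

end RepSel

/-! ### The sweep over the sorted ramps. -/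

namespace RepSel

open RealRAM

/-- Start with the last ramp. -/
def sweepInit : Prog := .block [
  .setMax 4 (.lit 1) (.lit 0) (.get 5 (.get 10 (.sub (.var 9) (.lit 1)))),
  .setReal 4 (.lit 0) (.add (.mul (.get 0 (.lit 0)) (.get 4 (.lit 1))) (.get 14 (.lit 0)))]

/-- The value in the scratch register is at least as good as the best one. -/
def betterTest : Test := .realLE (.get 17 (.lit 0)) (.get 4 (.lit 0))

/-- Evaluate the function at all ramps, from right to left. -/
def sweepLoop : Prog := .forLoop 12 (.var 9) (.block [
  .setInt 21 (.lit 0) (.get 10 (.sub (.sub (.var 9) (.lit 1)) (.var 12))),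
  .setReal 15 (.lit 0) (.add (.get 15 (.lit 0)) (.get 13 (.var 21))),
  .setReal 16 (.lit 0) (.add (.get 16 (.lit 0)) (.mul (.get 13 (.var 21)) (.get 5 (.var 21)))),
  .setReal 17 (.lit 0)
    (.add (.add (.mul (.get 0 (.lit 0)) (.get 5 (.var 21))) (.get 14 (.lit 0)))
      (.sub (.get 16 (.lit 0)) (.mul (.get 15 (.lit 0)) (.get 5 (.var 21))))),
  .ite betterTest
    (.block [.setReal 4 (.lit 0) (.get 17 (.lit 0)), .setReal 4 (.lit 1) (.get 5 (.var 21))])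
    .skip])

/-- Evaluate the function at `0`. -/
def sweepFinal : Prog := .block [
  .setReal 17 (.lit 0) (.add (.get 14 (.lit 0)) (.get 16 (.lit 0))),
  .ite betterTest
    (.block [.setReal 4 (.lit 0) (.get 17 (.lit 0)), .setReal 4 (.lit 1) (.lit 0)])
    .skip]

/-- Find the minimum of an affine function plus ramps. -/
def sweep : Prog := .seq sweepInit (.seq sweepLoop sweepFinal)

/-- An affine function plus ramps. -/
noncomputable def rampSum (γ β : ℝ) (Q V : ℕ → ℝ) (N : ℕ) (π : ℝ) : ℝ :=
  γ * π + β + ∑ i ∈ Finset.range N, V i * max 0 (Q i - π)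

theorem Sorts.sum_comp_reflect {key : ℕ → ℝ} {N : ℕ} {σ : ℕ → ℕ} (h : Sorts key N σ)
    (g : ℕ → ℝ) :
    ∑ k ∈ Finset.range N, g (σ (N - 1 - k)) = ∑ k ∈ Finset.range N, g k := by
  rw [Finset.sum_range_reflect (fun k => g (σ k)) N, h.sum_comp]

theorem rampSum_last {γ β : ℝ} {Q V : ℕ → ℝ} {N : ℕ} {π : ℝ} (h : ∀ i < N, Q i ≤ π) :
    rampSum γ β Q V N π = γ * π + β := by
  rw [rampSum, Finset.sum_eq_zero, add_zero]
  intro i hi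
  rw [max_eq_left (by linarith [h i (Finset.mem_range.1 hi)]), mul_zero]

theorem rampSum_zero {γ β : ℝ} {Q V : ℕ → ℝ} {N : ℕ} {σ : ℕ → ℕ} (h : Sorts Q N σ)
    (hQ : ∀ i < N, 0 ≤ Q i) :
    rampSum γ β Q V N 0 =
      β + ∑ l ∈ Finset.range N, V (σ (N - 1 - l)) * Q (σ (N - 1 - l)) := by
  rw [h.sum_comp_reflect fun i => V i * Q i, rampSum, mul_zero, zero_add]
  congr 1
  refine Finset.sum_congr rfl fun i hi => ?_
  rw [sub_zero, max_eq_right (hQ i (Finset.mem_range.1 hi))]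

/-- At the `k`-th location from the right only the ramps met so far can be positive. Their sum
depends on two prefix sums, of `V` and of `V * Q`; ties contribute `0` on either side. -/
theorem rampSum_loc {γ β : ℝ} {Q V : ℕ → ℝ} {N : ℕ} {σ : ℕ → ℕ} (h : Sorts Q N σ)
    {k : ℕ} (hk : k < N) :
    rampSum γ β Q V N (Q (σ (N - 1 - k))) = γ * Q (σ (N - 1 - k)) + β +
      (∑ l ∈ Finset.range (k + 1), V (σ (N - 1 - l)) * Q (σ (N - 1 - l)) -
        (∑ l ∈ Finset.range (k + 1), V (σ (N - 1 - l))) * Q (σ (N - 1 - k))) := by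
  rw [rampSum, ← h.sum_comp_reflect fun i => V i * max 0 (Q i - Q (σ (N - 1 - k))),
    Finset.sum_mul, ← Finset.sum_sub_distrib]
  congr 1
  rw [← Finset.sum_subset (Finset.range_subset_range.2 (Nat.succ_le_of_lt hk))]
  · refine Finset.sum_congr rfl fun l hl => ?_
    rw [Finset.mem_range] at hl
    have := h.mono (N - 1 - k) (N - 1 - l) (by omega) (by omega)
    rw [max_eq_right (by linarith)]
    ring
  · intro l hl hl'
    rw [Finset.mem_range] at hl hl'
    have := h.mono (N - 1 - l) (N - 1 - k) (by omega) (by omega)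
    rw [max_eq_left (by linarith), mul_zero]

theorem runs_sweep {s : State} {N : ℕ} (hN : s.int 9 0 = N)
    (hσ : Sorts (s.real 5) N (s.int 10)) (hQ : ∀ i < N, 0 ≤ s.real 5 i) (hγ : 0 ≤ s.real 0 0)
    (h15 : s.real 15 0 = 0) (h16 : s.real 16 0 = 0) {g : ℝ → ℝ}
    (hg : ∀ π, 0 ≤ π → g π = rampSum (s.real 0 0) (s.real 14 0) (s.real 5) (s.real 13) N π) :
    Runs sweep s ((N + 1) * 300) fun s' =>
      (s'.real 4 0 = g (s'.real 4 1) ∧ 0 ≤ s'.real 4 1 ∧ ∀ π, 0 ≤ π → s'.real 4 0 ≤ g π) ∧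
      sweep.Frame s s' := by
  set Q := s.real 5 with hQdef
  set V := s.real 13 with hVdef
  set σ := s.int 10 with hσdef
  set γ := s.real 0 0 with hγdef
  set β := s.real 14 0 with hβdef
  have hσlt : ∀ l < N, σ (N - 1 - l) < N := fun l hl =>
    hσ.bij.mapsTo (show N - 1 - l < N by omega)
  refine Runs.frame ?_
  -- To the right of all locations the ramps vanish, so the affine part alone gives a genuine
  -- function value to start from; the maximum with `0` keeps the point admissible.
  have hinit : Runs sweepInit s 60 fun s' => (s'.real 4 0 = g (s'.real 4 1) ∧ 0 ≤ s'.real 4 1) ∧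
      sweepInit.Frame s s' := by
    refine ((Runs.of_flat rfl ?_).mono (by decide) fun _ h => h).frame
    simp only [sweepInit, Prog.block, Prog.run_seq, Prog.run_setReal, Prog.run_setMax]
    simp only [IExp.eval, RExp.eval, hN, ← hQdef, ← hσdef]
    simp [← hγdef, ← hβdef]
    rw [hg _ (le_max_left _ _), rampSum_last]
    intro i hi
    obtain ⟨k, hk, rfl⟩ := hσ.bij.surjOn hi
    exact le_max_of_le_right (hσ.mono k (N - 1) (Nat.le_sub_one_of_lt hk)
      (Nat.sub_lt (by have : k < N := hk; omega) Nat.one_pos))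
  refine (hinit.seq (T' := (N + 1) * 150 + 60) fun s₁ ⟨⟨hv, hπ⟩, hf₁⟩ => ?_).mono (by omega)
    fun s' h => h
  · have i9 : s₁.int 9 = s.int 9 := hf₁.int 9 (by decide)
    have i10 : s₁.int 10 = σ := hf₁.int 10 (by decide)
    have r0 : s₁.real 0 = s.real 0 := hf₁.real 0 (by decide)
    have r5 : s₁.real 5 = Q := hf₁.real 5 (by decide)
    have r13 : s₁.real 13 = V := hf₁.real 13 (by decide)
    have r14 : s₁.real 14 = s.real 14 := hf₁.real 14 (by decide)
    have r15 : s₁.real 15 = s.real 15 := hf₁.real 15 (by decide)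
    have r16 : s₁.real 16 = s.real 16 := hf₁.real 16 (by decide)
    have hloop : Runs sweepLoop s₁ ((N + 1) * 150) fun s' =>
        (s'.real 15 0 = ∑ l ∈ Finset.range N, V (σ (N - 1 - l)) ∧
        s'.real 16 0 = ∑ l ∈ Finset.range N, V (σ (N - 1 - l)) * Q (σ (N - 1 - l)) ∧
        s'.real 4 0 = g (s'.real 4 1) ∧ 0 ≤ s'.real 4 1 ∧
        ∀ l < N, s'.real 4 0 ≤ g (Q (σ (N - 1 - l)))) ∧ sweepLoop.Frame s₁ s' := by
      refine (Runs.forLoop (N := N) (fun k s' =>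
        s'.real 15 0 = ∑ l ∈ Finset.range k, V (σ (N - 1 - l)) ∧
        s'.real 16 0 = ∑ l ∈ Finset.range k, V (σ (N - 1 - l)) * Q (σ (N - 1 - l)) ∧
        s'.real 4 0 = g (s'.real 4 1) ∧ 0 ≤ s'.real 4 1 ∧
        ∀ l < k, s'.real 4 0 ≤ g (Q (σ (N - 1 - l)))) rfl (by decide) ?_ (fun k s' hf _ => ?_)
        fun k hk s' hf hck hI => ?_).mono (Nat.mul_le_mul_left _ (by decide)) fun _ h => h
      · exact ⟨by simp [r15, h15], by simp [r16, h16], by simpa using hv, by simpa using hπ, by simp⟩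
      · simp [IExp.eval, hf.int 9 (by decide), i9, hN]
      · have f9 : s'.int 9 0 = N := by rw [hf.int 9 (by decide), i9, hN]
        have f10 : s'.int 10 = σ := by rw [hf.int 10 (by decide), i10]
        have f0 : s'.real 0 0 = γ := by rw [hf.real 0 (by decide), r0]
        have f5 : s'.real 5 = Q := by rw [hf.real 5 (by decide), r5]
        have f13 : s'.real 13 = V := by rw [hf.real 13 (by decide), r13]
        have f14 : s'.real 14 0 = β := by rw [hf.real 14 (by decide), r14]
        obtain ⟨g15, g16, gv, gπ, gmin⟩ := hI
        have hloc := rampSum_loc (γ := γ) (β := β) (V := V) hσ hk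
        have hq0 := hQ _ (hσlt k hk)
        rw [← hg _ hq0] at hloc
        set q := Q (σ (N - 1 - k)) with hq
        set pre : Prog := .block [
          .setInt 21 (.lit 0) (.get 10 (.sub (.sub (.var 9) (.lit 1)) (.var 12))),
          .setReal 15 (.lit 0) (.add (.get 15 (.lit 0)) (.get 13 (.var 21))),
          .setReal 16 (.lit 0)
            (.add (.get 16 (.lit 0)) (.mul (.get 13 (.var 21)) (.get 5 (.var 21)))),
          .setReal 17 (.lit 0)
            (.add (.add (.mul (.get 0 (.lit 0)) (.get 5 (.var 21))) (.get 14 (.lit 0)))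
              (.sub (.get 16 (.lit 0)) (.mul (.get 15 (.lit 0)) (.get 5 (.var 21)))))] with hpre
        set s₃ := pre.run s' with hs₃
        have t21 : s₃.int 21 0 = σ (N - 1 - k) := by
          simp [hs₃, hpre, Prog.block, Prog.run_seq, Prog.run_setInt, Prog.run_setReal, IExp.eval,
            f9, f10, hck]
        have t5 : s₃.real 5 = Q := by
          funext i
          simp [hs₃, hpre, Prog.block, Prog.run_seq, Prog.run_setInt, Prog.run_setReal, f5]
        have t4 : s₃.real 4 = s'.real 4 := by
          funext i
          simp [hs₃, hpre, Prog.block, Prog.run_seq, Prog.run_setInt, Prog.run_setReal]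
        have t15 : s₃.real 15 0 = ∑ l ∈ Finset.range (k + 1), V (σ (N - 1 - l)) := by
          rw [Finset.sum_range_succ, ← g15]
          simp [hs₃, hpre, Prog.block, Prog.run_seq, Prog.run_setInt, Prog.run_setReal, IExp.eval,
            RExp.eval, f9, f10, f13, hck]
        have t16 : s₃.real 16 0 =
            ∑ l ∈ Finset.range (k + 1), V (σ (N - 1 - l)) * Q (σ (N - 1 - l)) := by
          rw [Finset.sum_range_succ, ← g16]
          simp [hs₃, hpre, Prog.block, Prog.run_seq, Prog.run_setInt, Prog.run_setReal, IExp.eval,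
            RExp.eval, f9, f10, f13, f5, hck]
        have t17 : s₃.real 17 0 = g q := by
          rw [hloc, Finset.sum_range_succ, Finset.sum_range_succ, ← g15, ← g16]
          simp [hs₃, hpre, Prog.block, Prog.run_seq, Prog.run_setInt, Prog.run_setReal, IExp.eval,
            RExp.eval, f0, f9, f10, f13, f14, f5, hck, ← hq]
        change _ ∧ _
        have hrun : ∀ r : Prog, (Prog.block [
          .setInt 21 (.lit 0) (.get 10 (.sub (.sub (.var 9) (.lit 1)) (.var 12))),
          .setReal 15 (.lit 0) (.add (.get 15 (.lit 0)) (.get 13 (.var 21))),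
          .setReal 16 (.lit 0)
            (.add (.get 16 (.lit 0)) (.mul (.get 13 (.var 21)) (.get 5 (.var 21)))),
          .setReal 17 (.lit 0)
            (.add (.add (.mul (.get 0 (.lit 0)) (.get 5 (.var 21))) (.get 14 (.lit 0)))
              (.sub (.get 16 (.lit 0)) (.mul (.get 15 (.lit 0)) (.get 5 (.var 21))))), r]).run s' =
            r.run s₃ := fun r => rfl
        rw [hrun]
        by_cases hb : betterTest.Holds s₃
        · rw [Prog.run_ite_pos hb]
          have hle : g q ≤ s'.real 4 0 := by rw [← t17, ← t4]; exact hb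
          simp only [Prog.block, Prog.run_seq, Prog.run_setReal]
          simp [IExp.eval, RExp.eval, t15, t16, t17, t21, t5, ← hq, hq0]
          intro l hl
          rcases Nat.le_iff_lt_or_eq.1 hl with hl' | rfl
          · exact hle.trans (gmin l hl')
          · exact le_rfl
        · rw [Prog.run_ite_neg hb, Prog.run_skip]
          have hle : s'.real 4 0 ≤ g q := by
            rw [← t17, ← t4]
            exact (not_le.1 hb).le
          simp [t15, t16, t4, gv, gπ]
          rw [← gv]
          intro l hl
          rcases Nat.le_iff_lt_or_eq.1 hl with hl' | rfl
          · exact gmin l hl'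
          · exact hle
    refine ((hloop.seq (T' := 60) fun s₂ hs₂ =>
      (Runs.of_flat rfl ?_).mono (by decide) fun _ h => h).mono ?_ fun s' h => h)
    · obtain ⟨⟨g15, g16, gv, gπ, gmin⟩, hf⟩ := hs₂
      have f14 : s₂.real 14 0 = β := by rw [hf.real 14 (by decide), r14]
      -- The loop has covered all locations and the final step covers `0`; these are all the
      -- candidates for a minimum.
      have hmin : ∀ v, v ≤ s₂.real 4 0 → v ≤ g 0 → ∀ π, 0 ≤ π → v ≤ g π := by
        intro v h1 h2 π hπ
        obtain ⟨q, hq, hle⟩ := exists_candidate_le hγ hQ hg hπ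
        refine le_trans ?_ hle
        rcases hq with rfl | ⟨i, hi, rfl⟩
        · exact h2
        · obtain ⟨k, hk, rfl⟩ := hσ.bij.surjOn hi
          have hk' : k < N := hk
          have := gmin (N - 1 - k) (by omega)
          rw [show N - 1 - (N - 1 - k) = k by omega] at this
          exact h1.trans this
      have h0 : g 0 = β + s₂.real 16 0 := by
        rw [hg 0 le_rfl, rampSum_zero hσ hQ, g16]
      simp only [sweepFinal, Prog.block, Prog.run_seq]
      set s₃ := Prog.run (.setReal 17 (.lit 0) (.add (.get 14 (.lit 0)) (.get 16 (.lit 0)))) s₂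
        with hs₃
      have t17 : s₃.real 17 0 = g 0 := by
        simp [hs₃, Prog.run_setReal, IExp.eval, RExp.eval, h0, f14]
      have t4 : s₃.real 4 = s₂.real 4 := by
        funext i
        simp [hs₃, Prog.run_setReal, IExp.eval]
      by_cases hb : betterTest.Holds s₃
      · rw [Prog.run_ite_pos hb]
        have hle : g 0 ≤ s₂.real 4 0 := by rw [← t17, ← t4]; exact hb
        simp only [Prog.run_seq, Prog.run_setReal]
        simp [IExp.eval, RExp.eval, t17]
        exact hmin _ hle le_rfl
      · rw [Prog.run_ite_neg hb, Prog.run_skip, t4]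
        have hle : s₂.real 4 0 ≤ g 0 := by
          rw [← t17, ← t4]
          exact (not_le.1 hb).le
        exact ⟨gv, gπ, hmin _ le_rfl hle⟩
    · exact le_rfl

end RepSel

/-! ### The assembled program and its correctness. -/

namespace RepSel

open RealRAM

/-- Compute the minima of the parts and the levels. -/
def prelude : Prog := .seq upperLoop (.seq (argminLoop 1 4) (.seq (argminLoop 6 5)
  (.seq (argminLoop 2 6) (.seq levelLoop (.block [
    .setInt 8 (.lit 0) (.add (.var 0) (.var 0)),
    .setInt 9 (.lit 0) (.add (.var 8) (.var 8)),
    .setInt 3 (.lit 0) (.var 9)])))))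

/-- The program. -/
def program : Prog := .seq prelude (.seq (sort 8 7) (.seq scanLoop (.seq cutLoop
  (.seq baseLoop (.seq (sort 9 5) (.seq sweep selectLoop))))))

namespace Instance

variable {n m : ℕ} (I : Instance n m)

/-- The array `A` holds for every part the successor of an item with the smallest value of `K`. -/
def IsArgmin (K : Fin n → ℝ) (A : ℕ → ℕ) : Prop :=
  ∀ j : Fin m, ∃ i : Fin n, I.part i = j ∧ A j = i + 1 ∧ K i = (I.T j).inf' (I.T_nonempty j) K

theorem input_part (i : Fin n) : I.input.int 1 i = I.part i := by simp [input]

theorem isArgmin_of_spec {K : Fin n → ℝ} {A p : ℕ → ℕ} {key : ℕ → ℝ} (hp : ∀ i : Fin n, p i = I.part i)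
    (hK : ∀ i : Fin n, key i = K i)
    (h : (∀ i < n, 1 ≤ A (p i) ∧ key (A (p i) - 1) ≤ key i) ∧
      ∀ j, 1 ≤ A j → A j ≤ n ∧ p (A j - 1) = j) : I.IsArgmin K A := by
  intro j
  obtain ⟨i₀, hi₀⟩ := I.part_surjective j
  have h1 := (h.1 i₀ i₀.2).1
  rw [hp, hi₀] at h1
  obtain ⟨h2, h3⟩ := h.2 j h1
  set a : Fin n := ⟨A j - 1, by omega⟩ with ha
  have ha' : A j - 1 = a := rfl
  have haj : I.part a = j := by
    rw [ha', hp, Fin.val_inj] at h3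
    exact h3
  refine ⟨a, haj, by omega, le_antisymm (Finset.le_inf' _ _ fun i hi => ?_)
    (Finset.inf'_le _ (I.mem_T.2 haj))⟩
  have := (h.1 i i.2).2
  rwa [hp, I.mem_T.1 hi, ha', hK, hK] at this

/-- The memory after the prelude. -/
structure PreludePost (s : State) : Prop where
  argC : I.IsArgmin I.C (s.int 4)
  argLow : I.IsArgmin I.cLow (s.int 6)
  levels : I.IsLevelData (s.real 7) (s.real 8) (s.int 7)
  numLevels : s.int 8 0 = n + n
  numRamps : s.int 9 0 = n + n + (n + n)
  numBreakpoints : s.int 3 0 = n + n + (n + n)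

theorem runs_prelude : Runs prelude I.input ((n + 1) * 600) fun s =>
    I.PreludePost s ∧ prelude.Frame I.input s := by
  have hn : I.input.int 0 0 = n := by simp [input]
  refine Runs.frame ?_
  refine ((runs_upperLoop hn).seq (T' := (n + 1) * 550) fun s₁ ⟨h₁, f₁⟩ => ?_).mono
    (by omega) fun _ h => h
  have a0 : s₁.int 0 = I.input.int 0 := f₁.int 0 (by decide)
  have a1 : s₁.int 1 = I.input.int 1 := f₁.int 1 (by decide)
  refine ((runs_argminLoop (by decide) (a0 ▸ hn) fun j => by
    rw [f₁.int 4 (by decide)]; simp [input]).seq (T' := (n + 1) * 470)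
    fun s₂ ⟨h₂, f₂⟩ => ?_).mono (by omega) fun _ h => h
  have b0 : s₂.int 0 = I.input.int 0 := by rw [f₂.int 0 (by decide), a0]
  have b1 : s₂.int 1 = I.input.int 1 := by rw [f₂.int 1 (by decide), a1]
  refine ((runs_argminLoop (by decide) (b0 ▸ hn) fun j => by
    rw [f₂.int 5 (by decide), f₁.int 5 (by decide)]; simp [input]).seq (T' := (n + 1) * 390)
    fun s₃ ⟨h₃, f₃⟩ => ?_).mono (by omega) fun _ h => h
  have c0 : s₃.int 0 = I.input.int 0 := by rw [f₃.int 0 (by decide), b0]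
  have c1 : s₃.int 1 = I.input.int 1 := by rw [f₃.int 1 (by decide), b1]
  refine ((runs_argminLoop (by decide) (c0 ▸ hn) fun j => by
    rw [f₃.int 6 (by decide), f₂.int 6 (by decide), f₁.int 6 (by decide)]; simp [input]).seq
    (T' := (n + 1) * 310) fun s₄ ⟨h₄, f₄⟩ => ?_).mono (by omega) fun _ h => h
  have d0 : s₄.int 0 = I.input.int 0 := by rw [f₄.int 0 (by decide), c0]
  have d1 : s₄.int 1 = I.input.int 1 := by rw [f₄.int 1 (by decide), c1]
  refine ((runs_levelLoop (d0 ▸ hn) fun i => by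
    rw [f₄.real 8 (by decide), f₃.real 8 (by decide), f₂.real 8 (by decide),
      f₁.real 8 (by decide)]; simp [input]).seq
    (T' := 40) fun s₅ ⟨h₅, f₅⟩ => ?_).mono (by omega) fun _ h => h
  have e0 : s₅.int 0 0 = n := by rw [f₅.int 0 (by decide), d0, hn]
  have hC : I.IsArgmin I.C (s₂.int 4) := by
    refine I.isArgmin_of_spec (p := s₁.int 1) (key := s₁.real 1) (fun i => ?_) (fun i => ?_) h₂
    · rw [a1, input_part]
    · rw [f₁.real 1 (by decide)]; simp [input]
  have hu : ∀ i : Fin n, s₂.real 6 i = I.cLow i + I.d i := fun i => by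
    rw [f₂.real 6 (by decide), h₁ i i.2]; simp [input]
  have hU : I.IsArgmin (fun i => I.cLow i + I.d i) (s₃.int 5) := by
    refine I.isArgmin_of_spec (p := s₂.int 1) (key := s₂.real 6) (fun i => ?_) hu h₃
    rw [b1, input_part]
  have hr2 : ∀ i : Fin n, s₄.real 2 i = I.cLow i := fun i => by
    rw [f₄.real 2 (by decide), f₃.real 2 (by decide), f₂.real 2 (by decide),
      f₁.real 2 (by decide)]
    simp [input]
  have hr3 : ∀ i : Fin n, s₄.real 3 i = I.d i := fun i => by
    rw [f₄.real 3 (by decide), f₃.real 3 (by decide), f₂.real 3 (by decide),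
      f₁.real 3 (by decide)]
    simp [input]
  have hL : I.IsArgmin I.cLow (s₄.int 6) := by
    refine I.isArgmin_of_spec (p := s₃.int 1) (key := s₃.real 2) (fun i => ?_) (fun i => ?_) h₄
    · rw [c1, input_part]
    · rw [← hr2, f₄.real 2 (by decide)]
  have htop : ∀ i : Fin n, s₄.real 6 (s₄.int 5 (s₄.int 1 i) - 1) = I.top (I.part i) := fun i => by
    rw [d1, input_part, f₄.int 5 (by decide)]
    obtain ⟨k, -, hk, he⟩ := hU (I.part i)
    rw [hk, Nat.add_sub_cancel, f₄.real 6 (by decide), f₃.real 6 (by decide), hu]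
    exact he
  have hlev : I.IsLevelData (s₅.real 7) (s₅.real 8) (s₅.int 7) := by
    obtain ⟨g, g0⟩ := h₅
    refine ⟨fun i => ?_, fun i => ?_, fun i => ?_, fun i => g0 _ (by omega), fun i => ?_,
      fun i => ?_⟩
    · rw [(g i i.2).1, htop, hr2]
    · rw [(g i i.2).2.1, htop]
    · rw [(g i i.2).2.2.1, hr3]
    · rw [(g i i.2).2.2.2.1, d1, input_part]
    · rw [(g i i.2).2.2.2.2, d1, input_part]
  have g4 : s₅.int 4 = s₂.int 4 := by
    rw [f₅.int 4 (by decide), f₄.int 4 (by decide), f₃.int 4 (by decide)]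
  have g6 : s₅.int 6 = s₄.int 6 := f₅.int 6 (by decide)
  refine (Runs.of_flat (Q := fun s => I.PreludePost s) rfl ?_).mono (by decide) fun _ h => h
  set s₆ := Prog.run (.block [
    .setInt 8 (.lit 0) (.add (.var 0) (.var 0)),
    .setInt 9 (.lit 0) (.add (.var 8) (.var 8)),
    .setInt 3 (.lit 0) (.var 9)]) s₅ with hs₆
  have k4 : s₆.int 4 = s₅.int 4 := by
    funext i; simp [hs₆, Prog.block, Prog.run_seq, Prog.run_setInt]
  have k6 : s₆.int 6 = s₅.int 6 := by
    funext i; simp [hs₆, Prog.block, Prog.run_seq, Prog.run_setInt]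
  have k7 : s₆.int 7 = s₅.int 7 := by
    funext i; simp [hs₆, Prog.block, Prog.run_seq, Prog.run_setInt]
  have kr : s₆.real = s₅.real := by
    simp [hs₆, Prog.block, Prog.run_seq, Prog.run_setInt]
  refine ⟨by rwa [k4, g4], by rwa [k6, g6], by rwa [k7, kr], ?_, ?_, ?_⟩ <;>
    simp [hs₆, Prog.block, Prog.run_seq, Prog.run_setInt, IExp.eval, e0]

/-- Nonempty parts make a loop over the parts linear in `n`. -/
theorem part_count_le {n m : ℕ} (I : Instance n m) : m ≤ n := by
  simpa using Fintype.card_le_of_surjective _ I.part_surjective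

/-- The selection computed from `π` attains the minima in `f`. -/
theorem selection_spec {L E : ℕ → ℝ} {P : ℕ → ℕ} (hL : I.IsLevelData L E P) {σ : ℕ → ℕ}
    (hσ : Sorts L (n + n) σ) {C : ℕ → ℝ} (hC : ∀ j : Fin m, C j = I.minC j) {A : ℕ → ℕ}
    (hA : I.IsArgmin I.C A) {π : ℝ} (hπ : 0 ≤ π) {x : Fin n → ℝ} (hx : ∀ i, x i = 0 ∨ x i = 1)
    (hsel : ∀ i, x i = 1 ↔ A (I.part i) = i + 1 ∧ (I.C i ≤ I.low (I.part i) ∨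
      π < cap (fun k => L (σ k)) (fun k => E (σ k)) (fun k => P (σ k)) C (n + n) (I.part i)))
    (j : Fin m) : (∑ i ∈ I.T j, x i = 0 ∧ I.fPart j π ≤ I.minC j) ∨
      (∑ i ∈ I.T j, x i = 1 ∧ ∑ i ∈ I.T j, I.C i * x i = I.minC j ∧ I.minC j ≤ I.fPart j π) := by
  obtain ⟨a, haj, hAj, hmin⟩ := hA j
  have hseq := hL.isLevelSeq hσ j
  have hf := hL.fPart_eq_ramps hσ j hπ
  have hmin' : I.C a = I.minC j := hmin
  have hoff : ∀ i ∈ I.T j, i ≠ a → x i = 0 := by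
    intro i hi hne
    refine (hx i).resolve_right fun h1 => hne ?_
    have := ((hsel i).1 h1).1
    rw [I.mem_T.1 hi, hAj] at this
    exact Fin.ext (by omega)
  have haT : a ∈ I.T j := I.mem_T.2 haj
  rw [Finset.sum_eq_single_of_mem a haT hoff, Finset.sum_eq_single_of_mem a haT
    fun i hi hne => by rw [hoff i hi hne, mul_zero]]
  have ha := hsel a
  rw [haj, hmin', ← hC] at ha
  by_cases h1 : x a = 1
  · right
    refine ⟨h1, by rw [h1, mul_one, hmin'], ?_⟩
    rcases (ha.1 h1).2 with h | h
    · rw [hC] at h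
      exact h.trans (I.low_le_fPart j hπ)
    · rw [hf, ← hC]
      exact le_ramps_of_le_cap hseq hπ h
  · left
    refine ⟨(hx a).resolve_right h1, ?_⟩
    have h2 : ¬ (C j ≤ I.low j ∨ π < cap (fun k => L (σ k)) (fun k => E (σ k))
      (fun k => P (σ k)) C (n + n) j) := fun h => h1 (ha.2 ⟨hAj, h⟩)
    push Not at h2
    -- An item is left to the second stage only if `low < C` and `cap ≤ π`; then the bound `max low
    -- C` is just `C`.
    have := ramps_le_of_cap_le hseq h2.2
    rw [max_eq_right h2.1.le, ← hf, hC] at this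
    exact this

end Instance

/-! ### Asymptotics and the final verification. -/

/-- The running time. -/
def runningTime (n : ℕ) : ℕ := 6000 * (n + 1) * (Nat.clog 2 (n + n + (n + n)) + 1)

/-- For `n ≥ 2` the predecessor of the logarithm satisfies `2 ^ (c - 1) < 4n ≤ n ^ 3`, so `c - 1 ≤ 6
log n` because `log 2 ≥ 1/2`; the remaining `2` is at most `4 log n`. With `n + 1 ≤ 2n` the constant
is `6000 * 2 * 10`. -/
theorem runningTime_isBigO :
    (fun n : ℕ => (runningTime n : ℝ)) =O[Filter.atTop] fun n : ℕ => (n : ℝ) * Real.log (n : ℝ) := by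
  refine Asymptotics.IsBigO.of_bound 120000 ?_
  filter_upwards [Filter.eventually_ge_atTop 2] with n hn
  have hn' : (2 : ℝ) ≤ n := by exact_mod_cast hn
  have hlog2 : (1 / 2 : ℝ) ≤ Real.log 2 := by linarith [Real.log_two_gt_d9]
  have hlog : Real.log 2 ≤ Real.log n := Real.log_le_log (by norm_num) hn'
  have hpow := Nat.pow_pred_clog_lt_self Nat.one_lt_two (show 1 < n + n + (n + n) by omega)
  set c := Nat.clog 2 (n + n + (n + n)) with hc
  have hc1 : (c : ℝ) - 1 ≤ (c.pred : ℕ) := by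
    rw [sub_le_iff_le_add]
    exact_mod_cast Nat.le_succ_of_pred_le le_rfl
  have h1 : ((c.pred : ℕ) : ℝ) * Real.log 2 ≤ 3 * Real.log n := by
    have h2 : ((2 : ℝ) ^ c.pred) ≤ (n : ℝ) ^ 3 := by
      have : 2 ^ c.pred ≤ n ^ 3 := by
        have h4 := Nat.mul_le_mul_right n (Nat.mul_le_mul hn hn)
        rw [pow_succ, sq]
        omega
      exact_mod_cast this
    have := Real.log_le_log (by positivity) h2
    rw [Real.log_pow, Real.log_pow] at this
    exact_mod_cast this
  have hcb : (c : ℝ) + 1 ≤ 10 * Real.log n := by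
    have h0 : (0 : ℝ) ≤ (c.pred : ℕ) := Nat.cast_nonneg _
    nlinarith
  rw [Real.norm_of_nonneg (Nat.cast_nonneg _), Real.norm_of_nonneg (by positivity)]
  rw [runningTime, ← hc]
  push_cast
  have hl0 : 0 ≤ Real.log n := by linarith
  calc 6000 * ((n : ℝ) + 1) * (c + 1) ≤ 6000 * (2 * n) * (10 * Real.log n) := by
        refine mul_le_mul (by linarith) hcb (by positivity) (by positivity)
    _ = 120000 * (n * Real.log n) := by ring

theorem runs_program {n m : ℕ} (I : Instance n m) : Runs program I.input (runningTime n) fun s =>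
    IsLeast (I.f '' Set.Ici 0) (outValue s) ∧
      I.IsOptimal (outX n s) (outValue s) ∧ I.IsMIPOptimal (outX n s) (outPi s) (outValue s) ∧
      (outBreakpoints s).card ≤ 4 * n ∧ PiecewiseLinearWith I.f (outBreakpoints s) := by
  have hmn := I.part_count_le
  set c := Nat.clog 2 (n + n + (n + n)) with hc
  have hcle : Nat.clog 2 (n + n) ≤ c := Nat.clog_mono_right 2 (by omega)
  refine (I.runs_prelude.seq fun s₁ ⟨h₁, f₁⟩ =>
    (runs_sort 8 7 (by decide) h₁.numLevels).frame.seq fun s₂ ⟨hσ, f₂⟩ =>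
    (runs_scanLoop (s := s₂) (K := n + n) (by rw [f₂.int 8 (by decide), h₁.numLevels])
      (fun j => by rw [f₂.real 9 (by decide), f₁.real 9 (by decide)]; simp [Instance.input])
      (fun j => by rw [f₂.real 10 (by decide), f₁.real 10 (by decide)]; simp [Instance.input])
      (fun j => by rw [f₂.real 11 (by decide), f₁.real 11 (by decide)]; simp [Instance.input])
      (fun j => by rw [f₂.real 12 (by decide), f₁.real 12 (by decide)]; simp [Instance.input])
      (fun _ => rfl) (fun _ => rfl) (fun _ => rfl) (fun _ => rfl)).seq fun s₃ ⟨h₃, f₃⟩ =>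
    (runs_cutLoop (s := s₃) (K := n + n) (by
      rw [f₃.int 8 (by decide), f₂.int 8 (by decide), h₁.numLevels])).seq fun s₄ ⟨h₄, f₄⟩ =>
    (runs_baseLoop (s := s₄) (m := m) (by
      rw [f₄.int 0 (by decide), f₃.int 0 (by decide), f₂.int 0 (by decide), f₁.int 0 (by decide)]
      simp [Instance.input]) (by
      rw [f₄.real 14 (by decide), f₃.real 14 (by decide), f₂.real 14 (by decide),
        f₁.real 14 (by decide)]
      simp [Instance.input])).seq fun s₅ ⟨h₅, f₅⟩ =>
    (runs_sort 9 5 (by decide) (s := s₅) (N := n + n + (n + n)) (by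
      rw [f₅.int 9 (by decide), f₄.int 9 (by decide), f₃.int 9 (by decide), f₂.int 9 (by decide),
        h₁.numRamps])).frame.seq
      (T' := (n + n + (n + n) + 1) * 300 + (n + 1) * 100) fun s₆ ⟨hτ, f₆⟩ => ?_).mono
      ?_ fun _ h => h
  · set L := s₂.real 7 with hLdef
    set E := s₂.real 8 with hEdef
    set P := s₂.int 7 with hPdef
    set σ := s₂.int 10 with hσdef
    set C : ℕ → ℝ := fun j => s₂.real 1 (s₂.int 4 j - 1) with hCdef
    set Q := s₄.real 5 with hQdef
    set V := s₄.real 13 with hVdef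
    have r1 : ∀ i : Fin n, s₂.real 1 i = I.C i := fun i => by
      rw [f₂.real 1 (by decide), f₁.real 1 (by decide)]; simp [Instance.input]
    have r2 : ∀ i : Fin n, s₂.real 2 i = I.cLow i := fun i => by
      rw [f₂.real 2 (by decide), f₁.real 2 (by decide)]; simp [Instance.input]
    have i4 : I.IsArgmin I.C (s₂.int 4) := by rw [f₂.int 4 (by decide)]; exact h₁.argC
    have i6 : I.IsArgmin I.cLow (s₂.int 6) := by rw [f₂.int 6 (by decide)]; exact h₁.argLow
    have hL : I.IsLevelData L E P := by
      rw [hLdef, hEdef, hPdef, f₂.real 7 (by decide), f₂.real 8 (by decide), f₂.int 7 (by decide)]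
      exact h₁.levels
    have hσ' : Sorts L (n + n) σ := by
      rw [hLdef, f₂.real 7 (by decide)]
      exact hσ
    have hC : ∀ j : Fin m, C j = I.minC j := fun j => by
      obtain ⟨a, -, ha, he⟩ := i4 j
      rw [hCdef]
      dsimp only
      rw [ha, Nat.add_sub_cancel, r1]
      exact he
    have hlow : ∀ j : Fin m, s₂.real 2 (s₂.int 6 j - 1) = I.low j := fun j => by
      obtain ⟨a, -, ha, he⟩ := i6 j
      rw [ha, Nat.add_sub_cancel, r2]
      exact he
    obtain ⟨-, -, -, hcap, hramp⟩ := h₃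
    have hRD : Instance.IsRampData (fun k => L (σ k)) (fun k => E (σ k)) (fun k => P (σ k)) C
        (n + n) Q V := by
      refine ⟨fun k hk => ?_, fun k hk => ?_, fun k hk => ?_, fun k hk => ?_⟩
      · rw [(h₄ k hk).1, (hramp k hk).1]
      · rw [(h₄ k hk).2.1, (hramp k hk).2]
      · rw [(h₄ k hk).2.2.1, (hramp k hk).1, hcap, f₃.int 7 (by decide), f₃.int 10 (by decide)]
      · rw [(h₄ k hk).2.2.2, (hramp k hk).2]
    -- Nonnegativity of the reciprocals does not depend on the part; any part will do, and `i < 4n`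
    -- ensures that there is an item.
    have hQ0 : ∀ i < n + n + (n + n), 0 ≤ Q i := fun i hi =>
      hRD.loc_nonneg (hL.isLevelSeq hσ' (I.part ⟨0, by omega⟩)).e_nonneg hi
    have q5 : s₆.real 5 = Q := by rw [f₆.real 5 (by decide), f₅.real 5 (by decide)]
    have q13 : s₆.real 13 = V := by rw [f₆.real 13 (by decide), f₅.real 13 (by decide)]
    have q0 : s₆.real 0 0 = I.Γ := by
      rw [f₆.real 0 (by decide), f₅.real 0 (by decide), f₄.real 0 (by decide),
        f₃.real 0 (by decide), f₂.real 0 (by decide), f₁.real 0 (by decide)]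
      simp [Instance.input]
    have q14 : s₆.real 14 0 = ∑ j, min (I.low j) (I.minC j) := by
      rw [f₆.real 14 (by decide), h₅, Finset.sum_range]
      refine Finset.sum_congr rfl fun j _ => ?_
      rw [f₄.real 1 (by decide), f₄.real 2 (by decide), f₄.int 4 (by decide),
        f₄.int 6 (by decide), f₃.real 1 (by decide), f₃.real 2 (by decide), f₃.int 4 (by decide),
        f₃.int 6 (by decide), hlow, ← hC]
    have hf : ∀ π, 0 ≤ π → I.f π =
        rampSum (s₆.real 0 0) (s₆.real 14 0) (s₆.real 5) (s₆.real 13) (n + n + (n + n)) π :=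
      fun π hπ => by
        rw [hL.f_eq_sum hσ' hC hRD hπ, q0, q14, q5, q13, rampSum]
    have hτ' : Sorts (s₆.real 5) (n + n + (n + n)) (s₆.int 10) := by
      rw [f₆.real 5 (by decide)]
      exact hτ
    refine ((runs_sweep (s := s₆) (by
      rw [f₆.int 9 (by decide), f₅.int 9 (by decide), f₄.int 9 (by decide), f₃.int 9 (by decide),
        f₂.int 9 (by decide), h₁.numRamps]) hτ' (q5 ▸ hQ0) (q0 ▸ I.Γ_nonneg) (by
      rw [f₆.real 15 (by decide), f₅.real 15 (by decide), f₄.real 15 (by decide),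
        f₃.real 15 (by decide), f₂.real 15 (by decide), f₁.real 15 (by decide)]
      simp [Instance.input]) (by
      rw [f₆.real 16 (by decide), f₅.real 16 (by decide), f₄.real 16 (by decide),
        f₃.real 16 (by decide), f₂.real 16 (by decide), f₁.real 16 (by decide)]
      simp [Instance.input]) hf).seq fun s₇ ⟨⟨hval, hπ, hmin⟩, f₇⟩ =>
      (runs_selectLoop (s := s₇) (n := n) (by
        rw [f₇.int 0 (by decide), f₆.int 0 (by decide), f₅.int 0 (by decide), f₄.int 0 (by decide),
          f₃.int 0 (by decide), f₂.int 0 (by decide), f₁.int 0 (by decide)]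
        simp [Instance.input]) fun i => by
        rw [f₇.int 2 (by decide), f₆.int 2 (by decide), f₅.int 2 (by decide), f₄.int 2 (by decide),
          f₃.int 2 (by decide), f₂.int 2 (by decide), f₁.int 2 (by decide)]
        simp [Instance.input]).mono le_rfl fun s₈ ⟨h₈, f₈⟩ => ?_).mono le_rfl fun _ h => h
    have k1 : s₇.int 1 = I.input.int 1 := by
      rw [f₇.int 1 (by decide), f₆.int 1 (by decide), f₅.int 1 (by decide), f₄.int 1 (by decide),
        f₃.int 1 (by decide), f₂.int 1 (by decide), f₁.int 1 (by decide)]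
    have k4 : s₇.int 4 = s₂.int 4 := by
      rw [f₇.int 4 (by decide), f₆.int 4 (by decide), f₅.int 4 (by decide), f₄.int 4 (by decide),
        f₃.int 4 (by decide)]
    have k6 : s₇.int 6 = s₂.int 6 := by
      rw [f₇.int 6 (by decide), f₆.int 6 (by decide), f₅.int 6 (by decide), f₄.int 6 (by decide),
        f₃.int 6 (by decide)]
    have l1 : s₇.real 1 = s₂.real 1 := by
      rw [f₇.real 1 (by decide), f₆.real 1 (by decide), f₅.real 1 (by decide),
        f₄.real 1 (by decide), f₃.real 1 (by decide)]
    have l2 : s₇.real 2 = s₂.real 2 := by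
      rw [f₇.real 2 (by decide), f₆.real 2 (by decide), f₅.real 2 (by decide),
        f₄.real 2 (by decide), f₃.real 2 (by decide)]
    have l12 : s₇.real 12 = s₃.real 12 := by
      rw [f₇.real 12 (by decide), f₆.real 12 (by decide), f₅.real 12 (by decide),
        f₄.real 12 (by decide)]
    have o4 : s₈.real 4 = s₇.real 4 := f₈.real 4 (by decide)
    have o5 : s₈.real 5 = Q := by rw [f₈.real 5 (by decide), f₇.real 5 (by decide), q5]
    have o3 : s₈.int 3 0 = n + n + (n + n) := by
      rw [f₈.int 3 (by decide), f₇.int 3 (by decide), f₆.int 3 (by decide), f₅.int 3 (by decide),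
        f₄.int 3 (by decide), f₃.int 3 (by decide), f₂.int 3 (by decide), h₁.numBreakpoints]
    have hx : ∀ i, outX n s₈ i = 0 ∨ outX n s₈ i = 1 := fun i => by
      simpa [outX] using (h₈ i i.2).1
    have hsel := I.selection_spec hL hσ' hC i4 hπ hx fun i => by
      have := (h₈ i i.2).2
      rw [k1, I.input_part, k4, k6, l1, l2, l12, r1, hlow, hcap] at this
      rw [← this, outX, Nat.cast_eq_one]
    have hopt := I.isOptimal_of_min hx hπ (fun π' hπ' => hval ▸ hmin π' hπ') hsel
    rw [← hval] at hopt
    have hB : outBreakpoints s₈ = (Finset.range (n + n + (n + n))).image Q := by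
      rw [outBreakpoints, o3, o5]
    rw [outValue, outPi, o4, hB]
    refine ⟨⟨⟨_, hπ, hval.symm⟩, ?_⟩, hopt.1, hopt.2, Finset.card_image_le.trans (by rw [Finset.card_range]; omega), ?_⟩
    · rintro _ ⟨π, hπ', rfl⟩
      exact hmin π hπ'
    refine piecewiseLinearWith_ramps (γ := I.Γ) (β := s₆.real 14 0) (V := V) fun π hπ => ?_
    rw [hf π hπ, q0, q5, q13, rampSum]
  -- All phases are compared with `(n + 1) * (c + 1)`, so that only linear arithmetic remains.
  · have h1 : (n + n + 1) * (Nat.clog 2 (n + n) + 1) ≤ 2 * ((n + 1) * (c + 1)) := by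
      rw [← mul_assoc]
      exact Nat.mul_le_mul (by omega) (by omega)
    have h2 : (n + n + (n + n) + 1) * (c + 1) ≤ 4 * ((n + 1) * (c + 1)) := by
      rw [← mul_assoc]
      exact Nat.mul_le_mul_right _ (by omega)
    have h3 : n + 1 ≤ (n + 1) * (c + 1) := Nat.le_mul_of_pos_right _ (Nat.succ_pos _)
    have h4 : runningTime n = 6000 * ((n + 1) * (c + 1)) := by rw [runningTime, mul_assoc]
    rw [h4, ← hc]
    omega

end RepSel

theorem theorem1 :
    ∃ (P : RealRAM.Prog) (time : ℕ → ℕ) (K : ℕ),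
      -- the running time is `O(n log n)`
      ((fun n : ℕ => (time n : ℝ)) =O[Filter.atTop] fun n : ℕ => (n : ℝ) * Real.log (n : ℝ)) ∧
      ∀ (n m : ℕ) (I : RepSel.Instance n m),
        -- the optimal value is the minimum of `f` over `π ≥ 0`
        (∀ (x : Fin n → ℝ) (v : ℝ), I.IsOptimal x v → IsLeast (I.f '' Set.Ici 0) v) ∧
        -- `f_j` is the optimal value of a parametric continuous knapsack problem
        (∀ (j : Fin m) (π : ℝ), 0 ≤ π →
          IsLeast (I.partValues j π) (I.fPart j π) ∧
          IsLeast (I.knapsackValues j π) (I.fPart j π)) ∧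
        -- the program halts in time, and its output is correct
        ∃ (s : RealRAM.State) (t : ℕ), RealRAM.Exec P I.input s t ∧ t ≤ time n ∧
          I.IsOptimal (RepSel.outX n s) (RepSel.outValue s) ∧
          I.IsMIPOptimal (RepSel.outX n s) (RepSel.outPi s) (RepSel.outValue s) ∧
          (RepSel.outBreakpoints s).card ≤ K * n ∧
          RepSel.PiecewiseLinearWith I.f (RepSel.outBreakpoints s) := by
  refine ⟨RepSel.program, RepSel.runningTime, 4, RepSel.runningTime_isBigO, fun n m I => ?_⟩
  obtain ⟨s, t, hexec, ht, hleast, hopt, hout⟩ := RepSel.runs_program I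
  -- The optimal value is unique, so the statement about the computed value holds for every optimal
  -- pair.
  exact ⟨fun x v h => h.unique I hopt ▸ hleast,
    fun j π hπ => ⟨I.isLeast_partValues j hπ, I.isLeast_knapsackValues j hπ⟩,
    s, t, hexec, ht, hopt, hout⟩
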